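/- \textbf{Definitions.} Let $\mu_k(X_1,\dots,X_k)$ be the Magnus commutator, i.e. the coefficient of $t_1\cdots t_k$ in the formal noncommutative series $\log(\exp(t_1X_1)\cdots\exp(t_kX_k))$, and let $\mathrm{BCH}_{n,m}(X_1,X_2)$ be the component of $\log(\exp(X_1)\exp(X_2))$ of degree $n$ in $X_1$ and $m$ in $X_2$. These are commutator polynomials, so each of them is the commutator expansion of a unique element $\mu_k^{\mathrm{Lie}}$, respectively $\mathrm{BCH}^{\mathrm{Lie}}_{n,m}$, of the free Lie algebra over $\mathbb R$. For a noncommutative polynomial let $|\cdot|_{\ell^1}$ be the sum of the absolute values of its coefficients. For a homogeneous element $P$ of the free Lie algebra of given multidegree let $\|P\|_{\ell^1}$ be the infimum of $\sum_\gamma|\theta_\gamma|$ over all presentations $P=\sum_\gamma\theta_\gamma\gamma$ ($\theta_\gamma\in\mathbb R$, finite sum) by Lie monomials $\gamma$ (iterated brackets of the variables) of that multidegree. Put \[\Theta_k=\tfrac1{k!}|\mu_k|_{\ell^1},\quad \Theta_k^{\mathrm{Lie}}=\tfrac1{k!}\|\mu_k^{\mathrm{Lie}}\|_{\ell^1},\quad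 \Gamma_{n,m}=|\mathrm{BCH}_{n,m}|_{\ell^1},\quad \Gamma^{\mathrm{Lie}}_{n,m}=\|\mathrm{BCH}^{\mathrm{Lie}}_{n,m}\|_{\ell^1},\] and, for $x,y\ge0$, with values in $[0,\infty]$, $\Theta(x)=\sum_{k\ge1}\Theta_kx^k$, $\Gamma(x,y)=\sum_{n,m\ge0}\Gamma_{n,m}x^ny^m$, and likewise $\Theta^{\mathrm{Lie}}(x)$, $\Gamma^{\mathrm{Lie}}(x,y)$. Let $\mathrm C^{\mathrm{Lie}}_\infty$ be the convergence radius of $\Theta^{\mathrm{Lie}}$, let \[\mathrm C_2=\sup\Bigl\{x\ge0:\sup_{x_1,x_2\ge0,\;x_1+x_2\le x}\Gamma(x_1,x_2)<\infty\Bigr\},\] let $\mathrm C_2^{\mathrm{Lie}}$ be defined in the same way from $\Gamma^{\mathrm{Lie}}$, and let $\mathrm D_2^{\mathrm{Lie}}=\sup\{x\ge0:\Gamma^{\mathrm{Lie}}(\frac x2,\frac x2)<\infty\}$. \textbf{Theorem.} (1) For all $n\ge1$ and $x\ge0$, \[\Theta_n\le 2^{n-1}\Theta_n^{\mathrm{Lie}},\qquad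 2\,\Theta\left(\tfrac x2\right)\le\Theta^{\mathrm{Lie}}(x),\qquad \Theta^{\mathrm{Lie}}_n\le\tfrac1n\Theta_n,\] \[\Theta^{\mathrm{Lie}}(x)\le\int_0^1\frac{\Theta(xt)}t\,dt=\int_0^x\frac{\Theta(t)}t\,dt.\] Moreover $2\le\mathrm C^{\mathrm{Lie}}_\infty\le4$. (2) For all $n,m\ge0$ with $n+m\ge1$ and all $x,y\ge0$, \[\Gamma_{n,m}\le2^{n+m-1}\Gamma^{\mathrm{Lie}}_{n,m},\quad 2\,\Gamma\left(\tfrac x2,\tfrac y2\right)\le\Gamma^{\mathrm{Lie}}(x,y),\quad \Gamma^{\mathrm{Lie}}_{n,m}\le\tfrac1{n+m}\Gamma_{n,m},\quad \Gamma^{\mathrm{Lie}}(x,y)\le\int_0^1\frac{\Gamma(xt,yt)}t\,dt.\] Moreover $\mathrm C_2\le\mathrm C_2^{\mathrm{Lie}}\le\mathrm D_2^{\mathrm{Lie}}\le2\,\mathrm C_2$. -/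

import Mathlib

open MeasureTheory
open scoped ENNReal NNReal Nat

noncomputable section

namespace MagnusLie

/-! ### Formal series: `log (exp (t₁ X₁) ⋯ exp (tₖ Xₖ))` -/

/-- The formal series `exp (tᵢ Xᵢ) = ∑ₙ tᵢⁿ Xᵢⁿ / n!`, a power series in commuting variables
`t₁, …, tₖ` whose coefficients are noncommutative real polynomials in `X₁, …, Xₖ`. -/
def expVar {k : ℕ} (i : Fin k) : MvPowerSeries (Fin k) (FreeAlgebra ℝ (Fin k)) :=
  fun d => if d = Finsupp.single i (d i)
    then (((d i)! : ℝ)⁻¹) • (FreeAlgebra.ι ℝ i) ^ (d i) else 0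

/-- The formal logarithm `log f = ∑_{n ≥ 1} (-1)ⁿ⁺¹ (f - 1)ⁿ / n` of a power series `f` with
constant coefficient `1`. In each multidegree `d` only the terms with `n ≤ |d|` contribute. -/
def formalLog {k : ℕ} (f : MvPowerSeries (Fin k) (FreeAlgebra ℝ (Fin k))) :
    MvPowerSeries (Fin k) (FreeAlgebra ℝ (Fin k)) :=
  fun d => ∑ n ∈ Finset.Icc 1 d.degree,
    ((-1 : ℝ) ^ (n + 1) / (n : ℝ)) • MvPowerSeries.coeff d ((f - 1) ^ n)

/-- The coefficient of `t₁^{d₁} ⋯ tₖ^{dₖ}` in `log (exp (t₁ X₁) ⋯ exp (tₖ Xₖ))`; that is, the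
component of `log (exp X₁ ⋯ exp Xₖ)` of multidegree `d` in `X₁, …, Xₖ`. -/
def logComponent {k : ℕ} (d : Fin k →₀ ℕ) : FreeAlgebra ℝ (Fin k) :=
  MvPowerSeries.coeff d (formalLog (List.ofFn (fun i : Fin k => expVar i)).prod)

/-- The multidegree `(1, …, 1)`. -/
def onesDegree (k : ℕ) : Fin k →₀ ℕ := Finsupp.equivFunOnFinite.symm (fun _ => 1)

/-- The bidegree `(n, m)`. -/
def bidegree (n m : ℕ) : Fin 2 →₀ ℕ := Finsupp.equivFunOnFinite.symm ![n, m]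

/-- The Magnus commutator `μₖ(X₁, …, Xₖ)`: the value at `t = 0` of
`∂ᵏ / ∂t₁ ⋯ ∂tₖ` of `log (exp (t₁ X₁) ⋯ exp (tₖ Xₖ))`. -/
def magnus (k : ℕ) : FreeAlgebra ℝ (Fin k) := logComponent (onesDegree k)

/-- The component of `log (exp X₁ exp X₂)` of bidegree `(n, m)`. -/
def bch (n m : ℕ) : FreeAlgebra ℝ (Fin 2) := logComponent (bidegree n m)

/-! ### The associative `ℓ¹` norm -/

/-- The sum of the absolute values of the coefficients of a noncommutative polynomial. -/
def assocNorm {X : Type} (P : FreeAlgebra ℝ X) : ℝ≥0∞ :=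
  ENNReal.ofReal
    ((FreeAlgebra.equivMonoidAlgebraFreeMonoid P).coeff.sum (fun _ c => |c|))

/-! ### Lie monomials and the Lie `ℓ¹` norm -/

attribute [local instance] LieRing.ofAssociativeRing

/-- The commutator expansion, i.e. the canonical homomorphism of Lie algebras from the free Lie
algebra to the free associative algebra with its commutator bracket. -/
def commutatorExpansion (X : Type) : FreeLieAlgebra ℝ X →ₗ⁅ℝ⁆ FreeAlgebra ℝ X :=
  FreeLieAlgebra.lift ℝ (FreeAlgebra.ι ℝ)

/-- The Lie polynomial associated to a commutator polynomial `Q`: the element of the free Lie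
algebra with commutator expansion `Q`. (It is unique, as the commutator expansion is injective;
the value is meaningless when `Q` is not a commutator polynomial.) -/
def lieOf {X : Type} (Q : FreeAlgebra ℝ X) : FreeLieAlgebra ℝ X :=
  Classical.epsilon (fun P => commutatorExpansion X P = Q)

/-- The Lie monomial given by a bracketing `γ`, i.e. by a nonempty binary planar tree with
leaves labelled by the variables. -/
def lieMonomial {X : Type} : FreeMagma X → FreeLieAlgebra ℝ X
  | .of x => FreeLieAlgebra.of ℝ x
  | .mul a b => ⁅lieMonomial a, lieMonomial b⁆

/-- The multidegree of a bracketing: how often each variable occurs. -/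
def multidegree {X : Type} : FreeMagma X → (X →₀ ℕ)
  | .of x => Finsupp.single x 1
  | .mul a b => multidegree a + multidegree b

/-- The `ℓ¹` Lie norm in multidegree `d`: the infimum of `∑ |θ_γ|` over all presentations
`P = ∑ θ_γ γ` with real coefficients in terms of Lie monomials `γ` of multidegree `d`. -/
def lieNorm {X : Type} (d : X →₀ ℕ) (P : FreeLieAlgebra ℝ X) : ℝ≥0∞ :=
  ⨅ (θ : FreeMagma X →₀ ℝ) (_ : ∀ γ ∈ θ.support, multidegree γ = d)
    (_ : θ.sum (fun γ c => c • lieMonomial γ) = P),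
    ENNReal.ofReal (θ.sum (fun _ c => |c|))

/-! ### The Magnus and BCH characteristics -/

/-- `Θₖ = |μₖ|_{ℓ¹} / k!`. -/
def Theta (k : ℕ) : ℝ≥0∞ := assocNorm (magnus k) / (k ! : ℝ≥0∞)

/-- `Θₖ^Lie = ‖μₖ^Lie‖_{ℓ¹} / k!`, where the Lie monomials are those in which each of
`X₁, …, Xₖ` occurs exactly once. -/
def ThetaLie (k : ℕ) : ℝ≥0∞ := lieNorm (onesDegree k) (lieOf (magnus k)) / (k ! : ℝ≥0∞)

/-- `Γ_{n,m}`, the `ℓ¹` norm of the BCH component of bidegree `(n, m)`. -/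
def Gam (n m : ℕ) : ℝ≥0∞ := assocNorm (bch n m)

/-- `Γ_{n,m}^Lie`, the `ℓ¹` Lie norm of the BCH component of bidegree `(n, m)`. -/
def GamLie (n m : ℕ) : ℝ≥0∞ := lieNorm (bidegree n m) (lieOf (bch n m))

/-- The value in `[0, ∞]` of `∑_{k ≥ 1} aₖ xᵏ`. -/
def seriesOne (a : ℕ → ℝ≥0∞) (x : ℝ≥0) : ℝ≥0∞ :=
  ∑' k : ℕ, a (k + 1) * (x : ℝ≥0∞) ^ (k + 1)

/-- The value in `[0, ∞]` of `∑_{n, m ≥ 0} a_{n,m} xⁿ yᵐ`. -/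
def seriesTwo (a : ℕ → ℕ → ℝ≥0∞) (x y : ℝ≥0) : ℝ≥0∞ :=
  ∑' (n : ℕ) (m : ℕ), a n m * (x : ℝ≥0∞) ^ n * (y : ℝ≥0∞) ^ m

/-- The convergence radius of `∑_{k ≥ 1} aₖ xᵏ` with `aₖ ≥ 0`. -/
def convRadius (a : ℕ → ℝ≥0∞) : ℝ≥0∞ :=
  ⨆ (x : ℝ≥0) (_ : seriesOne a x < ∞), (x : ℝ≥0∞)

/-- The cumulative convergence radius: the supremum of all `x ≥ 0` for which the maximum of
`F(x₁, x₂) = ∑ a_{n,m} x₁ⁿ x₂ᵐ` over `x₁, x₂ ≥ 0`, `x₁ + x₂ ≤ x` is finite. -/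
def cumulativeRadius (a : ℕ → ℕ → ℝ≥0∞) : ℝ≥0∞ :=
  ⨆ (x : ℝ≥0) (_ : (⨆ (x₁ : ℝ≥0) (x₂ : ℝ≥0) (_ : x₁ + x₂ ≤ x), seriesTwo a x₁ x₂) < ∞),
    (x : ℝ≥0∞)

/-- The diagonal convergence radius: the supremum of all `x ≥ 0` with `F(x/2, x/2)` finite. -/
def diagonalRadius (a : ℕ → ℕ → ℝ≥0∞) : ℝ≥0∞ :=
  ⨆ (x : ℝ≥0) (_ : seriesTwo a (x / 2) (x / 2) < ∞), (x : ℝ≥0∞)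

end MagnusLie

end

/-!
# Lie norms of the Magnus and Baker–Campbell–Hausdorff expansions

*Coefficientwise inequalities.* A Lie monomial of degree `n` expands into `2 ^ (n - 1)` signed
words, which gives `assocNorm_commutatorExpansion_le`. Conversely, right-nested bracketing
multiplies Lie polynomials of degree `n` by `n` (Dynkin–Specht–Wever, `smul_eq_nestedBracket`); it
presents a Lie polynomial by as many monomials as its expansion has words, which gives
`lieNorm_le_assocNorm_div`, and it shows that the commutator expansion is injective. The components
of `log (exp X₁ ⋯ exp Xₖ)` are commutator polynomials because the logarithm of a grouplike series is
primitive (`comulSeries_logProd`) and because the Dynkin operator is the convolution of the Euler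
derivation with the antipode (`eulerAntipode_comul`). The inequalities between the generating
functions follow by summation and termwise integration.

*The Lie convergence radius of the Magnus expansion.* The logarithm is the mean over `s ∈ [0, 1]` of
the resolvents `z / (1 + (1 - s) z)`, and in the resolvent of `exp (t₁ X₁) ⋯ exp (tₖ Xₖ) - 1` each
ascent of a word contributes a factor `s` and each descent a factor `-(1 - s)`. So the coefficient
of a permutation with `a` ascents and `d` descents in the Magnus commutator is `± a! d! / k!`
(`wordCoeff_magnus`). Estimating these numbers from both sides gives
`1 / (k 2 ^ (k - 1)) ≤ Θₖ ≤ 1 / 2 ^ (k - 1)`, and the coefficientwise inequalities turn this into the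
bounds `2` and `4`.

*The diagonal radius of the Baker–Campbell–Hausdorff expansion.* Let `Γ^Lie(s, s)` be finite. For
`p ∈ [0, 1]` there are unit vectors `H₀, H₁` of `sl₂(ℝ)`, with respect to a norm that is
submultiplicative for the commutator (`lieSq_commutator_le`), such that
`tr (exp (t H₀) exp (t H₁)) = 2 - (1 - p²) S(t)²`, where `S` is a sine with parameter
`δ = (1 - 2 p²) / 4`. For `t ≤ s` the product is the exponential of a traceless real matrix, the sum
of the Baker–Campbell–Hausdorff series, hence its trace is at least `-2` (`genSin_sq_le`), and it
follows that `w = C - (p / 2) S` has no zero on `[0, s)` (`majDen_pos`), `C` being the cosine that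
belongs to `S`. On the associative side, the resolvent with parameter `l` of a single exponential is
majorized by `S / w` with `p = |1 - 2 l|`: both satisfy Riccati equations whose coefficients agree
up to sign (`tsum_enorm_coeff_expResolvent_le`). The resolvent of a product of two exponentials is a
rational expression in the two resolvents (`resolvent_product`), and the addition formulas for `S`
and `C` turn the resulting estimate at `(x, y)` into a fraction with denominator `w(x + y)`
(`weightedNorm_resolvent_le`). By compactness this is bounded for `x + y ≤ x' < s`, uniformly in
`p`, and integration over the parameter of the resolvent bounds `Γ(x, y)`. Thus finiteness of
`Γ^Lie(s, s)` implies that `s` is at most the cumulative radius of `Γ`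
(`diagonalRadius_GamLie_le`).
-/

namespace MagnusLie

/-! ### Evaluation of real power series at noncommutative formal series -/

section FormalCalculus

variable {σ B C : Type*} [Ring B]

open MvPowerSeries in
theorem coeff_pow_eq_zero_of_degree_lt {f : MvPowerSeries σ B} (hf : constantCoeff f = 0)
    (n : ℕ) {d : σ →₀ ℕ} (hd : d.degree < n) : coeff d (f ^ n) = 0 := by
  classical
  induction n generalizing d with
  | zero => omega
  | succ n ih =>
    rw [pow_succ', coeff_mul]
    refine Finset.sum_eq_zero fun p hp => ?_
    rw [Finset.HasAntidiagonal.mem_antidiagonal] at hp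
    by_cases h0 : p.1 = 0
    · rw [h0, coeff_zero_eq_constantCoeff_apply, hf, zero_mul]
    · have h1 : p.1.degree ≠ 0 := by simpa [Finsupp.degree_eq_zero_iff] using h0
      have h2 : p.1.degree + p.2.degree = d.degree := by rw [← hp, map_add]
      rw [ih (by omega), mul_zero]

variable [Algebra ℝ B] [Ring C] [Algebra ℝ C]

/-- The value `∑ₙ aₙ fⁿ` of a real power series `a` at a formal series `f` with noncommuting
coefficients. The definition is meaningful when `f` has zero constant coefficient: in
multidegree `d` only the terms with `n ≤ |d|` contribute then. -/
noncomputable def evalAt (f : MvPowerSeries σ B) (a : PowerSeries ℝ) : MvPowerSeries σ B :=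
  fun d => ∑ n ∈ Finset.range (d.degree + 1), a.coeff n • MvPowerSeries.coeff d (f ^ n)

open MvPowerSeries in
theorem coeff_evalAt (f : MvPowerSeries σ B) (a : PowerSeries ℝ) (d : σ →₀ ℕ) :
    coeff d (evalAt f a) = ∑ n ∈ Finset.range (d.degree + 1), a.coeff n • coeff d (f ^ n) := rfl

open MvPowerSeries in
theorem coeff_evalAt_of_le {f : MvPowerSeries σ B} (hf : constantCoeff f = 0)
    (a : PowerSeries ℝ) {d : σ →₀ ℕ} {N : ℕ} (hN : d.degree ≤ N) :
    coeff d (evalAt f a) = ∑ n ∈ Finset.range (N + 1), a.coeff n • coeff d (f ^ n) := by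
  rw [coeff_evalAt]
  refine Finset.sum_subset (Finset.range_mono (by omega)) fun n _ hn => ?_
  rw [coeff_pow_eq_zero_of_degree_lt hf n (by simpa using hn), smul_zero]

open MvPowerSeries in
theorem coeff_aeval_eq_sum {f : MvPowerSeries σ B} (hf : constantCoeff f = 0)
    (p : Polynomial ℝ) {d : σ →₀ ℕ} {N : ℕ} (hN : d.degree ≤ N) :
    coeff d (Polynomial.aeval f p) =
      ∑ n ∈ Finset.range (N + 1), p.coeff n • coeff d (f ^ n) := by
  rw [Polynomial.aeval_eq_sum_range' (n := max p.natDegree N + 1)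
    (Nat.lt_succ_of_le (le_max_left _ _)), map_sum]
  symm
  refine Finset.sum_subset_zero_on_sdiff (Finset.range_mono (by omega)) (fun n hn => ?_)
    fun n _ => rfl
  have : d.degree < n := by
    simp only [Finset.mem_sdiff, Finset.mem_range, not_lt] at hn
    omega
  change p.coeff n • coeff d (f ^ n) = 0
  rw [coeff_pow_eq_zero_of_degree_lt hf n this, smul_zero]

open MvPowerSeries in
/-- Both sides only depend on truncations of `a` and `b`, so the claim reduces to the
multiplicativity of polynomial evaluation. -/
theorem evalAt_mul {f : MvPowerSeries σ B} (hf : constantCoeff f = 0) (a b : PowerSeries ℝ) :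
    evalAt f (a * b) = evalAt f a * evalAt f b := by
  classical
  ext d
  set N := d.degree
  have key : ∀ (c : PowerSeries ℝ) (e : σ →₀ ℕ), e.degree ≤ N →
      coeff e (evalAt f c) = coeff e (Polynomial.aeval f (PowerSeries.trunc (N + 1) c)) := by
    intro c e he
    rw [coeff_evalAt_of_le hf c he, coeff_aeval_eq_sum hf _ he]
    refine Finset.sum_congr rfl fun n hn => ?_
    rw [PowerSeries.coeff_trunc, if_pos (Finset.mem_range.1 hn)]
  have h1 : coeff d (evalAt f a * evalAt f b) = coeff d (Polynomial.aeval f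
      (PowerSeries.trunc (N + 1) a * PowerSeries.trunc (N + 1) b)) := by
    rw [map_mul (Polynomial.aeval f), coeff_mul, coeff_mul]
    refine Finset.sum_congr rfl fun p hp => ?_
    have h2 : p.1.degree + p.2.degree = d.degree := by
      rw [← Finset.HasAntidiagonal.mem_antidiagonal.1 hp, map_add]
    rw [key a _ (by omega), key b _ (by omega)]
  rw [h1, coeff_aeval_eq_sum hf _ le_rfl, coeff_evalAt]
  refine Finset.sum_congr rfl fun n hn => ?_
  congr 1
  rw [PowerSeries.coeff_mul, Polynomial.coeff_mul]
  refine Finset.sum_congr rfl fun p hp => ?_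
  have h2 := Finset.HasAntidiagonal.mem_antidiagonal.1 hp
  have h3 := Finset.mem_range.1 hn
  rw [PowerSeries.coeff_trunc, PowerSeries.coeff_trunc, if_pos (by omega), if_pos (by omega)]

theorem evalAt_add (f : MvPowerSeries σ B) (a b : PowerSeries ℝ) :
    evalAt f (a + b) = evalAt f a + evalAt f b := by
  ext d
  simp only [map_add, coeff_evalAt, add_smul, Finset.sum_add_distrib]

theorem evalAt_smul (f : MvPowerSeries σ B) (r : ℝ) (a : PowerSeries ℝ) :
    evalAt f (r • a) = r • evalAt f a := by
  ext d
  change _ = r • MvPowerSeries.coeff d (evalAt f a)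
  simp only [coeff_evalAt, PowerSeries.coeff_smul, smul_eq_mul, mul_smul, Finset.smul_sum]

theorem evalAt_sub (f : MvPowerSeries σ B) (a b : PowerSeries ℝ) :
    evalAt f (a - b) = evalAt f a - evalAt f b := by
  ext d
  simp only [map_sub, coeff_evalAt, sub_smul, Finset.sum_sub_distrib]

theorem evalAt_one (f : MvPowerSeries σ B) : evalAt f 1 = 1 := by
  ext d
  rw [coeff_evalAt, Finset.sum_eq_single 0] <;> simp +contextual [PowerSeries.coeff_one]

theorem evalAt_X {f : MvPowerSeries σ B} (hf : MvPowerSeries.constantCoeff f = 0) :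
    evalAt f PowerSeries.X = f := by
  ext d
  rw [coeff_evalAt_of_le hf _ (Nat.le_succ _), Finset.sum_eq_single 1]
  · simp
  · intro n _ hn
    simp [PowerSeries.coeff_X, hn]
  · simp

theorem evalAt_pow {f : MvPowerSeries σ B} (hf : MvPowerSeries.constantCoeff f = 0)
    (a : PowerSeries ℝ) (n : ℕ) : evalAt f (a ^ n) = evalAt f a ^ n := by
  induction n with
  | zero => simp [evalAt_one]
  | succ n ih => rw [pow_succ, pow_succ, evalAt_mul hf, ih]

theorem constantCoeff_evalAt (f : MvPowerSeries σ B) (a : PowerSeries ℝ) :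
    MvPowerSeries.constantCoeff (evalAt f a) = algebraMap ℝ B (a.coeff 0) := by
  rw [← MvPowerSeries.coeff_zero_eq_constantCoeff_apply, coeff_evalAt]
  simp [Algebra.algebraMap_eq_smul_one]

open MvPowerSeries in
theorem evalAt_subst {f : MvPowerSeries σ B} (hf : constantCoeff f = 0)
    {b : PowerSeries ℝ} (hb : PowerSeries.constantCoeff b = 0) (a : PowerSeries ℝ) :
    evalAt f (a.subst b) = evalAt (evalAt f b) a := by
  ext d
  have hsub : PowerSeries.HasSubst b := PowerSeries.HasSubst.of_constantCoeff_zero' hb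
  have hlt : ∀ m n : ℕ, m < n → PowerSeries.coeff m (b ^ n) = 0 := fun m n h =>
    PowerSeries.coeff_of_lt_order m (lt_of_lt_of_le (by exact_mod_cast h)
      (PowerSeries.le_order_pow_of_constantCoeff_eq_zero n hb))
  rw [coeff_evalAt, coeff_evalAt]
  have h1 : ∀ n, coeff d (evalAt f b ^ n) = ∑ m ∈ Finset.range (d.degree + 1),
      PowerSeries.coeff m (b ^ n) • coeff d (f ^ m) := by
    intro n
    rw [← evalAt_pow hf, coeff_evalAt]
  simp only [h1, Finset.smul_sum]
  rw [Finset.sum_comm]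
  refine Finset.sum_congr rfl fun m hm => ?_
  rw [PowerSeries.coeff_subst' hsub,
    finsum_eq_sum_of_support_subset (s := Finset.range (d.degree + 1)), Finset.sum_smul]
  · simp only [smul_eq_mul, mul_smul]
  · intro n hn
    by_contra hcon
    apply hn
    have h3 := Finset.mem_range.1 hm
    simp only [Finset.coe_range, Set.mem_Iio, not_lt] at hcon
    simp [hlt m n (by omega)]

theorem map_evalAt (T : B →ₐ[ℝ] C) (f : MvPowerSeries σ B) (a : PowerSeries ℝ) :
    MvPowerSeries.map (T : B →+* C) (evalAt f a) =
      evalAt (MvPowerSeries.map (T : B →+* C) f) a := by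
  ext d
  simp only [MvPowerSeries.coeff_map, coeff_evalAt, map_sum, ← map_pow, RingHom.coe_coe, map_smul]

/-! ### Formal exponential and logarithm -/

/-- Proved by differentiation: with `c = exp ∘ log` and `l = log'`, one has `c' = c l` and
`l' = -l²`, so `c l` is constant. -/
theorem exp_subst_log :
    (PowerSeries.exp ℝ).subst (PowerSeries.log ℝ) = 1 + PowerSeries.X := by
  set c : PowerSeries ℝ := (PowerSeries.exp ℝ).subst (PowerSeries.log ℝ) with hc
  have hsub : PowerSeries.HasSubst (PowerSeries.log ℝ) := PowerSeries.HasSubst.log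
  have hc0 : PowerSeries.constantCoeff c = 1 := by
    have h1 : c - 1 = (PowerSeries.exp ℝ - 1).subst (PowerSeries.log ℝ) := by
      rw [← PowerSeries.coe_substAlgHom hsub, map_sub, map_one, PowerSeries.coe_substAlgHom hsub]
    have h2 : PowerSeries.constantCoeff (c - 1) = 0 := by
      rw [h1]
      exact PowerSeries.constantCoeff_subst_eq_zero PowerSeries.constantCoeff_log _ (by simp)
    rw [map_sub, map_one, sub_eq_zero] at h2
    exact h2
  have hlog : (1 + PowerSeries.X) * PowerSeries.derivative ℝ (PowerSeries.log ℝ) = 1 := by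
    rw [PowerSeries.deriv_log, add_mul, one_mul]
    ext n
    cases n with
    | zero => simp
    | succ n => simp [PowerSeries.coeff_succ_X_mul, PowerSeries.coeff_one, pow_succ]
  have hder : PowerSeries.derivative ℝ c = c * PowerSeries.derivative ℝ (PowerSeries.log ℝ) := by
    rw [hc, PowerSeries.derivative_subst hsub, PowerSeries.derivative_exp]
  set l := PowerSeries.derivative ℝ (PowerSeries.log ℝ) with hl
  have hconst : c * l = 1 := by
    apply PowerSeries.derivative.ext
    · have h3 : PowerSeries.derivative ℝ l = - l ^ 2 := by
        have h4 := congrArg (PowerSeries.derivative ℝ) hlog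
        rw [Derivation.leibniz, map_add, PowerSeries.derivative_X, PowerSeries.derivative_one,
          zero_add, smul_eq_mul, smul_eq_mul] at h4
        linear_combination l * h4 - PowerSeries.derivative ℝ l * hlog
      rw [Derivation.leibniz, hder, h3, PowerSeries.derivative_one, smul_eq_mul, smul_eq_mul]
      ring
    · have h5 := congrArg PowerSeries.constantCoeff hlog
      simp only [map_mul, map_add, map_one, PowerSeries.constantCoeff_X, add_zero, one_mul] at h5
      rw [map_mul, hc0, h5, mul_one, map_one]
  linear_combination (1 + PowerSeries.X) * hconst - c * hlog

/-- The formal exponential of a formal series without constant coefficient. -/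
noncomputable abbrev formalExp (f : MvPowerSeries σ B) : MvPowerSeries σ B :=
  evalAt f (PowerSeries.exp ℝ)

theorem formalExp_evalAt_log {f : MvPowerSeries σ B} (hf : MvPowerSeries.constantCoeff f = 0) :
    formalExp (evalAt f (PowerSeries.log ℝ)) = 1 + f := by
  rw [formalExp, ← evalAt_subst hf PowerSeries.constantCoeff_log, exp_subst_log, evalAt_add,
    evalAt_one, evalAt_X hf]

open MvPowerSeries in
theorem formalExp_add {f g : MvPowerSeries σ B} (hf : constantCoeff f = 0)
    (hg : constantCoeff g = 0) (h : Commute f g) :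
    formalExp (f + g) = formalExp f * formalExp g := by
  classical
  ext d
  set N := d.degree
  have hlhs : coeff d (formalExp (f + g)) = ∑ n ∈ Finset.range (N + 1),
      ∑ p ∈ Finset.HasAntidiagonal.antidiagonal n,
        ((p.1 ! : ℝ)⁻¹ * (p.2 ! : ℝ)⁻¹) • coeff d (f ^ p.1 * g ^ p.2) := by
    rw [formalExp, coeff_evalAt]
    refine Finset.sum_congr rfl fun n _ => ?_
    rw [h.add_pow', map_sum, Finset.smul_sum]
    refine Finset.sum_congr rfl fun p hp => ?_
    have hp' := Finset.HasAntidiagonal.mem_antidiagonal.1 hp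
    rw [map_nsmul, ← Nat.cast_smul_eq_nsmul ℝ, smul_smul, PowerSeries.coeff_exp, ← hp']
    congr 1
    have h1 := Nat.add_choose_mul_factorial_mul_factorial p.1 p.2
    rw [← Nat.choose_symm_add] at h1
    have h2 : ((p.1 + p.2)! : ℝ) = ((p.1 + p.2).choose p.1 : ℝ) * p.1 ! * p.2 ! := by
      exact_mod_cast h1.symm
    have h3 : ((p.1 + p.2)! : ℝ) ≠ 0 := by positivity
    have h4 : (p.1 ! : ℝ) ≠ 0 := by positivity
    have h5 : (p.2 ! : ℝ) ≠ 0 := by positivity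
    simp only [one_div, map_inv₀, map_natCast]
    field_simp
    linear_combination -h2
  have hrhs : coeff d (formalExp f * formalExp g) =
      ∑ p ∈ Finset.range (N + 1) ×ˢ Finset.range (N + 1),
        ((p.1 ! : ℝ)⁻¹ * (p.2 ! : ℝ)⁻¹) • coeff d (f ^ p.1 * g ^ p.2) := by
    rw [coeff_mul]
    have h1 : ∀ p ∈ Finset.HasAntidiagonal.antidiagonal d,
        coeff p.1 (formalExp f) * coeff p.2 (formalExp g) =
        ∑ q ∈ Finset.range (N + 1) ×ˢ Finset.range (N + 1),
          ((q.1 ! : ℝ)⁻¹ * (q.2 ! : ℝ)⁻¹) • (coeff p.1 (f ^ q.1) * coeff p.2 (g ^ q.2)) := by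
      intro p hp
      have h2 : p.1.degree + p.2.degree = d.degree := by
        rw [← Finset.HasAntidiagonal.mem_antidiagonal.1 hp, map_add]
      rw [formalExp, formalExp, coeff_evalAt_of_le hf _ (show p.1.degree ≤ N by omega),
        coeff_evalAt_of_le hg _ (show p.2.degree ≤ N by omega), Finset.sum_mul_sum,
        Finset.sum_product]
      refine Finset.sum_congr rfl fun i _ => Finset.sum_congr rfl fun j _ => ?_
      rw [smul_mul_smul_comm, PowerSeries.coeff_exp, PowerSeries.coeff_exp]
      simp
    rw [Finset.sum_congr rfl h1, Finset.sum_comm]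
    refine Finset.sum_congr rfl fun q _ => ?_
    rw [coeff_mul, Finset.smul_sum]
  have hvan : ∀ i j : ℕ, N < i + j → coeff d (f ^ i * g ^ j) = 0 := by
    intro i j hij
    rw [coeff_mul]
    refine Finset.sum_eq_zero fun p hp => ?_
    have h2 : p.1.degree + p.2.degree = d.degree := by
      rw [← Finset.HasAntidiagonal.mem_antidiagonal.1 hp, map_add]
    by_cases h3 : p.1.degree < i
    · rw [coeff_pow_eq_zero_of_degree_lt hf i h3, zero_mul]
    · rw [coeff_pow_eq_zero_of_degree_lt hg j (by omega), mul_zero]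
  rw [hlhs, hrhs, ← Finset.sum_filter_of_ne (p := fun p : ℕ × ℕ => p.1 + p.2 ≤ N)]
  · rw [← Finset.sum_fiberwise_of_maps_to (t := Finset.range (N + 1))
      (g := fun p : ℕ × ℕ => p.1 + p.2)]
    · refine Finset.sum_congr rfl fun n hn => Finset.sum_congr ?_ fun _ _ => rfl
      ext p
      simp only [Finset.HasAntidiagonal.mem_antidiagonal, Finset.mem_filter, Finset.mem_product,
        Finset.mem_range] at hn ⊢
      omega
    · intro p hp
      simp only [Finset.mem_filter, Finset.mem_range] at hp ⊢
      omega
  · intro p _ hp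
    by_contra hcon
    exact hp (by rw [hvan _ _ (by omega), smul_zero])

open MvPowerSeries in
/-- Comparing coefficients by induction on the degree. -/
theorem formalExp_injective {f g : MvPowerSeries σ B} (hf : constantCoeff f = 0)
    (hg : constantCoeff g = 0) (h : formalExp f = formalExp g) : f = g := by
  classical
  have key : ∀ (N : ℕ) (d : σ →₀ ℕ), d.degree = N → coeff d f = coeff d g := by
    intro N
    induction N using Nat.strong_induction_on with
    | _ N ih =>
    have hlt : ∀ (n : ℕ) (e : σ →₀ ℕ), e.degree < N → coeff e (f ^ n) = coeff e (g ^ n) := by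
      intro n
      induction n with
      | zero => intro e _; simp
      | succ n ihn =>
        intro e he
        rw [pow_succ, pow_succ, coeff_mul, coeff_mul]
        refine Finset.sum_congr rfl fun p hp => ?_
        have h2 : p.1.degree + p.2.degree = e.degree := by
          rw [← Finset.HasAntidiagonal.mem_antidiagonal.1 hp, map_add]
        rw [ihn _ (by omega), ih p.2.degree (by omega) _ rfl]
    intro d hd
    -- In degree `N` the powers with exponent at least two only involve lower coefficients.
    have htwo : ∀ n : ℕ, coeff d (f ^ (n + 2)) = coeff d (g ^ (n + 2)) := by
      intro n
      rw [pow_succ, pow_succ g, coeff_mul, coeff_mul]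
      refine Finset.sum_congr rfl fun p hp => ?_
      have h2 : p.1.degree + p.2.degree = d.degree := by
        rw [← Finset.HasAntidiagonal.mem_antidiagonal.1 hp, map_add]
      by_cases h3 : p.1.degree < n + 1
      · rw [coeff_pow_eq_zero_of_degree_lt hf _ h3, coeff_pow_eq_zero_of_degree_lt hg _ h3,
          zero_mul, zero_mul]
      · rw [ih p.2.degree (by omega) _ rfl]
        by_cases h4 : p.2.degree = 0
        · rw [Finsupp.degree_eq_zero_iff] at h4
          rw [h4, coeff_zero_eq_constantCoeff_apply, hg, mul_zero, mul_zero]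
        · rw [hlt _ _ (by omega)]
    have h5 := congrArg (coeff d) h
    rw [formalExp, formalExp, coeff_evalAt_of_le hf _ (show d.degree ≤ N + 1 by omega),
      coeff_evalAt_of_le hg _ (show d.degree ≤ N + 1 by omega), Finset.sum_range_succ',
      Finset.sum_range_succ', Finset.sum_range_succ', Finset.sum_range_succ'] at h5
    simpa [htwo, PowerSeries.coeff_exp] using h5
  ext d
  exact key _ d rfl

end FormalCalculus

/-! ### Word coefficients of noncommutative polynomials -/

section Words

variable {X : Type}

/-- The coefficient of the word `w` in a noncommutative polynomial. -/
noncomputable def wordCoeff (w : List X) : FreeAlgebra ℝ X →ₗ[ℝ] ℝ :=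
  Finsupp.lapply (FreeMonoid.ofList w) ∘ₗ
    (MonoidAlgebra.coeffLinearEquiv ℝ).toLinearMap ∘ₗ
      FreeAlgebra.equivMonoidAlgebraFreeMonoid.toLinearMap

theorem wordCoeff_apply (w : List X) (P : FreeAlgebra ℝ X) :
    wordCoeff w P =
      (FreeAlgebra.equivMonoidAlgebraFreeMonoid P).coeff (FreeMonoid.ofList w) := rfl

/-- The noncommutative monomial `x₁ ⋯ xₙ`. -/
noncomputable def wordMonomial (w : List X) : FreeAlgebra ℝ X :=
  (w.map (FreeAlgebra.ι ℝ)).prod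

theorem equiv_ι (x : X) :
    FreeAlgebra.equivMonoidAlgebraFreeMonoid (FreeAlgebra.ι ℝ x) =
      MonoidAlgebra.single (FreeMonoid.of x) (1 : ℝ) := by
  simp [FreeAlgebra.equivMonoidAlgebraFreeMonoid]

theorem equiv_wordMonomial (w : List X) :
    FreeAlgebra.equivMonoidAlgebraFreeMonoid (wordMonomial w) =
      MonoidAlgebra.single (FreeMonoid.ofList w) (1 : ℝ) := by
  induction w with
  | nil => simp [wordMonomial, MonoidAlgebra.one_def]
  | cons x w ih =>
    have : wordMonomial (x :: w) = FreeAlgebra.ι ℝ x * wordMonomial w := by simp [wordMonomial]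
    rw [this, map_mul, ih, equiv_ι, MonoidAlgebra.single_mul_single, one_mul]
    rfl

theorem wordCoeff_ext {P Q : FreeAlgebra ℝ X} (h : ∀ w, wordCoeff w P = wordCoeff w Q) :
    P = Q := by
  apply FreeAlgebra.equivMonoidAlgebraFreeMonoid.injective
  apply MonoidAlgebra.coeff_injective
  ext w
  exact h (FreeMonoid.toList w)

theorem wordCoeff_wordMonomial [DecidableEq X] (w v : List X) :
    wordCoeff w (wordMonomial v) = if w = v then 1 else 0 := by
  classical
  rw [wordCoeff_apply, equiv_wordMonomial, MonoidAlgebra.coeff_single, Finsupp.single_apply]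
  simp [eq_comm]

theorem wordCoeff_one [DecidableEq X] (w : List X) :
    wordCoeff w (1 : FreeAlgebra ℝ X) = if w = [] then 1 else 0 :=
  wordCoeff_wordMonomial w []

theorem wordCoeff_mul (w : List X) (P Q : FreeAlgebra ℝ X) :
    wordCoeff w (P * Q) = ∑ i ∈ Finset.range (w.length + 1),
      wordCoeff (w.take i) P * wordCoeff (w.drop i) Q := by
  classical
  rw [wordCoeff_apply, map_mul, MonoidAlgebra.coeff_mul_antidiag _ _ _
    ((Finset.range (w.length + 1)).image
      fun i => (FreeMonoid.ofList (w.take i), FreeMonoid.ofList (w.drop i)))]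
  · rw [Finset.sum_image]
    · rfl
    · intro i hi j hj hij
      have h1 : (w.take i).length = (w.take j).length :=
        congrArg (fun p => (FreeMonoid.toList p.1).length) hij
      simp only [List.length_take, Finset.coe_range, Set.mem_Iio] at h1 hi hj
      omega
  · intro p
    simp only [Finset.mem_image, Finset.mem_range]
    constructor
    · rintro ⟨i, _, rfl⟩
      exact congrArg FreeMonoid.ofList (List.take_append_drop i w)
    · intro h
      have h' : FreeMonoid.toList p.1 ++ FreeMonoid.toList p.2 = w := h
      refine ⟨(FreeMonoid.toList p.1).length, ?_, ?_⟩
      · rw [← h', List.length_append]; omega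
      · rw [← h', List.take_left, List.drop_left]; rfl

/-- The finite set of words occurring in a noncommutative polynomial. -/
noncomputable def wordSupport (P : FreeAlgebra ℝ X) : Finset (List X) :=
  (FreeAlgebra.equivMonoidAlgebraFreeMonoid P).coeff.support.map FreeMonoid.toList.toEmbedding

theorem mem_wordSupport {P : FreeAlgebra ℝ X} {w : List X} :
    w ∈ wordSupport P ↔ wordCoeff w P ≠ 0 := by
  rw [wordSupport, Finset.mem_map_equiv, Finsupp.mem_support_iff]
  rfl

theorem sum_wordCoeff_smul (P : FreeAlgebra ℝ X) :
    ∑ w ∈ wordSupport P, wordCoeff w P • wordMonomial w = P := by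
  classical
  apply wordCoeff_ext
  intro v
  simp only [map_sum, map_smul, wordCoeff_wordMonomial, smul_eq_mul, mul_ite, mul_one, mul_zero]
  rw [Finset.sum_ite_eq, ite_eq_left_iff]
  intro h
  rw [mem_wordSupport, not_not] at h
  exact h.symm

theorem assocNorm_eq_sum (P : FreeAlgebra ℝ X) :
    assocNorm P = ∑ w ∈ wordSupport P, ‖wordCoeff w P‖ₑ := by
  rw [assocNorm, Finsupp.sum, ENNReal.ofReal_sum_of_nonneg fun _ _ => abs_nonneg _, wordSupport,
    Finset.sum_map]
  exact Finset.sum_congr rfl fun w _ => (Real.enorm_eq_ofReal_abs _).symm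

theorem assocNorm_eq_tsum (P : FreeAlgebra ℝ X) :
    assocNorm P = ∑' w : List X, ‖wordCoeff w P‖ₑ := by
  rw [assocNorm_eq_sum, tsum_eq_sum]
  intro w hw
  rw [mem_wordSupport, not_not] at hw
  simp [hw]

@[simp]
theorem assocNorm_zero : assocNorm (0 : FreeAlgebra ℝ X) = 0 := by
  simp [assocNorm_eq_tsum]

theorem assocNorm_add_le (P Q : FreeAlgebra ℝ X) :
    assocNorm (P + Q) ≤ assocNorm P + assocNorm Q := by
  simp only [assocNorm_eq_tsum, map_add, ← ENNReal.tsum_add]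
  exact ENNReal.tsum_le_tsum fun w => enorm_add_le _ _

theorem assocNorm_smul (r : ℝ) (P : FreeAlgebra ℝ X) :
    assocNorm (r • P) = ‖r‖ₑ * assocNorm P := by
  simp only [assocNorm_eq_tsum, map_smul, ← ENNReal.tsum_mul_left, smul_eq_mul, enorm_mul]

theorem assocNorm_neg (P : FreeAlgebra ℝ X) : assocNorm (-P) = assocNorm P := by
  simp only [assocNorm_eq_tsum, map_neg, enorm_neg]

theorem assocNorm_sub_le (P Q : FreeAlgebra ℝ X) :
    assocNorm (P - Q) ≤ assocNorm P + assocNorm Q := by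
  rw [sub_eq_add_neg, ← assocNorm_neg Q]
  exact assocNorm_add_le _ _

theorem assocNorm_sum_le {ι : Type*} (s : Finset ι) (f : ι → FreeAlgebra ℝ X) :
    assocNorm (∑ i ∈ s, f i) ≤ ∑ i ∈ s, assocNorm (f i) := by
  classical
  induction s using Finset.induction_on with
  | empty => simp
  | insert a s ha ih =>
    rw [Finset.sum_insert ha, Finset.sum_insert ha]
    exact (assocNorm_add_le _ _).trans (by gcongr)

theorem assocNorm_wordMonomial (w : List X) : assocNorm (wordMonomial w) = 1 := by
  classical
  rw [assocNorm_eq_tsum, tsum_eq_single w]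
  · simp [wordCoeff_wordMonomial]
  · intro v hv
    simp [wordCoeff_wordMonomial, hv]

theorem wordMonomial_mul (u v : List X) :
    wordMonomial u * wordMonomial v = wordMonomial (u ++ v) := by
  simp [wordMonomial]

theorem assocNorm_mul_le (P Q : FreeAlgebra ℝ X) :
    assocNorm (P * Q) ≤ assocNorm P * assocNorm Q := by
  conv_lhs => rw [← sum_wordCoeff_smul P, ← sum_wordCoeff_smul Q, Finset.sum_mul_sum]
  rw [assocNorm_eq_sum P, assocNorm_eq_sum Q, Finset.sum_mul_sum]
  refine (assocNorm_sum_le _ _).trans (Finset.sum_le_sum fun u _ => ?_)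
  refine (assocNorm_sum_le _ _).trans (Finset.sum_le_sum fun v _ => ?_)
  rw [smul_mul_smul_comm, assocNorm_smul, wordMonomial_mul, assocNorm_wordMonomial, mul_one,
    enorm_mul]

theorem wordMonomial_nil : wordMonomial ([] : List X) = 1 := rfl

theorem wordMonomial_singleton (x : X) : wordMonomial [x] = FreeAlgebra.ι ℝ x := by
  simp [wordMonomial]

theorem wordMonomial_cons (x : X) (w : List X) :
    wordMonomial (x :: w) = FreeAlgebra.ι ℝ x * wordMonomial w := by
  simp [wordMonomial]

/-- Two linear maps on noncommutative polynomials agree as soon as the set where they agree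
contains `1` and is stable under left multiplication by variables. -/
theorem linearMap_ext_of_ι_mul {M : Type*} [AddCommGroup M] [Module ℝ M]
    {f g : FreeAlgebra ℝ X →ₗ[ℝ] M} (h1 : f 1 = g 1)
    (hmul : ∀ x P, f P = g P → f (FreeAlgebra.ι ℝ x * P) = g (FreeAlgebra.ι ℝ x * P)) :
    f = g := by
  have hw : ∀ w : List X, f (wordMonomial w) = g (wordMonomial w) := by
    intro w
    induction w with
    | nil => exact h1
    | cons x w ih => rw [wordMonomial_cons]; exact hmul x _ ih
  ext P
  rw [← sum_wordCoeff_smul P, map_sum, map_sum]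
  exact Finset.sum_congr rfl fun w _ => by rw [map_smul, map_smul, hw]

/-! ### Multihomogeneous polynomials and series -/

/-- The multidegree of a word: how often each letter occurs. -/
noncomputable def wordDegree (w : List X) : X →₀ ℕ := (w.map fun x => Finsupp.single x 1).sum

@[simp]
theorem wordDegree_nil : wordDegree ([] : List X) = 0 := rfl

@[simp]
theorem wordDegree_cons (x : X) (w : List X) :
    wordDegree (x :: w) = Finsupp.single x 1 + wordDegree w := by simp [wordDegree]

theorem wordDegree_append (u v : List X) : wordDegree (u ++ v) = wordDegree u + wordDegree v := by
  simp [wordDegree]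

theorem degree_wordDegree (w : List X) : (wordDegree w).degree = w.length := by
  induction w with
  | nil => simp
  | cons x w ih => simp [ih, add_comm]

theorem wordDegree_apply [DecidableEq X] (w : List X) (x : X) : wordDegree w x = w.count x := by
  induction w with
  | nil => simp
  | cons y w ih => simp [ih, List.count_cons, Finsupp.single_apply, add_comm]

/-- All words occurring in the polynomial have multidegree `d`. -/
def IsMultihomogeneous (d : X →₀ ℕ) (P : FreeAlgebra ℝ X) : Prop :=
  ∀ w, wordCoeff w P ≠ 0 → wordDegree w = d

/-- A power series over the free algebra such that each coefficient is multihomogeneous of the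
degree of its exponent; that is, `tᵢ` only occurs together with `Xᵢ`. -/
def IsMultihomogeneousSeries (F : MvPowerSeries X (FreeAlgebra ℝ X)) : Prop :=
  ∀ d, IsMultihomogeneous d (MvPowerSeries.coeff d F)

theorem IsMultihomogeneous.sum {ι : Type*} {s : Finset ι} {f : ι → FreeAlgebra ℝ X} {d : X →₀ ℕ}
    (h : ∀ i ∈ s, IsMultihomogeneous d (f i)) : IsMultihomogeneous d (∑ i ∈ s, f i) := by
  intro w hw
  rw [map_sum] at hw
  obtain ⟨i, hi, hi'⟩ := Finset.exists_ne_zero_of_sum_ne_zero hw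
  exact h i hi w hi'

theorem IsMultihomogeneous.smul {d : X →₀ ℕ} {P : FreeAlgebra ℝ X} (h : IsMultihomogeneous d P)
    (r : ℝ) : IsMultihomogeneous d (r • P) := by
  intro w hw
  rw [map_smul, smul_eq_mul] at hw
  exact h w (right_ne_zero_of_mul hw)

theorem IsMultihomogeneous.mul {d e : X →₀ ℕ} {P Q : FreeAlgebra ℝ X}
    (hP : IsMultihomogeneous d P) (hQ : IsMultihomogeneous e Q) :
    IsMultihomogeneous (d + e) (P * Q) := by
  intro w hw
  rw [wordCoeff_mul] at hw
  obtain ⟨i, _, hi⟩ := Finset.exists_ne_zero_of_sum_ne_zero hw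
  rw [← hP _ (left_ne_zero_of_mul hi), ← hQ _ (right_ne_zero_of_mul hi), ← wordDegree_append,
    List.take_append_drop]

theorem isMultihomogeneous_wordMonomial (w : List X) :
    IsMultihomogeneous (wordDegree w) (wordMonomial w) := by
  classical
  intro v hv
  rw [wordCoeff_wordMonomial] at hv
  by_contra h
  exact hv (if_neg fun h' => h (by rw [h']))

theorem isMultihomogeneous_zero (d : X →₀ ℕ) : IsMultihomogeneous d (0 : FreeAlgebra ℝ X) :=
  fun _ hw => absurd (map_zero _) hw

namespace IsMultihomogeneousSeries

variable {F G : MvPowerSeries X (FreeAlgebra ℝ X)}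

theorem one : IsMultihomogeneousSeries (1 : MvPowerSeries X (FreeAlgebra ℝ X)) := by
  classical
  intro d
  rw [MvPowerSeries.coeff_one]
  split_ifs with h
  · rw [h]; exact isMultihomogeneous_wordMonomial []
  · exact isMultihomogeneous_zero d

theorem sub (hF : IsMultihomogeneousSeries F) (hG : IsMultihomogeneousSeries G) :
    IsMultihomogeneousSeries (F - G) := by
  intro d w hw
  rw [map_sub, map_sub] at hw
  by_cases h : wordCoeff w (MvPowerSeries.coeff d F) = 0
  · exact hG d w fun h' => hw (by rw [h, h', sub_zero])
  · exact hF d w h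

theorem mul (hF : IsMultihomogeneousSeries F) (hG : IsMultihomogeneousSeries G) :
    IsMultihomogeneousSeries (F * G) := by
  classical
  intro d
  rw [MvPowerSeries.coeff_mul]
  refine IsMultihomogeneous.sum fun p hp => ?_
  rw [← Finset.HasAntidiagonal.mem_antidiagonal.1 hp]
  exact (hF _).mul (hG _)

theorem pow (hF : IsMultihomogeneousSeries F) (n : ℕ) : IsMultihomogeneousSeries (F ^ n) := by
  induction n with
  | zero => rw [pow_zero]; exact one
  | succ n ih => rw [pow_succ]; exact ih.mul hF

theorem evalAt (hF : IsMultihomogeneousSeries F) (a : PowerSeries ℝ) :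
    IsMultihomogeneousSeries (evalAt F a) := by
  intro d
  rw [coeff_evalAt]
  exact IsMultihomogeneous.sum fun n _ => (hF.pow n d).smul _

theorem list_prod {l : List (MvPowerSeries X (FreeAlgebra ℝ X))}
    (h : ∀ F ∈ l, IsMultihomogeneousSeries F) : IsMultihomogeneousSeries l.prod := by
  induction l with
  | nil => exact one
  | cons F l ih =>
    rw [List.prod_cons]
    exact (h F (by simp)).mul (ih fun G hG => h G (by simp [hG]))

theorem monomial_ι (x : X) :
    IsMultihomogeneousSeries
      (MvPowerSeries.monomial (Finsupp.single x 1) (FreeAlgebra.ι ℝ x)) := by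
  classical
  intro d
  rw [MvPowerSeries.coeff_monomial]
  split_ifs with h
  · rw [h, ← wordMonomial_singleton]
    simpa using isMultihomogeneous_wordMonomial [x]
  · exact isMultihomogeneous_zero d

end IsMultihomogeneousSeries

end Words

/-! ### The formal logarithm of a product of exponentials -/

section LogComponent

variable {k : ℕ}

/-- The formal series `tᵢ Xᵢ`. -/
noncomputable def tX (i : Fin k) : MvPowerSeries (Fin k) (FreeAlgebra ℝ (Fin k)) :=
  MvPowerSeries.monomial (Finsupp.single i 1) (FreeAlgebra.ι ℝ i)

theorem constantCoeff_tX (i : Fin k) : MvPowerSeries.constantCoeff (tX i) = 0 := by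
  classical
  rw [← MvPowerSeries.coeff_zero_eq_constantCoeff_apply, tX, MvPowerSeries.coeff_monomial,
    if_neg (by simp [eq_comm])]

theorem tX_pow (i : Fin k) (n : ℕ) : tX i ^ n =
    MvPowerSeries.monomial (Finsupp.single i n) (FreeAlgebra.ι ℝ i ^ n) := by
  induction n with
  | zero => simp [MvPowerSeries.monomial_zero_one]
  | succ n ih =>
    rw [pow_succ, ih, tX, MvPowerSeries.monomial_mul_monomial, ← Finsupp.single_add, ← pow_succ]

theorem coeff_evalAt_tX (i : Fin k) (a : PowerSeries ℝ) (d : Fin k →₀ ℕ) :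
    MvPowerSeries.coeff d (evalAt (tX i) a) = if d = Finsupp.single i (d i) then
      a.coeff (d i) • FreeAlgebra.ι ℝ i ^ d i else 0 := by
  classical
  rw [coeff_evalAt]
  simp only [tX_pow, MvPowerSeries.coeff_monomial]
  split_ifs with h
  · rw [Finset.sum_eq_single (d i), if_pos h]
    · intro n _ hn
      rw [if_neg, smul_zero]
      intro h'
      apply hn
      rw [h', Finsupp.single_eq_same]
    · intro h'
      exact absurd (Finset.mem_range.2 (Nat.lt_succ_of_le (Finsupp.le_degree i d))) h'
  · refine Finset.sum_eq_zero fun n _ => ?_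
    rw [if_neg, smul_zero]
    intro h'
    apply h
    rw [h', Finsupp.single_eq_same]

theorem expVar_eq (i : Fin k) : expVar i = formalExp (tX i) := by
  ext d
  rw [formalExp, coeff_evalAt_tX, PowerSeries.coeff_exp]
  change expVar i d = _
  simp [expVar]

/-- The formal series `exp (t₁ X₁) ⋯ exp (tₖ Xₖ)`. -/
noncomputable def expProd (k : ℕ) : MvPowerSeries (Fin k) (FreeAlgebra ℝ (Fin k)) :=
  (List.ofFn (fun i : Fin k => expVar i)).prod

theorem constantCoeff_expProd_sub_one : MvPowerSeries.constantCoeff (expProd k - 1) = 0 := by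
  have h : MvPowerSeries.constantCoeff (expProd k) = 1 := by
    rw [expProd, map_list_prod]
    apply List.prod_eq_one
    intro P hP
    simp only [List.map_ofFn, List.mem_ofFn, Function.comp_apply] at hP
    obtain ⟨i, rfl⟩ := hP
    rw [expVar_eq, constantCoeff_evalAt]
    simp [PowerSeries.coeff_exp]
  rw [map_sub, h, map_one, sub_self]

theorem formalLog_eq (f : MvPowerSeries (Fin k) (FreeAlgebra ℝ (Fin k))) :
    formalLog f = evalAt (f - 1) (PowerSeries.log ℝ) := by
  ext d
  rw [coeff_evalAt, Finset.sum_range_succ']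
  change formalLog f d = _
  rw [formalLog, ← Finset.Ico_succ_right_eq_Icc, Finset.sum_Ico_eq_sum_range]
  simp [add_comm 1]

/-- The formal series `log (exp (t₁ X₁) ⋯ exp (tₖ Xₖ))`. -/
noncomputable def logProd (k : ℕ) : MvPowerSeries (Fin k) (FreeAlgebra ℝ (Fin k)) :=
  evalAt (expProd k - 1) (PowerSeries.log ℝ)

theorem logComponent_eq (d : Fin k →₀ ℕ) :
    logComponent d = MvPowerSeries.coeff d (logProd k) := by
  rw [logComponent, formalLog_eq, logProd, expProd]

theorem constantCoeff_logProd : MvPowerSeries.constantCoeff (logProd k) = 0 := by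
  rw [logProd, constantCoeff_evalAt]
  simp

theorem formalExp_logProd : formalExp (logProd k) = expProd k := by
  rw [logProd, formalExp_evalAt_log constantCoeff_expProd_sub_one, add_sub_cancel]

theorem isMultihomogeneousSeries_expProd : IsMultihomogeneousSeries (expProd k) := by
  refine IsMultihomogeneousSeries.list_prod fun F hF => ?_
  obtain ⟨i, rfl⟩ := List.mem_ofFn.1 hF
  rw [expVar_eq]
  exact (IsMultihomogeneousSeries.monomial_ι i).evalAt _

theorem isMultihomogeneous_logComponent (d : Fin k →₀ ℕ) :
    IsMultihomogeneous d (logComponent d) := by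
  rw [logComponent_eq]
  exact (isMultihomogeneousSeries_expProd.sub .one).evalAt _ d

end LogComponent

/-! ### Right-nested brackets and the injectivity of the commutator expansion -/

section LieTheory

attribute [local instance] LieRing.ofAssociativeRing

variable {X : Type}

/-- The adjoint action of the free Lie algebra on itself, extended to its enveloping algebra. -/
noncomputable def adjointAction :
    FreeAlgebra ℝ X →ₐ[ℝ] Module.End ℝ (FreeLieAlgebra ℝ X) :=
  FreeAlgebra.lift ℝ fun x => LieAlgebra.ad ℝ (FreeLieAlgebra ℝ X) (FreeLieAlgebra.of ℝ x)

/-- The extension of the adjoint action by the trivial module under which a variable `x` maps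
`(l, c)` to `([x, l] + c x, 0)`. The orbit of `(0, 1)` consists of right-nested brackets. -/
noncomputable def nestingAction :
    FreeAlgebra ℝ X →ₐ[ℝ] Module.End ℝ (FreeLieAlgebra ℝ X × ℝ) :=
  FreeAlgebra.lift ℝ fun x =>
    (LinearMap.inl ℝ (FreeLieAlgebra ℝ X) ℝ) ∘ₗ
      (LinearMap.coprod (LieAlgebra.ad ℝ (FreeLieAlgebra ℝ X) (FreeLieAlgebra.of ℝ x))
        (LinearMap.toSpanSingleton ℝ _ (FreeLieAlgebra.of ℝ x)))

/-- The right-nested bracketing `x₁ ⋯ xₙ ↦ [x₁, [x₂, …, [xₙ₋₁, xₙ]]]`, with `1 ↦ 0`. -/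
noncomputable def nestedBracket : FreeAlgebra ℝ X →ₗ[ℝ] FreeLieAlgebra ℝ X :=
  LinearMap.fst ℝ _ _ ∘ₗ LinearMap.applyₗ ((0 : FreeLieAlgebra ℝ X), (1 : ℝ)) ∘ₗ
    nestingAction.toLinearMap

/-- The augmentation of the free algebra, taking the constant coefficient. -/
noncomputable def augmentation : FreeAlgebra ℝ X →ₐ[ℝ] ℝ := FreeAlgebra.lift ℝ fun _ => 0

theorem augmentation_ι_mul (x : X) (P : FreeAlgebra ℝ X) :
    augmentation (FreeAlgebra.ι ℝ x * P) = 0 := by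
  simp [augmentation]

theorem nestedBracket_apply (P : FreeAlgebra ℝ X) :
    nestedBracket P = (nestingAction P (0, 1)).1 := rfl

theorem nestingAction_apply (P : FreeAlgebra ℝ X) : ∀ (l : FreeLieAlgebra ℝ X) (c : ℝ),
    nestingAction P (l, c) = (adjointAction P l + c • nestedBracket P, c * augmentation P) := by
  induction P using FreeAlgebra.induction with
  | grade0 r =>
    intro l c
    simp [nestedBracket_apply, Module.algebraMap_end_apply, mul_comm]
  | grade1 x =>
    intro l c
    simp [nestedBracket_apply, nestingAction, adjointAction, augmentation]
  | mul P Q hP hQ =>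
    intro l c
    rw [nestedBracket_apply, map_mul, map_mul, map_mul, Module.End.mul_apply, Module.End.mul_apply,
      Module.End.mul_apply, hQ, hP, hQ, hP]
    ext
    · simp only [map_add, map_smul, smul_add, smul_smul, one_mul, map_zero, zero_add, one_smul,
        add_assoc]
    · ring
  | add P Q hP hQ =>
    intro l c
    rw [map_add, LinearMap.add_apply, hP, hQ]
    ext <;> simp [mul_add, add_add_add_comm]

theorem nestedBracket_mul (P Q : FreeAlgebra ℝ X) : nestedBracket (P * Q) =
    adjointAction P (nestedBracket Q) + augmentation Q • nestedBracket P := by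
  rw [nestedBracket_apply, map_mul, Module.End.mul_apply, nestingAction_apply Q,
    nestingAction_apply P]
  simp

theorem nestedBracket_ι (x : X) :
    nestedBracket (FreeAlgebra.ι ℝ x) = FreeLieAlgebra.of ℝ x := by
  simp [nestedBracket_apply, nestingAction]

theorem nestedBracket_one : nestedBracket (1 : FreeAlgebra ℝ X) = 0 := by
  simp [nestedBracket_apply]

theorem nestedBracket_ι_mul (x : X) (P : FreeAlgebra ℝ X) :
    nestedBracket (FreeAlgebra.ι ℝ x * P) =
      ⁅FreeLieAlgebra.of ℝ x, nestedBracket P⁆ + augmentation P • FreeLieAlgebra.of ℝ x := by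
  rw [nestedBracket_mul, nestedBracket_ι]
  simp [adjointAction]

theorem commutatorExpansion_of (x : X) :
    commutatorExpansion X (FreeLieAlgebra.of ℝ x) = FreeAlgebra.ι ℝ x := by
  simp [commutatorExpansion]

theorem adjointAction_commutatorExpansion (P l : FreeLieAlgebra ℝ X) :
    adjointAction (commutatorExpansion X P) l = ⁅P, l⁆ := by
  have h : (adjointAction (X := X)).toLieHom.comp (commutatorExpansion X) =
      LieAlgebra.ad ℝ (FreeLieAlgebra ℝ X) := by
    apply FreeLieAlgebra.hom_ext
    intro x
    simp [commutatorExpansion_of, adjointAction]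
  have h2 := congrArg (fun f => f P l) h
  simpa using h2

theorem exists_presentation (P : FreeLieAlgebra ℝ X) :
    ∃ θ : FreeMagma X →₀ ℝ, θ.sum (fun γ c => c • lieMonomial γ) = P := by
  let S : LieSubalgebra ℝ (FreeLieAlgebra ℝ X) :=
    { Submodule.span ℝ (Set.range (lieMonomial (X := X))) with
      lie_mem' := by
        intro a b ha hb
        induction ha, hb using Submodule.span_induction₂ with
        | mem_mem a b ha hb =>
          obtain ⟨γ, rfl⟩ := ha
          obtain ⟨γ', rfl⟩ := hb
          exact Submodule.subset_span ⟨γ.mul γ', rfl⟩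
        | zero_left => rw [zero_lie]; exact Submodule.zero_mem _
        | zero_right => rw [lie_zero]; exact Submodule.zero_mem _
        | add_left _ _ _ _ _ _ h1 h2 => rw [add_lie]; exact Submodule.add_mem _ h1 h2
        | add_right _ _ _ _ _ _ h1 h2 => rw [lie_add]; exact Submodule.add_mem _ h1 h2
        | smul_left _ _ _ _ _ h => rw [smul_lie]; exact Submodule.smul_mem _ _ h
        | smul_right _ _ _ _ _ h => rw [lie_smul]; exact Submodule.smul_mem _ _ h }
  let f : FreeLieAlgebra ℝ X →ₗ⁅ℝ⁆ S := FreeLieAlgebra.lift ℝ fun x =>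
    ⟨FreeLieAlgebra.of ℝ x, Submodule.subset_span ⟨FreeMagma.of x, rfl⟩⟩
  have hf : S.incl.comp f = LieHom.id := by
    apply FreeLieAlgebra.hom_ext
    intro x
    simp [f]
  have hP : P = (f P : FreeLieAlgebra ℝ X) := (congrArg (fun g => g P) hf).symm
  have hmem : P ∈ Submodule.span ℝ (Set.range (lieMonomial (X := X))) := by
    rw [hP]; exact (f P).2
  exact (Finsupp.mem_span_range_iff_exists_finsupp).1 hmem

/-- The commutator expansion of the Lie monomial given by a bracketing. -/
noncomputable def expandedMonomial (γ : FreeMagma X) : FreeAlgebra ℝ X :=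
  commutatorExpansion X (lieMonomial γ)

theorem expandedMonomial_of (x : X) :
    expandedMonomial (FreeMagma.of x) = FreeAlgebra.ι ℝ x := commutatorExpansion_of x

theorem expandedMonomial_mul (a b : FreeMagma X) : expandedMonomial (a * b) =
    expandedMonomial a * expandedMonomial b - expandedMonomial b * expandedMonomial a := by
  change commutatorExpansion X ⁅lieMonomial a, lieMonomial b⁆ = _
  rw [LieHom.map_lie, LieRing.of_associative_ring_bracket]
  rfl

theorem multidegree_mul (a b : FreeMagma X) :
    multidegree (a * b) = multidegree a + multidegree b := rfl

theorem one_le_degree_multidegree (γ : FreeMagma X) : 1 ≤ (multidegree γ).degree := by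
  induction γ using FreeMagma.recOnMul with
  | ih1 x => simp [multidegree]
  | ih2 a b ha hb => rw [multidegree_mul, map_add]; omega

theorem IsMultihomogeneous.sub {d : X →₀ ℕ} {P Q : FreeAlgebra ℝ X}
    (hP : IsMultihomogeneous d P) (hQ : IsMultihomogeneous d Q) :
    IsMultihomogeneous d (P - Q) := by
  intro w hw
  rw [map_sub] at hw
  by_cases h : wordCoeff w P = 0
  · exact hQ w fun h' => hw (by rw [h, h', sub_zero])
  · exact hP w h

theorem isMultihomogeneous_expandedMonomial (γ : FreeMagma X) :
    IsMultihomogeneous (multidegree γ) (expandedMonomial γ) := by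
  induction γ using FreeMagma.recOnMul with
  | ih1 x =>
    rw [expandedMonomial_of, ← wordMonomial_singleton]
    simpa [multidegree] using isMultihomogeneous_wordMonomial [x]
  | ih2 a b ha hb =>
    rw [expandedMonomial_mul, multidegree_mul]
    exact (ha.mul hb).sub (add_comm (multidegree b) _ ▸ hb.mul ha)

theorem assocNorm_expandedMonomial_le (γ : FreeMagma X) :
    assocNorm (expandedMonomial γ) ≤ 2 ^ ((multidegree γ).degree - 1) := by
  induction γ using FreeMagma.recOnMul with
  | ih1 x =>
    rw [expandedMonomial_of, ← wordMonomial_singleton, assocNorm_wordMonomial]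
    exact one_le_pow₀ one_le_two
  | ih2 a b ha hb =>
    have ha' := one_le_degree_multidegree a
    have hb' := one_le_degree_multidegree b
    rw [expandedMonomial_mul, multidegree_mul, map_add]
    have hexp : (multidegree a).degree + (multidegree b).degree - 1 =
        ((multidegree a).degree - 1) + ((multidegree b).degree - 1) + 1 := by omega
    have h1 := (assocNorm_mul_le (expandedMonomial a) (expandedMonomial b)).trans
      (mul_le_mul' ha hb)
    have h2 := (assocNorm_mul_le (expandedMonomial b) (expandedMonomial a)).trans
      (mul_le_mul' hb ha)
    refine (assocNorm_sub_le _ _).trans ((add_le_add h1 h2).trans (le_of_eq ?_))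
    rw [hexp, pow_succ, pow_add]
    ring

theorem augmentation_expandedMonomial (γ : FreeMagma X) :
    augmentation (expandedMonomial γ) = 0 := by
  induction γ using FreeMagma.recOnMul with
  | ih1 x => rw [expandedMonomial_of]; simp [augmentation]
  | ih2 a b ha hb => rw [expandedMonomial_mul, map_sub, map_mul, map_mul, ha, hb]; simp

/-- Right-nested bracketing is a derivation on commutator polynomials, so it acts on Lie
monomials as multiplication by the degree (Dynkin–Specht–Wever). -/
theorem nestedBracket_expandedMonomial (γ : FreeMagma X) :
    nestedBracket (expandedMonomial γ) = ((multidegree γ).degree : ℝ) • lieMonomial γ := by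
  induction γ using FreeMagma.recOnMul with
  | ih1 x =>
    rw [expandedMonomial_of, nestedBracket_ι]
    simp [multidegree, lieMonomial]
  | ih2 a b ha hb =>
    rw [expandedMonomial_mul, map_sub, nestedBracket_mul, nestedBracket_mul,
      augmentation_expandedMonomial, augmentation_expandedMonomial, ha, hb]
    rw [expandedMonomial, expandedMonomial, adjointAction_commutatorExpansion,
      adjointAction_commutatorExpansion, multidegree_mul]
    change _ = _ • ⁅lieMonomial a, lieMonomial b⁆
    have hskew : ⁅lieMonomial b, lieMonomial a⁆ = -⁅lieMonomial a, lieMonomial b⁆ :=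
      (lie_skew _ _).symm
    rw [lie_smul, lie_smul, hskew, map_add]
    push_cast
    module

/-- A Lie polynomial is determined by its commutator expansion: when all words of the expansion
`Q` have length `n`, then `n` times the Lie polynomial is the right-nested bracketing of `Q`. -/
theorem smul_eq_nestedBracket {P : FreeLieAlgebra ℝ X} {Q : FreeAlgebra ℝ X} {n : ℕ}
    (hPQ : commutatorExpansion X P = Q) (hQ : ∀ w, wordCoeff w Q ≠ 0 → w.length = n) :
    (n : ℝ) • P = nestedBracket Q := by
  classical
  obtain ⟨θ, hθ⟩ := exists_presentation P
  let deg : FreeMagma X → ℕ := fun γ => (multidegree γ).degree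
  let part : ℕ → FreeLieAlgebra ℝ X := fun j =>
    ∑ γ ∈ θ.support with deg γ = j, θ γ • lieMonomial γ
  let J : Finset ℕ := insert n (θ.support.image deg)
  have hsum : ∑ j ∈ J, part j = P := by
    rw [← hθ, Finsupp.sum]
    refine Finset.sum_fiberwise_of_maps_to (fun γ hγ => ?_) _
    exact Finset.mem_insert_of_mem (Finset.mem_image_of_mem deg hγ)
  have hexp : ∀ j, commutatorExpansion X (part j) =
      ∑ γ ∈ θ.support with deg γ = j, θ γ • expandedMonomial γ := by
    intro j
    simp only [part, map_sum, map_smul, expandedMonomial]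
  have hnest : ∀ j, nestedBracket (commutatorExpansion X (part j)) = (j : ℝ) • part j := by
    intro j
    rw [hexp, map_sum, Finset.smul_sum]
    refine Finset.sum_congr rfl fun γ hγ => ?_
    rw [map_smul, nestedBracket_expandedMonomial, smul_comm]
    rw [show (multidegree γ).degree = j from (Finset.mem_filter.1 hγ).2]
  have hlen : ∀ j w, wordCoeff w (commutatorExpansion X (part j)) ≠ 0 → w.length = j := by
    intro j w hw
    rw [hexp, map_sum] at hw
    obtain ⟨γ, hγ, hγ'⟩ := Finset.exists_ne_zero_of_sum_ne_zero hw
    rw [map_smul, smul_eq_mul] at hγ'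
    have h1 := isMultihomogeneous_expandedMonomial γ w (right_ne_zero_of_mul hγ')
    rw [← degree_wordDegree, h1]
    exact (Finset.mem_filter.1 hγ).2
  have hzero : ∀ j ∈ J, j ≠ n → part j = 0 := by
    intro j hj hjn
    have h1 : commutatorExpansion X (part j) = 0 := by
      apply wordCoeff_ext
      intro w
      rw [map_zero]
      by_contra hw
      have h2 := hlen j w hw
      have h3 : wordCoeff w Q = wordCoeff w (commutatorExpansion X (part j)) := by
        rw [← hPQ, ← hsum, map_sum, map_sum]
        refine Finset.sum_eq_single j (fun i _ hi => ?_) fun h => absurd hj h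
        by_contra h
        exact hi ((hlen i w h).symm.trans h2)
      exact hjn (h2.symm.trans (hQ w (by rw [h3]; exact hw)))
    have h4 := hnest j
    rw [h1, map_zero] at h4
    have hj0 : j ≠ 0 := by
      rcases Finset.mem_insert.1 hj with h | h
      · exact absurd h hjn
      · obtain ⟨γ, _, hγ⟩ := Finset.mem_image.1 h
        have : 1 ≤ j := hγ ▸ one_le_degree_multidegree γ
        omega
    exact (smul_eq_zero.1 h4.symm).resolve_left (by exact_mod_cast hj0)
  have hP : P = part n := by
    rw [← hsum]
    exact Finset.sum_eq_single n hzero fun h => absurd (Finset.mem_insert_self _ _) h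
  rw [← hPQ, hP, hnest]

theorem commutatorExpansion_injective : Function.Injective (commutatorExpansion X) := by
  rw [injective_iff_map_eq_zero]
  intro P hP
  have h := smul_eq_nestedBracket (n := 1) hP (fun w hw => absurd (map_zero _) hw)
  simpa using h

/-! ### The two norm comparisons -/

/-- The right-nested bracketing `x₁ (x₂ (⋯ xₙ))` of a nonempty word. -/
def nestedBracketing : X → List X → FreeMagma X
  | x, [] => FreeMagma.of x
  | x, y :: w => FreeMagma.of x * nestedBracketing y w

theorem multidegree_nestedBracketing (x : X) (w : List X) :
    multidegree (nestedBracketing x w) = wordDegree (x :: w) := by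
  induction w generalizing x with
  | nil => simp [nestedBracketing, multidegree]
  | cons y w ih =>
    rw [nestedBracketing, multidegree_mul, ih, wordDegree_cons x]
    rfl

theorem nestedBracket_wordMonomial (x : X) (w : List X) :
    nestedBracket (wordMonomial (x :: w)) = lieMonomial (nestedBracketing x w) := by
  induction w generalizing x with
  | nil => rw [wordMonomial_singleton, nestedBracket_ι]; rfl
  | cons y w ih =>
    rw [wordMonomial_cons, nestedBracket_ι_mul, ih, wordMonomial_cons, augmentation_ι_mul,
      zero_smul, add_zero]
    rfl

/-- The presentation of the right-nested bracket of a word by a single Lie monomial. -/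
noncomputable def nestedPresentation : List X → (FreeMagma X →₀ ℝ)
  | [] => 0
  | x :: w => Finsupp.single (nestedBracketing x w) 1

theorem ofReal_finsupp_sum_abs {α : Type*} (θ : α →₀ ℝ) :
    ENNReal.ofReal (θ.sum fun _ c => |c|) = ∑' a, ‖θ a‖ₑ := by
  rw [Finsupp.sum, ENNReal.ofReal_sum_of_nonneg fun _ _ => abs_nonneg _,
    tsum_eq_sum (s := θ.support)]
  · exact Finset.sum_congr rfl fun w _ => (Real.enorm_eq_ofReal_abs _).symm
  · intro a ha
    rw [Finsupp.notMem_support_iff] at ha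
    simp [ha]

theorem lieNorm_le {d : X →₀ ℕ} {P : FreeLieAlgebra ℝ X} (θ : FreeMagma X →₀ ℝ)
    (h1 : ∀ γ ∈ θ.support, multidegree γ = d)
    (h2 : θ.sum (fun γ c => c • lieMonomial γ) = P) :
    lieNorm d P ≤ ∑' γ, ‖θ γ‖ₑ := by
  rw [← ofReal_finsupp_sum_abs]
  exact iInf_le_of_le θ (iInf_le_of_le h1 (iInf_le _ h2))

/-- The right-nested bracketing of `Q` presents `n P` by as many Lie monomials as `Q` has words. -/
theorem lieNorm_le_assocNorm_div {d : X →₀ ℕ} (hd : 1 ≤ d.degree) {P : FreeLieAlgebra ℝ X}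
    {Q : FreeAlgebra ℝ X} (hPQ : commutatorExpansion X P = Q) (hQ : IsMultihomogeneous d Q) :
    lieNorm d P ≤ assocNorm Q / (d.degree : ℝ≥0∞) := by
  classical
  have hd0 : (d.degree : ℝ) ≠ 0 := by positivity
  have hD := smul_eq_nestedBracket (n := d.degree) hPQ
    fun w hw => by rw [← degree_wordDegree, hQ w hw]
  let θ : FreeMagma X →₀ ℝ := ∑ w ∈ wordSupport Q,
    ((d.degree : ℝ)⁻¹ * wordCoeff w Q) • nestedPresentation w
  have hθP : θ.sum (fun γ c => c • lieMonomial γ) = P := by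
    have h1 : ∀ w ∈ wordSupport Q, Finsupp.linearCombination ℝ lieMonomial (nestedPresentation w) =
        nestedBracket (wordMonomial w) := by
      intro w _
      cases w with
      | nil => simp [nestedPresentation, wordMonomial_nil, nestedBracket_one]
      | cons x w => simp [nestedPresentation, nestedBracket_wordMonomial]
    change Finsupp.linearCombination ℝ lieMonomial θ = P
    simp only [θ, map_sum, map_smul]
    rw [Finset.sum_congr rfl fun w hw => by rw [h1 w hw, mul_smul], ← Finset.smul_sum,
      Finset.sum_congr rfl fun w _ => (map_smul nestedBracket _ _).symm, ← map_sum,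
      sum_wordCoeff_smul, ← hD, smul_smul, inv_mul_cancel₀ hd0, one_smul]
  have hsupp : ∀ γ ∈ θ.support, multidegree γ = d := by
    intro γ hγ
    rw [Finsupp.mem_support_iff, Finsupp.finsetSum_apply] at hγ
    obtain ⟨w, hw, hw'⟩ := Finset.exists_ne_zero_of_sum_ne_zero hγ
    rw [mem_wordSupport] at hw
    cases w with
    | nil => simp [nestedPresentation] at hw'
    | cons x w =>
      have h2 : nestedBracketing x w = γ := by
        by_contra h
        simp [nestedPresentation, h] at hw'
      rw [← h2, multidegree_nestedBracketing, hQ _ hw]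
  refine (lieNorm_le θ hsupp hθP).trans ?_
  have hone : ∀ w : List X, ∑' γ, ‖nestedPresentation w γ‖ₑ ≤ 1 := by
    intro w
    cases w with
    | nil => simp [nestedPresentation]
    | cons x w =>
      rw [tsum_eq_single (nestedBracketing x w)]
      · simp [nestedPresentation]
      · intro γ hγ
        simp [nestedPresentation, hγ.symm]
  calc ∑' γ, ‖θ γ‖ₑ ≤ ∑' γ, ∑ w ∈ wordSupport Q,
        ‖((d.degree : ℝ)⁻¹ * wordCoeff w Q)‖ₑ * ‖nestedPresentation w γ‖ₑ := by
        refine ENNReal.tsum_le_tsum fun γ => ?_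
        simp only [θ, Finsupp.finsetSum_apply, Finsupp.smul_apply, smul_eq_mul]
        refine (enorm_sum_le _ _).trans (Finset.sum_le_sum fun w _ => ?_)
        rw [enorm_mul]
    _ = ∑ w ∈ wordSupport Q, ‖((d.degree : ℝ)⁻¹ * wordCoeff w Q)‖ₑ *
        ∑' γ, ‖nestedPresentation w γ‖ₑ := by
        rw [Summable.tsum_finsetSum fun _ _ => ENNReal.summable]
        exact Finset.sum_congr rfl fun w _ => ENNReal.tsum_mul_left
    _ ≤ ∑ w ∈ wordSupport Q, ‖((d.degree : ℝ)⁻¹ * wordCoeff w Q)‖ₑ * 1 :=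
        Finset.sum_le_sum fun w _ => mul_le_mul_right (hone w) _
    _ = assocNorm Q / (d.degree : ℝ≥0∞) := by
        rw [assocNorm_eq_sum, ENNReal.div_eq_inv_mul, Finset.mul_sum]
        refine Finset.sum_congr rfl fun w _ => ?_
        rw [mul_one, enorm_mul, Real.enorm_eq_ofReal_abs (d.degree : ℝ)⁻¹,
          abs_of_nonneg (by positivity), ENNReal.ofReal_inv_of_pos (by positivity),
          ENNReal.ofReal_natCast]

/-- A Lie monomial of degree `n` expands into `2 ^ (n - 1)` signed words, counted with
multiplicity. -/
theorem assocNorm_commutatorExpansion_le (d : X →₀ ℕ) (P : FreeLieAlgebra ℝ X) :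
    assocNorm (commutatorExpansion X P) ≤ 2 ^ (d.degree - 1) * lieNorm d P := by
  have h2 : (2 : ℝ≥0∞) ^ (d.degree - 1) ≠ 0 := by simp
  have h3 : (2 : ℝ≥0∞) ^ (d.degree - 1) ≠ ∞ := ENNReal.pow_ne_top (by simp)
  rw [← ENNReal.div_le_iff' h2 h3, lieNorm]
  refine le_iInf fun θ => le_iInf fun hθ => le_iInf fun hP => ?_
  rw [ENNReal.div_le_iff' h2 h3, ← hP, Finsupp.sum, map_sum, Finsupp.sum,
    ENNReal.ofReal_sum_of_nonneg fun _ _ => abs_nonneg _, Finset.mul_sum]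
  refine (assocNorm_sum_le _ _).trans (Finset.sum_le_sum fun γ hγ => ?_)
  rw [map_smul, assocNorm_smul, ← Real.enorm_eq_ofReal_abs, mul_comm, ← hθ γ hγ]
  exact mul_le_mul_left (assocNorm_expandedMonomial_le γ) _

end LieTheory

/-! ### Primitive elements are commutator polynomials -/

section Primitive

attribute [local instance] LieRing.ofAssociativeRing

open scoped TensorProduct

variable {X : Type}

/-- The comultiplication of the free algebra, for which the variables are primitive. -/
noncomputable def comul : FreeAlgebra ℝ X →ₐ[ℝ] FreeAlgebra ℝ X ⊗[ℝ] FreeAlgebra ℝ X :=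
  FreeAlgebra.lift ℝ fun x => FreeAlgebra.ι ℝ x ⊗ₜ 1 + 1 ⊗ₜ FreeAlgebra.ι ℝ x

/-- The antipode of the free algebra, as an antihomomorphism. -/
noncomputable def antipodeHom : FreeAlgebra ℝ X →ₐ[ℝ] (FreeAlgebra ℝ X)ᵐᵒᵖ :=
  FreeAlgebra.lift ℝ fun x => MulOpposite.op (-FreeAlgebra.ι ℝ x)

/-- The antipode of the free algebra. -/
noncomputable def antipode : FreeAlgebra ℝ X →ₗ[ℝ] FreeAlgebra ℝ X :=
  (MulOpposite.opLinearEquiv ℝ).symm.toLinearMap ∘ₗ antipodeHom.toLinearMap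

theorem antipode_one : antipode (1 : FreeAlgebra ℝ X) = 1 := by
  simp [antipode]

theorem antipode_ι_mul (x : X) (P : FreeAlgebra ℝ X) :
    antipode (FreeAlgebra.ι ℝ x * P) = -(antipode P * FreeAlgebra.ι ℝ x) := by
  simp [antipode, antipodeHom]

/-- The action of the free algebra on pairs for which a variable `x` maps `(a, b)` to
`(x a, x a + x b)`; it encodes the Euler derivation. -/
noncomputable def eulerAction :
    FreeAlgebra ℝ X →ₐ[ℝ] Module.End ℝ (FreeAlgebra ℝ X × FreeAlgebra ℝ X) :=
  FreeAlgebra.lift ℝ fun x =>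
    LinearMap.prod (LinearMap.mulLeft ℝ (FreeAlgebra.ι ℝ x) ∘ₗ LinearMap.fst ℝ _ _)
      (LinearMap.mulLeft ℝ (FreeAlgebra.ι ℝ x) ∘ₗ (LinearMap.fst ℝ _ _ + LinearMap.snd ℝ _ _))

/-- The Euler derivation of the free algebra, multiplication by `n` in degree `n`. -/
noncomputable def euler : FreeAlgebra ℝ X →ₗ[ℝ] FreeAlgebra ℝ X :=
  LinearMap.snd ℝ _ _ ∘ₗ LinearMap.applyₗ ((1 : FreeAlgebra ℝ X), (0 : FreeAlgebra ℝ X)) ∘ₗ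
    eulerAction.toLinearMap

theorem euler_one : euler (1 : FreeAlgebra ℝ X) = 0 := by simp [euler]

theorem eulerAction_ι_mul (x : X) (P : FreeAlgebra ℝ X) :
    eulerAction (FreeAlgebra.ι ℝ x * P) (1, 0) = (FreeAlgebra.ι ℝ x * (eulerAction P (1, 0)).1,
      FreeAlgebra.ι ℝ x * ((eulerAction P (1, 0)).1 + (eulerAction P (1, 0)).2)) := by
  rw [map_mul, Module.End.mul_apply]
  simp [eulerAction]

theorem eulerAction_fst (P : FreeAlgebra ℝ X) : (eulerAction P (1, 0)).1 = P := by
  have h : LinearMap.fst ℝ _ _ ∘ₗ LinearMap.applyₗ ((1 : FreeAlgebra ℝ X), (0 : FreeAlgebra ℝ X)) ∘ₗ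
      eulerAction.toLinearMap = LinearMap.id := by
    apply linearMap_ext_of_ι_mul
    · simp
    · intro x Q hQ
      have hQ' : (eulerAction Q (1, 0)).1 = Q := hQ
      change (eulerAction (FreeAlgebra.ι ℝ x * Q) (1, 0)).1 = FreeAlgebra.ι ℝ x * Q
      rw [eulerAction_ι_mul, hQ']
  exact congrArg (fun f => f P) h

theorem euler_ι_mul (x : X) (P : FreeAlgebra ℝ X) :
    euler (FreeAlgebra.ι ℝ x * P) = FreeAlgebra.ι ℝ x * P + FreeAlgebra.ι ℝ x * euler P := by
  change (eulerAction (FreeAlgebra.ι ℝ x * P) (1, 0)).2 = _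
  rw [eulerAction_ι_mul, eulerAction_fst, mul_add]
  rfl

theorem euler_wordMonomial (w : List X) :
    euler (wordMonomial w) = (w.length : ℝ) • wordMonomial w := by
  induction w with
  | nil => rw [wordMonomial_nil, euler_one]; simp
  | cons x w ih =>
    rw [wordMonomial_cons, euler_ι_mul, ih, List.length_cons, mul_smul_comm]
    push_cast
    module

theorem euler_eq_smul {P : FreeAlgebra ℝ X} {n : ℕ}
    (hP : ∀ w, wordCoeff w P ≠ 0 → w.length = n) : euler P = (n : ℝ) • P := by
  conv_lhs => rw [← sum_wordCoeff_smul P]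
  conv_rhs => rw [← sum_wordCoeff_smul P]
  rw [map_sum, Finset.smul_sum]
  refine Finset.sum_congr rfl fun w hw => ?_
  rw [map_smul, euler_wordMonomial, hP w (mem_wordSupport.1 hw), smul_comm]

/-- The linear map `a ⊗ b ↦ a S(b)`. -/
noncomputable def mulAntipode : FreeAlgebra ℝ X ⊗[ℝ] FreeAlgebra ℝ X →ₗ[ℝ] FreeAlgebra ℝ X :=
  LinearMap.mul' ℝ _ ∘ₗ TensorProduct.map LinearMap.id antipode

/-- The linear map `a ⊗ b ↦ E(a) S(b)`. -/
noncomputable def eulerAntipode : FreeAlgebra ℝ X ⊗[ℝ] FreeAlgebra ℝ X →ₗ[ℝ] FreeAlgebra ℝ X :=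
  LinearMap.mul' ℝ _ ∘ₗ TensorProduct.map euler antipode

theorem mulAntipode_tmul (a b : FreeAlgebra ℝ X) :
    mulAntipode (a ⊗ₜ[ℝ] b) = a * antipode b := by simp [mulAntipode]

theorem eulerAntipode_tmul (a b : FreeAlgebra ℝ X) :
    eulerAntipode (a ⊗ₜ[ℝ] b) = euler a * antipode b := by simp [eulerAntipode]

theorem comul_ι (x : X) : comul (FreeAlgebra.ι ℝ x) =
    FreeAlgebra.ι ℝ x ⊗ₜ[ℝ] 1 + 1 ⊗ₜ FreeAlgebra.ι ℝ x := by simp [comul]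

theorem mulAntipode_comul_ι_mul (x : X) (τ : FreeAlgebra ℝ X ⊗[ℝ] FreeAlgebra ℝ X) :
    mulAntipode (comul (FreeAlgebra.ι ℝ x) * τ) =
      FreeAlgebra.ι ℝ x * mulAntipode τ - mulAntipode τ * FreeAlgebra.ι ℝ x := by
  induction τ using TensorProduct.induction_on with
  | zero => simp
  | tmul a b =>
    rw [comul_ι, add_mul, Algebra.TensorProduct.tmul_mul_tmul, Algebra.TensorProduct.tmul_mul_tmul,
      map_add, mulAntipode_tmul, mulAntipode_tmul, mulAntipode_tmul, one_mul, one_mul,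
      antipode_ι_mul]
    noncomm_ring
  | add σ τ hσ hτ => rw [mul_add, map_add, hσ, hτ, map_add]; noncomm_ring

theorem eulerAntipode_comul_ι_mul (x : X) (τ : FreeAlgebra ℝ X ⊗[ℝ] FreeAlgebra ℝ X) :
    eulerAntipode (comul (FreeAlgebra.ι ℝ x) * τ) = FreeAlgebra.ι ℝ x * mulAntipode τ +
      (FreeAlgebra.ι ℝ x * eulerAntipode τ - eulerAntipode τ * FreeAlgebra.ι ℝ x) := by
  induction τ using TensorProduct.induction_on with
  | zero => simp
  | tmul a b =>
    rw [comul_ι, add_mul, Algebra.TensorProduct.tmul_mul_tmul, Algebra.TensorProduct.tmul_mul_tmul,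
      map_add, eulerAntipode_tmul, eulerAntipode_tmul, eulerAntipode_tmul, mulAntipode_tmul,
      one_mul, one_mul, antipode_ι_mul, euler_ι_mul]
    noncomm_ring
  | add σ τ hσ hτ => rw [mul_add, map_add, hσ, hτ, map_add, map_add]; noncomm_ring

theorem mulAntipode_comul (P : FreeAlgebra ℝ X) :
    mulAntipode (comul P) = algebraMap ℝ _ (augmentation P) := by
  have h : mulAntipode ∘ₗ comul.toLinearMap =
      (Algebra.linearMap ℝ (FreeAlgebra ℝ X)) ∘ₗ augmentation.toLinearMap := by
    apply linearMap_ext_of_ι_mul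
    · change mulAntipode (comul 1) = algebraMap ℝ _ (augmentation 1)
      rw [map_one comul, map_one augmentation, map_one (algebraMap _ _), Algebra.TensorProduct.one_def, mulAntipode_tmul, antipode_one,
        one_mul]
    · intro x Q hQ
      have hQ' : mulAntipode (comul Q) = algebraMap ℝ _ (augmentation Q) := hQ
      change mulAntipode (comul (_ * Q)) = algebraMap ℝ _ (augmentation (_ * Q))
      rw [augmentation_ι_mul, map_mul, mulAntipode_comul_ι_mul, hQ', map_zero, sub_eq_zero]
      exact (Algebra.commutes _ _).symm
  exact congrArg (fun f => f P) h

/-- The Dynkin operator is the convolution `E ⋆ S` of the Euler derivation and the antipode. -/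
theorem eulerAntipode_comul (P : FreeAlgebra ℝ X) :
    eulerAntipode (comul P) = commutatorExpansion X (nestedBracket P) := by
  have h : eulerAntipode ∘ₗ comul.toLinearMap =
      (commutatorExpansion X).toLinearMap ∘ₗ nestedBracket := by
    apply linearMap_ext_of_ι_mul
    · change eulerAntipode (comul 1) = commutatorExpansion X (nestedBracket 1)
      rw [map_one, Algebra.TensorProduct.one_def, eulerAntipode_tmul, euler_one, zero_mul,
        nestedBracket_one, map_zero]
    · intro x Q hQ
      have hQ' : eulerAntipode (comul Q) = commutatorExpansion X (nestedBracket Q) := hQ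
      change eulerAntipode (comul (_ * Q)) = commutatorExpansion X (nestedBracket (_ * Q))
      rw [nestedBracket_ι_mul, map_mul, eulerAntipode_comul_ι_mul, hQ', mulAntipode_comul, map_add,
        map_smul, LieHom.map_lie, commutatorExpansion_of, LieRing.of_associative_ring_bracket,
        ← Algebra.commutes, ← Algebra.smul_def, add_comm]
  exact congrArg (fun f => f P) h

/-- A homogeneous primitive element `P` of degree `n ≠ 0` is a commutator polynomial: on `P` the
convolution `E ⋆ S` takes the value `n P`, while in general it is a commutator expansion. -/
theorem exists_commutatorExpansion_eq_of_primitive {P : FreeAlgebra ℝ X} {n : ℕ} (hn : n ≠ 0)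
    (hP : ∀ w, wordCoeff w P ≠ 0 → w.length = n) (hprim : comul P = P ⊗ₜ[ℝ] 1 + 1 ⊗ₜ P) :
    ∃ Q, commutatorExpansion X Q = P := by
  refine ⟨(n : ℝ)⁻¹ • nestedBracket P, ?_⟩
  rw [map_smul, ← eulerAntipode_comul, hprim, map_add, eulerAntipode_tmul, eulerAntipode_tmul,
    antipode_one, euler_one, zero_mul, add_zero, mul_one, euler_eq_smul hP, smul_smul,
    inv_mul_cancel₀ (by exact_mod_cast hn), one_smul]

open MvPowerSeries in
theorem commute_of_commute_coeff {σ B : Type*} [Ring B] {F G : MvPowerSeries σ B}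
    (h : ∀ d e, Commute (coeff d F) (coeff e G)) : Commute F G := by
  classical
  ext d
  rw [coeff_mul, coeff_mul]
  refine Finset.sum_equiv (Equiv.prodComm _ _) (fun p => ?_) fun p _ => (h _ _).eq
  simp [Finset.HasAntidiagonal.mem_antidiagonal, add_comm]

/-- `a ↦ a ⊗ 1`, applied to the coefficients of a series. -/
noncomputable def leftSeries {k : ℕ} (F : MvPowerSeries (Fin k) (FreeAlgebra ℝ (Fin k))) :
    MvPowerSeries (Fin k) (FreeAlgebra ℝ (Fin k) ⊗[ℝ] FreeAlgebra ℝ (Fin k)) :=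
  MvPowerSeries.map ((Algebra.TensorProduct.includeLeft :
    FreeAlgebra ℝ (Fin k) →ₐ[ℝ] FreeAlgebra ℝ (Fin k) ⊗[ℝ] FreeAlgebra ℝ (Fin k)) :
      FreeAlgebra ℝ (Fin k) →+* FreeAlgebra ℝ (Fin k) ⊗[ℝ] FreeAlgebra ℝ (Fin k)) F

/-- `a ↦ 1 ⊗ a`, applied to the coefficients of a series. -/
noncomputable def rightSeries {k : ℕ} (F : MvPowerSeries (Fin k) (FreeAlgebra ℝ (Fin k))) :
    MvPowerSeries (Fin k) (FreeAlgebra ℝ (Fin k) ⊗[ℝ] FreeAlgebra ℝ (Fin k)) :=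
  MvPowerSeries.map ((Algebra.TensorProduct.includeRight :
    FreeAlgebra ℝ (Fin k) →ₐ[ℝ] FreeAlgebra ℝ (Fin k) ⊗[ℝ] FreeAlgebra ℝ (Fin k)) :
      FreeAlgebra ℝ (Fin k) →+* FreeAlgebra ℝ (Fin k) ⊗[ℝ] FreeAlgebra ℝ (Fin k)) F

/-- The comultiplication, applied to the coefficients of a series. -/
noncomputable def comulSeries {k : ℕ} (F : MvPowerSeries (Fin k) (FreeAlgebra ℝ (Fin k))) :
    MvPowerSeries (Fin k) (FreeAlgebra ℝ (Fin k) ⊗[ℝ] FreeAlgebra ℝ (Fin k)) :=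
  MvPowerSeries.map ((comul : FreeAlgebra ℝ (Fin k) →ₐ[ℝ] _) :
      FreeAlgebra ℝ (Fin k) →+* FreeAlgebra ℝ (Fin k) ⊗[ℝ] FreeAlgebra ℝ (Fin k)) F

variable {k : ℕ}

theorem commute_leftSeries_rightSeries (F G : MvPowerSeries (Fin k) (FreeAlgebra ℝ (Fin k))) :
    Commute (leftSeries F) (rightSeries G) := by
  apply commute_of_commute_coeff
  intro d e
  change _ * _ = _ * _
  simp [leftSeries, rightSeries]

theorem constantCoeff_leftSeries {F : MvPowerSeries (Fin k) (FreeAlgebra ℝ (Fin k))}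
    (hF : MvPowerSeries.constantCoeff F = 0) :
    MvPowerSeries.constantCoeff (leftSeries F) = 0 := by
  rw [leftSeries, MvPowerSeries.constantCoeff_map, hF, map_zero]

theorem constantCoeff_rightSeries {F : MvPowerSeries (Fin k) (FreeAlgebra ℝ (Fin k))}
    (hF : MvPowerSeries.constantCoeff F = 0) :
    MvPowerSeries.constantCoeff (rightSeries F) = 0 := by
  rw [rightSeries, MvPowerSeries.constantCoeff_map, hF, map_zero]

theorem constantCoeff_comulSeries {F : MvPowerSeries (Fin k) (FreeAlgebra ℝ (Fin k))}
    (hF : MvPowerSeries.constantCoeff F = 0) :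
    MvPowerSeries.constantCoeff (comulSeries F) = 0 := by
  rw [comulSeries, MvPowerSeries.constantCoeff_map, hF, map_zero]

theorem leftSeries_formalExp (F : MvPowerSeries (Fin k) (FreeAlgebra ℝ (Fin k))) :
    leftSeries (formalExp F) = formalExp (leftSeries F) := map_evalAt _ _ _

theorem rightSeries_formalExp (F : MvPowerSeries (Fin k) (FreeAlgebra ℝ (Fin k))) :
    rightSeries (formalExp F) = formalExp (rightSeries F) := map_evalAt _ _ _

theorem comulSeries_formalExp (F : MvPowerSeries (Fin k) (FreeAlgebra ℝ (Fin k))) :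
    comulSeries (formalExp F) = formalExp (comulSeries F) := map_evalAt _ _ _

theorem comulSeries_expVar (i : Fin k) :
    comulSeries (expVar i) = leftSeries (expVar i) * rightSeries (expVar i) := by
  have h : comulSeries (tX i) = leftSeries (tX i) + rightSeries (tX i) := by
    rw [comulSeries, leftSeries, rightSeries, tX, MvPowerSeries.map_monomial,
      MvPowerSeries.map_monomial, MvPowerSeries.map_monomial, ← map_add]
    simp [comul_ι]
  rw [expVar_eq, comulSeries_formalExp, h, formalExp_add
    (constantCoeff_leftSeries (constantCoeff_tX i))
    (constantCoeff_rightSeries (constantCoeff_tX i)) (commute_leftSeries_rightSeries _ _),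
    leftSeries_formalExp, rightSeries_formalExp]

theorem comulSeries_list_prod (l : List (Fin k)) :
    comulSeries (l.map fun i => expVar i).prod =
      leftSeries (l.map fun i => expVar i).prod * rightSeries (l.map fun i => expVar i).prod := by
  induction l with
  | nil => simp [comulSeries, leftSeries, rightSeries]
  | cons i l ih =>
    have hc : ∀ F G : MvPowerSeries (Fin k) (FreeAlgebra ℝ (Fin k)),
        comulSeries (F * G) = comulSeries F * comulSeries G := fun F G => map_mul _ _ _
    have hl : ∀ F G : MvPowerSeries (Fin k) (FreeAlgebra ℝ (Fin k)),
        leftSeries (F * G) = leftSeries F * leftSeries G := fun F G => map_mul _ _ _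
    have hr : ∀ F G : MvPowerSeries (Fin k) (FreeAlgebra ℝ (Fin k)),
        rightSeries (F * G) = rightSeries F * rightSeries G := fun F G => map_mul _ _ _
    rw [List.map_cons, List.prod_cons, hc, ih, comulSeries_expVar, hl, hr, mul_assoc, mul_assoc]
    congr 1
    rw [← mul_assoc, ← (commute_leftSeries_rightSeries _ (expVar i)).eq, mul_assoc]

/-- The logarithm of a grouplike series is primitive. -/
theorem comulSeries_logProd :
    comulSeries (logProd k) = leftSeries (logProd k) + rightSeries (logProd k) := by
  have h0 := constantCoeff_logProd (k := k)
  have hl := constantCoeff_leftSeries h0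
  have hr := constantCoeff_rightSeries h0
  apply formalExp_injective (constantCoeff_comulSeries h0)
  · rw [map_add, hl, hr, add_zero]
  · rw [formalExp_add hl hr (commute_leftSeries_rightSeries _ _), ← comulSeries_formalExp,
      ← leftSeries_formalExp, ← rightSeries_formalExp, formalExp_logProd, expProd,
      List.ofFn_eq_map]
    exact comulSeries_list_prod _

/-- The components of `log (exp X₁ ⋯ exp Xₖ)` are commutator polynomials. -/
theorem exists_commutatorExpansion_eq_logComponent (d : Fin k →₀ ℕ) :
    ∃ Q, commutatorExpansion (Fin k) Q = logComponent d := by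
  by_cases hd : d = 0
  · refine ⟨0, ?_⟩
    rw [map_zero, logComponent_eq, hd, MvPowerSeries.coeff_zero_eq_constantCoeff_apply,
      constantCoeff_logProd]
  · refine exists_commutatorExpansion_eq_of_primitive (n := d.degree)
      (by rwa [Ne, Finsupp.degree_eq_zero_iff]) (fun w hw => ?_) ?_
    · rw [← degree_wordDegree, isMultihomogeneous_logComponent d w hw]
    · have h := congrArg (MvPowerSeries.coeff d) (comulSeries_logProd (k := k))
      rw [map_add, comulSeries, leftSeries, rightSeries, MvPowerSeries.coeff_map,
        MvPowerSeries.coeff_map, MvPowerSeries.coeff_map, ← logComponent_eq] at h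
      exact h

/-- The value of `lieOf` at the components of the logarithm is not a junk value. -/
theorem commutatorExpansion_lieOf_logComponent (d : Fin k →₀ ℕ) :
    commutatorExpansion (Fin k) (lieOf (logComponent d)) = logComponent d :=
  Classical.epsilon_spec (exists_commutatorExpansion_eq_logComponent d)

theorem assocNorm_logComponent_le (d : Fin k →₀ ℕ) :
    assocNorm (logComponent d) ≤ 2 ^ (d.degree - 1) * lieNorm d (lieOf (logComponent d)) := by
  conv_lhs => rw [← commutatorExpansion_lieOf_logComponent]
  exact assocNorm_commutatorExpansion_le d _

theorem lieNorm_logComponent_le {d : Fin k →₀ ℕ} (hd : 1 ≤ d.degree) :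
    lieNorm d (lieOf (logComponent d)) ≤ assocNorm (logComponent d) / (d.degree : ℝ≥0∞) :=
  lieNorm_le_assocNorm_div hd (commutatorExpansion_lieOf_logComponent d)
    (isMultihomogeneous_logComponent d)

theorem logComponent_zero : logComponent (0 : Fin k →₀ ℕ) = 0 := by
  rw [logComponent_eq, MvPowerSeries.coeff_zero_eq_constantCoeff_apply, constantCoeff_logProd]

theorem lieNorm_logComponent_zero :
    lieNorm (0 : Fin k →₀ ℕ) (lieOf (logComponent (0 : Fin k →₀ ℕ))) = 0 := by
  have h : lieOf (logComponent (0 : Fin k →₀ ℕ)) = 0 := by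
    apply commutatorExpansion_injective
    rw [commutatorExpansion_lieOf_logComponent, map_zero, logComponent_zero]
  rw [h]
  refine le_antisymm ((lieNorm_le 0 (by simp) (by simp)).trans (by simp)) zero_le

end Primitive

/-! ### The resolvent representation of the logarithm -/

section Resolvent

/-- The power series `z / (1 + (1 - s) z)`. Its integral over `s ∈ [0, 1]` is `log (1 + z)`. -/
noncomputable def resolventSeries (s : ℝ) : PowerSeries ℝ :=
  PowerSeries.mk fun n => if n = 0 then 0 else (-(1 - s)) ^ (n - 1)

theorem resolventSeries_eq (s : ℝ) : resolventSeries s =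
    PowerSeries.X - (1 - s) • (PowerSeries.X * resolventSeries s) := by
  ext n
  rw [map_sub, PowerSeries.coeff_smul, resolventSeries, PowerSeries.coeff_mk]
  rcases n with _ | n
  · simp
  · rw [PowerSeries.coeff_succ_X_mul, PowerSeries.coeff_mk, PowerSeries.coeff_X]
    rcases n with _ | n
    · simp
    · simp [pow_succ]
      ring

theorem coeff_log_eq_integral (n : ℕ) : (PowerSeries.log ℝ).coeff n =
    ∫ s in (0 : ℝ)..1, (resolventSeries s).coeff n := by
  simp only [resolventSeries, PowerSeries.coeff_mk, PowerSeries.coeff_log]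
  rcases n with _ | n
  · simp
  · have h : ∀ s : ℝ, (-(1 - s)) ^ n = (s - 1) ^ n := fun s => by ring
    simp only [Nat.add_eq_zero_iff, one_ne_zero, and_false, if_false, Nat.add_sub_cancel, h]
    rw [intervalIntegral.integral_comp_sub_right (fun x => x ^ n), integral_pow]
    simp [pow_succ]

variable {X : Type}

/-- The resolvent `f (1 + (1 - s) f)⁻¹` of a formal series without constant coefficient. -/
noncomputable def resolvent (f : MvPowerSeries X (FreeAlgebra ℝ X)) (s : ℝ) :
    MvPowerSeries X (FreeAlgebra ℝ X) := evalAt f (resolventSeries s)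

theorem resolvent_eq {f : MvPowerSeries X (FreeAlgebra ℝ X)}
    (hf : MvPowerSeries.constantCoeff f = 0) (s : ℝ) :
    resolvent f s = f - (1 - s) • (f * resolvent f s) := by
  conv_lhs => rw [resolvent, resolventSeries_eq, evalAt_sub, evalAt_smul, evalAt_mul hf,
    evalAt_X hf]
  rfl

theorem continuous_coeff_resolventSeries (n : ℕ) :
    Continuous fun s => (resolventSeries s).coeff n := by
  simp only [resolventSeries, PowerSeries.coeff_mk]
  split_ifs <;> fun_prop

theorem wordCoeff_coeff_resolvent (f : MvPowerSeries X (FreeAlgebra ℝ X)) (d : X →₀ ℕ)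
    (w : List X) (s : ℝ) : wordCoeff w (MvPowerSeries.coeff d (resolvent f s)) =
      ∑ n ∈ Finset.range (d.degree + 1),
        (resolventSeries s).coeff n * wordCoeff w (MvPowerSeries.coeff d (f ^ n)) := by
  simp only [resolvent, coeff_evalAt, map_sum, map_smul, smul_eq_mul]

theorem continuous_wordCoeff_resolvent (f : MvPowerSeries X (FreeAlgebra ℝ X)) (d : X →₀ ℕ)
    (w : List X) :
    Continuous fun s => wordCoeff w (MvPowerSeries.coeff d (resolvent f s)) := by
  simp only [wordCoeff_coeff_resolvent]
  exact continuous_finsetSum _ fun n _ => (continuous_coeff_resolventSeries n).mul_const _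

theorem wordCoeff_coeff_log_eq_integral (f : MvPowerSeries X (FreeAlgebra ℝ X)) (d : X →₀ ℕ)
    (w : List X) : wordCoeff w (MvPowerSeries.coeff d (evalAt f (PowerSeries.log ℝ))) =
      ∫ s in (0 : ℝ)..1, wordCoeff w (MvPowerSeries.coeff d (resolvent f s)) := by
  simp only [wordCoeff_coeff_resolvent]
  rw [intervalIntegral.integral_finsetSum fun n _ =>
    ((continuous_coeff_resolventSeries n).mul_const _).intervalIntegrable _ _]
  simp only [intervalIntegral.integral_mul_const, ← coeff_log_eq_integral, coeff_evalAt, map_sum,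
    map_smul, smul_eq_mul]

/-! ### Word coefficients of multihomogeneous series -/

/-- The coefficient of the word `w` in a multihomogeneous series. -/
noncomputable def seriesCoeff (F : MvPowerSeries X (FreeAlgebra ℝ X)) (w : List X) : ℝ :=
  wordCoeff w (MvPowerSeries.coeff (wordDegree w) F)

theorem wordCoeff_coeff_eq_zero {F : MvPowerSeries X (FreeAlgebra ℝ X)}
    (hF : IsMultihomogeneousSeries F) {d : X →₀ ℕ} {w : List X} (h : wordDegree w ≠ d) :
    wordCoeff w (MvPowerSeries.coeff d F) = 0 := by
  by_contra h'
  exact h (hF d w h')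

theorem seriesCoeff_mul {F G : MvPowerSeries X (FreeAlgebra ℝ X)}
    (hF : IsMultihomogeneousSeries F) (hG : IsMultihomogeneousSeries G) (w : List X) :
    seriesCoeff (F * G) w = ∑ i ∈ Finset.range (w.length + 1),
      seriesCoeff F (w.take i) * seriesCoeff G (w.drop i) := by
  classical
  rw [seriesCoeff, MvPowerSeries.coeff_mul, map_sum]
  simp only [wordCoeff_mul]
  rw [Finset.sum_comm]
  refine Finset.sum_congr rfl fun i _ => ?_
  rw [Finset.sum_eq_single (wordDegree (w.take i), wordDegree (w.drop i))]
  · rfl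
  · intro p _ hp
    by_cases h1 : wordDegree (w.take i) = p.1
    · have h2 : wordDegree (w.drop i) ≠ p.2 := fun h2 => hp (by rw [h1, h2])
      rw [wordCoeff_coeff_eq_zero hG h2, mul_zero]
    · rw [wordCoeff_coeff_eq_zero hF h1, zero_mul]
  · intro h
    exfalso
    apply h
    rw [Finset.HasAntidiagonal.mem_antidiagonal, ← wordDegree_append, List.take_append_drop]

theorem seriesCoeff_nil (F : MvPowerSeries X (FreeAlgebra ℝ X)) :
    seriesCoeff F [] = wordCoeff [] (MvPowerSeries.constantCoeff F) := by
  rw [seriesCoeff, wordDegree_nil, MvPowerSeries.coeff_zero_eq_constantCoeff_apply]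

end Resolvent

/-! ### The Magnus commutator on words without repetition -/

section MagnusWords

variable {k : ℕ}

theorem seriesCoeff_expVar_nil (i : Fin k) : seriesCoeff (expVar i) [] = 1 := by
  rw [seriesCoeff_nil, expVar_eq, constantCoeff_evalAt]
  simp [PowerSeries.coeff_exp, wordCoeff_one]

theorem seriesCoeff_expVar_singleton (i a : Fin k) :
    seriesCoeff (expVar i) [a] = if a = i then 1 else 0 := by
  rw [seriesCoeff, expVar_eq, formalExp, coeff_evalAt_tX]
  by_cases h : a = i
  · subst h
    simp [PowerSeries.coeff_exp, ← wordMonomial_singleton, wordCoeff_wordMonomial]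
  · have h2 : (Finsupp.single a 1 : Fin k →₀ ℕ) ≠ 0 := by simp
    simp [h, h2]

theorem seriesCoeff_expVar_cons_cons (i : Fin k) {a b : Fin k} (hab : a ≠ b) (w : List (Fin k)) :
    seriesCoeff (expVar i) (a :: b :: w) = 0 := by
  rw [seriesCoeff, expVar_eq, formalExp, coeff_evalAt_tX, if_neg, map_zero]
  intro h
  have key : ∀ c, c ∈ a :: b :: w → c = i := by
    intro c hc
    by_contra hci
    have h1 := congrArg (fun f => f c) h
    simp only [Finsupp.single_apply, if_neg (Ne.symm hci)] at h1
    rw [wordDegree_apply] at h1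
    exact (List.count_pos_iff.2 hc).ne' h1
  exact hab ((key a (by simp)).trans (key b (by simp)).symm)

theorem isMultihomogeneousSeries_expVar (i : Fin k) : IsMultihomogeneousSeries (expVar i) := by
  rw [expVar_eq]
  exact (IsMultihomogeneousSeries.monomial_ι i).evalAt _

theorem seriesCoeff_list_prod {l : List (Fin k)} (hl : l.Nodup) {w : List (Fin k)}
    (hw : w.Nodup) :
    seriesCoeff (l.map fun i => expVar i).prod w = if w.Sublist l then 1 else 0 := by
  induction l generalizing w with
  | nil =>
    rw [List.map_nil, List.prod_nil, seriesCoeff, MvPowerSeries.coeff_one]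
    cases w with
    | nil => simp [wordCoeff_one]
    | cons a w => simp
  | cons i l ih =>
    have hi := (List.nodup_cons.1 hl).1
    have hl' := (List.nodup_cons.1 hl).2
    rw [List.map_cons, List.prod_cons, seriesCoeff_mul (isMultihomogeneousSeries_expVar i)
      (IsMultihomogeneousSeries.list_prod fun F hF => by
        obtain ⟨j, _, rfl⟩ := List.mem_map.1 hF
        exact isMultihomogeneousSeries_expVar j)]
    cases w with
    | nil => simp [seriesCoeff_expVar_nil, ih hl' List.nodup_nil]
    | cons a w =>
      have hw' := (List.nodup_cons.1 hw).2
      rw [List.length_cons, Finset.sum_range_succ', Finset.sum_range_succ', Finset.sum_eq_zero]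
      · simp only [zero_add, List.take_succ_cons, List.take_zero, List.drop_succ_cons,
          List.drop_zero, seriesCoeff_expVar_nil, seriesCoeff_expVar_singleton, ih hl' hw,
          ih hl' hw', one_mul]
        by_cases hai : a = i
        · subst hai
          have h1 : ¬ (a :: w).Sublist l := fun h => hi (h.subset (by simp))
          simp [h1, List.cons_sublist_cons]
        · have h2 : (a :: w).Sublist (i :: l) ↔ (a :: w).Sublist l := by
            rw [List.sublist_cons_iff]
            constructor
            · rintro (h | ⟨r, hr, _⟩)
              · exact h
              · exact absurd (List.cons.inj hr).1 hai
            · exact Or.inl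
          simp [hai, h2]
      · intro j hj
        rw [Finset.mem_range] at hj
        cases w with
        | nil => simp at hj
        | cons b w =>
          have hab : a ≠ b := by
            rintro rfl
            simp at hw
          simp only [List.take_succ_cons]
          rw [seriesCoeff_expVar_cons_cons i hab, zero_mul]

theorem sublist_finRange_iff (w : List (Fin k)) :
    w.Sublist (List.finRange k) ↔ w.Pairwise (· < ·) := by
  constructor
  · exact fun h => (List.sortedLT_finRange k).pairwise.sublist h
  · intro h
    refine List.sublist_of_subperm_of_pairwise (r := (· ≤ ·)) ?_ (h.imp le_of_lt)
      ((List.sortedLT_finRange k).pairwise.imp le_of_lt)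
    have hnd : w.Nodup := h.imp ne_of_lt
    exact hnd.subperm fun x _ => List.mem_finRange x

theorem seriesCoeff_expProd_sub_one {w : List (Fin k)} (hw : w.Nodup) :
    seriesCoeff (expProd k - 1) w = if w ≠ [] ∧ w.Pairwise (· < ·) then 1 else 0 := by
  have h : seriesCoeff (expProd k - 1) w = seriesCoeff (expProd k) w - seriesCoeff 1 w := by
    rw [seriesCoeff, map_sub, map_sub]; rfl
  have h1 : seriesCoeff (1 : MvPowerSeries (Fin k) (FreeAlgebra ℝ (Fin k))) w =
      if w = [] then 1 else 0 := by
    rw [seriesCoeff, MvPowerSeries.coeff_one]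
    cases w with
    | nil => simp [wordCoeff_one]
    | cons a w => simp
  rw [h, h1, expProd, List.ofFn_eq_map, seriesCoeff_list_prod (List.nodup_finRange k) hw]
  simp only [sublist_finRange_iff]
  cases w with
  | nil => simp
  | cons a w => simp

/-- The number of ascents of a word. -/
def ascents {α : Type*} [LinearOrder α] : List α → ℕ
  | [] => 0
  | [_] => 0
  | a :: b :: w => (if a < b then 1 else 0) + ascents (b :: w)

/-- The number of descents of a word. -/
def descents {α : Type*} [LinearOrder α] : List α → ℕ
  | [] => 0
  | [_] => 0
  | a :: b :: w => (if a < b then 0 else 1) + descents (b :: w)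

/-- In the resolvent, each ascent of a word contributes a factor `s` and each descent a factor
`-(1 - s)`. -/
theorem seriesCoeff_resolvent (s : ℝ) {a : Fin k} {w : List (Fin k)} (hw : (a :: w).Nodup) :
    seriesCoeff (resolvent (expProd k - 1) s) (a :: w) =
      s ^ ascents (a :: w) * (-(1 - s)) ^ descents (a :: w) := by
  have hf := isMultihomogeneousSeries_expProd.sub (IsMultihomogeneousSeries.one (X := Fin k))
  have hR : IsMultihomogeneousSeries (resolvent (expProd k - 1) s) := hf.evalAt _
  have hnil : seriesCoeff (resolvent (expProd k - 1) s) [] = 0 := by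
    rw [seriesCoeff_nil, resolvent, constantCoeff_evalAt]
    simp [resolventSeries]
  have hfnil : seriesCoeff (expProd k - 1) [] = 0 := by
    rw [seriesCoeff_expProd_sub_one List.nodup_nil]; simp
  have hrec : ∀ v : List (Fin k), seriesCoeff (resolvent (expProd k - 1) s) v =
      seriesCoeff (expProd k - 1) v - (1 - s) * ∑ i ∈ Finset.range (v.length + 1),
        seriesCoeff (expProd k - 1) (v.take i) *
          seriesCoeff (resolvent (expProd k - 1) s) (v.drop i) := by
    intro v
    rw [← seriesCoeff_mul hf hR]
    conv_lhs => rw [resolvent_eq constantCoeff_expProd_sub_one, seriesCoeff, map_sub, map_sub]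
    congr 1
    exact map_smul (wordCoeff v) _ _
  induction w generalizing a with
  | nil =>
    rw [hrec, seriesCoeff_expProd_sub_one (List.nodup_singleton a)]
    simp [Finset.sum_range_succ, hfnil, hnil, ascents, descents]
  | cons b w ih =>
    have hbw := (List.nodup_cons.1 hw).2
    have hsing : seriesCoeff (expProd k - 1) [a] = 1 := by
      rw [seriesCoeff_expProd_sub_one (List.nodup_singleton a)]; simp
    -- Prepending `a` to a nonempty block keeps it increasing exactly when `a < b`.
    have hcons : ∀ v : List (Fin k), v.Sublist w → seriesCoeff (expProd k - 1) (a :: b :: v) =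
        if a < b then seriesCoeff (expProd k - 1) (b :: v) else 0 := by
      intro v hv
      rw [seriesCoeff_expProd_sub_one (hw.sublist ((hv.cons_cons b).cons_cons a)),
        seriesCoeff_expProd_sub_one (hbw.sublist (hv.cons_cons b))]
      by_cases hab : a < b
      · have h1 : (a :: b :: v).Pairwise (· < ·) ↔ (b :: v).Pairwise (· < ·) := by
          rw [List.pairwise_cons]
          constructor
          · exact fun h => h.2
          · intro h
            refine ⟨fun c hc => ?_, h⟩
            rcases List.mem_cons.1 hc with rfl | hc
            · exact hab
            · exact hab.trans (List.rel_of_pairwise_cons h hc)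
        simp [hab, h1]
      · have h1 : ¬ (a :: b :: v).Pairwise (· < ·) := fun h =>
          hab (List.rel_of_pairwise_cons h (by simp))
        simp only [h1, hab]
        simp
    have h1 := hrec (a :: b :: w)
    have h2 := hrec (b :: w)
    rw [List.length_cons, Finset.sum_range_succ', Finset.sum_range_succ'] at h1
    rw [List.length_cons, Finset.sum_range_succ'] at h2
    simp only [List.take_succ_cons, List.drop_succ_cons, List.take_zero, List.drop_zero, zero_add,
      hfnil, hsing, zero_mul, add_zero, one_mul] at h1 h2
    rw [hcons w (List.Sublist.refl w), Finset.sum_congr rfl fun i _ => by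
      rw [hcons (w.take i) (List.take_sublist i w)]] at h1
    rw [h1]
    have h3 := ih hbw
    by_cases hab : a < b
    · simp only [hab, if_true, ascents, descents, zero_add]
      rw [pow_add, pow_one, mul_assoc, ← h3]
      linear_combination (-1 : ℝ) * h2
    · simp only [hab, if_false, ascents, descents, zero_add, zero_mul, Finset.sum_const_zero]
      rw [pow_add, pow_one, h3]
      ring

theorem integral_pow_mul_one_sub_pow (a b : ℕ) :
    ∫ s in (0 : ℝ)..1, s ^ a * (1 - s) ^ b = (a ! : ℝ) * b ! / (a + b + 1)! := by
  induction b generalizing a with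
  | zero =>
    simp only [pow_zero, mul_one, integral_pow, Nat.factorial_zero, Nat.cast_one, add_zero]
    rw [Nat.factorial_succ]
    have : (a ! : ℝ) ≠ 0 := by positivity
    push_cast
    field_simp
    simp
  | succ b ih =>
    have hderiv : ∀ s : ℝ, HasDerivAt (fun s : ℝ => s ^ (a + 1) * (1 - s) ^ (b + 1))
        ((a + 1) * (s ^ a * (1 - s) ^ (b + 1)) - (b + 1) * (s ^ (a + 1) * (1 - s) ^ b)) s := by
      intro s
      have h1 := hasDerivAt_pow (a + 1) s
      have h2 := ((hasDerivAt_id s).const_sub 1).fun_pow (b + 1)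
      refine (h1.mul h2).congr_deriv ?_
      simp only [Nat.add_sub_cancel, id]
      push_cast
      ring
    have hint := intervalIntegral.integral_eq_sub_of_hasDerivAt (a := 0) (b := 1)
      (fun s _ => hderiv s) (by
        apply Continuous.intervalIntegrable
        fun_prop)
    rw [intervalIntegral.integral_sub (by apply Continuous.intervalIntegrable; fun_prop)
      (by apply Continuous.intervalIntegrable; fun_prop), intervalIntegral.integral_const_mul,
      intervalIntegral.integral_const_mul, ih (a + 1)] at hint
    simp only [ne_eq, Nat.add_eq_zero_iff, one_ne_zero, and_false, not_false_eq_true, zero_pow,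
      sub_self, mul_zero, zero_mul] at hint
    have h3 : a + 1 + b + 1 = a + (b + 1) + 1 := by ring
    rw [h3] at hint
    have h4 : ((a : ℝ) + 1) ≠ 0 := by positivity
    have h5 : ((a + (b + 1) + 1)! : ℝ) ≠ 0 := by positivity
    apply mul_left_cancel₀ h4
    rw [sub_eq_zero.1 hint, Nat.factorial_succ a, Nat.factorial_succ b]
    push_cast
    ring

theorem wordCoeff_magnus {a : Fin k} {w : List (Fin k)} (hw : (a :: w).Nodup)
    (hd : wordDegree (a :: w) = onesDegree k) :
    ‖wordCoeff (a :: w) (magnus k)‖ₑ = ENNReal.ofReal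
      ((ascents (a :: w))! * (descents (a :: w))! /
        (ascents (a :: w) + descents (a :: w) + 1)! : ℝ) := by
  rw [magnus, logComponent_eq, logProd, wordCoeff_coeff_log_eq_integral, ← hd]
  change ‖∫ s in (0 : ℝ)..1, seriesCoeff (resolvent (expProd k - 1) s) (a :: w)‖ₑ = _
  simp only [seriesCoeff_resolvent _ hw, neg_pow (1 - _ : ℝ)]
  have h : ∀ s : ℝ, s ^ ascents (a :: w) * ((-1) ^ descents (a :: w) *
      (1 - s) ^ descents (a :: w)) = (-1) ^ descents (a :: w) *
        (s ^ ascents (a :: w) * (1 - s) ^ descents (a :: w)) := fun s => by ring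
  simp only [h]
  rw [intervalIntegral.integral_const_mul, integral_pow_mul_one_sub_pow, enorm_mul, enorm_pow,
    enorm_neg, enorm_one, one_pow, one_mul, Real.enorm_eq_ofReal (by positivity)]

end MagnusWords

/-! ### Summation over permutations -/

section Permutations

variable {α : Type*} [LinearOrder α]

/-- The absolute value of the coefficient of a word with `a` ascents and `d` descents, and without
repetition, in the Magnus commutator. -/
noncomputable def eulerWeight (a d : ℕ) : ℝ := (a ! : ℝ) * d ! / (a + d + 1)!

theorem ascents_add_descents (a : α) (w : List α) :
    ascents (a :: w) + descents (a :: w) = w.length := by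
  induction w generalizing a with
  | nil => rfl
  | cons b w ih =>
    have := ih b
    rw [ascents, descents, List.length_cons]
    split_ifs <;> omega

theorem eulerWeight_pos (a d : ℕ) : 0 < eulerWeight a d := by
  rw [eulerWeight]; positivity

/-- The weight is the reciprocal of `(a + d + 1) * (a + d).choose a`. -/
theorem le_eulerWeight (a d : ℕ) : 1 / ((a + d + 1 : ℕ) * 2 ^ (a + d) : ℝ) ≤ eulerWeight a d := by
  have h1 : ((a + d).choose a : ℝ) ≤ 2 ^ (a + d) := by
    exact_mod_cast Nat.choose_le_two_pow (a + d) a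
  have h2 : ((a + d)! : ℝ) = (a + d).choose a * a ! * d ! := by
    have := Nat.add_choose_mul_factorial_mul_factorial a d
    rw [← Nat.choose_symm_add] at this
    exact_mod_cast this.symm
  rw [eulerWeight, Nat.factorial_succ, Nat.cast_mul, h2]
  have h3 : 0 < ((a + d).choose a : ℝ) := by
    exact_mod_cast Nat.choose_pos (Nat.le_add_right a d)
  rw [div_le_div_iff₀ (by positivity) (by positivity)]
  have h4 : 0 ≤ ((a + d + 1 : ℕ) : ℝ) * (a ! * d !) := by positivity
  nlinarith [mul_le_mul_of_nonneg_left h1 h4]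

/-- Insertion of a new largest letter `t` somewhere behind the first letter `a`. -/
theorem sum_insert_after_head_eq (F : ℕ → ℕ → ℝ) {t a : α} {w : List α}
    (ht : ∀ x ∈ a :: w, x < t) :
    (((List.permutations'Aux t w).map (List.cons a)).map
        fun v => F (ascents v) (descents v)).sum =
      ascents (a :: w) * F (ascents (a :: w)) (descents (a :: w) + 1) +
        (descents (a :: w) + 1) * F (ascents (a :: w) + 1) (descents (a :: w)) := by
  induction w generalizing F a with
  | nil =>
    have hat : a < t := ht a (by simp)
    simp [List.permutations'Aux, ascents, descents, hat]
  | cons b w ih =>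
    have hat : a < t := ht a (by simp)
    have hbt : ¬ t < b := (ht b (by simp)).asymm
    have h := ih (fun x y => F ((if a < b then 1 else 0) + x) ((if a < b then 0 else 1) + y))
      (fun x hx => ht x (List.mem_cons_of_mem a hx))
    simp only [List.map_map] at h
    simp only [List.permutations'Aux, List.map_cons, List.sum_cons, List.map_map, ascents, descents,
      hat, hbt, if_true, if_false]
    have hcomp : ((fun v => F (ascents v) (descents v)) ∘ List.cons a) ∘ List.cons b =
        (fun v => F ((if a < b then 1 else 0) + ascents v) ((if a < b then 0 else 1) + descents v)) ∘
          List.cons b := by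
      funext v
      simp [ascents, descents]
    rw [← Function.comp_assoc, hcomp, h]
    by_cases hab : a < b
    · simp only [hab, if_true]
      rw [show 1 + (0 + ascents (b :: w)) = 1 + ascents (b :: w) by ring,
        show 0 + (1 + descents (b :: w)) = 0 + descents (b :: w) + 1 by ring,
        show 1 + (ascents (b :: w) + 1) = 1 + ascents (b :: w) + 1 by ring,
        show 0 + (descents (b :: w) + 1) = 0 + descents (b :: w) + 1 by ring]
      push_cast
      ring
    · simp only [hab, if_false]
      rw [show 1 + (0 + ascents (b :: w)) = 0 + ascents (b :: w) + 1 by ring,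
        show 0 + (1 + descents (b :: w)) = 1 + descents (b :: w) by ring,
        show 0 + (ascents (b :: w) + 1) = 0 + ascents (b :: w) + 1 by ring,
        show 1 + (descents (b :: w) + 1) = 1 + descents (b :: w) + 1 by ring]
      push_cast
      ring

/-- Insertion of a new largest letter: inserting it into an ascent or in front adds a descent,
inserting it into a descent or at the end adds an ascent. -/
theorem sum_insert_eq (F : ℕ → ℕ → ℝ) {t a : α} {w : List α}
    (ht : ∀ x ∈ a :: w, x < t) :
    ((List.permutations'Aux t (a :: w)).map fun v => F (ascents v) (descents v)).sum =
      (ascents (a :: w) + 1) * F (ascents (a :: w)) (descents (a :: w) + 1) +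
        (descents (a :: w) + 1) * F (ascents (a :: w) + 1) (descents (a :: w)) := by
  have hta : ¬ t < a := (ht a (by simp)).asymm
  rw [List.permutations'Aux, List.map_cons, List.sum_cons, sum_insert_after_head_eq F ht]
  simp only [ascents, descents, hta, if_false]
  rw [zero_add, add_comm 1]
  ring

/-- The left-hand side is `2 (a + 1) (d + 1) / (a + d + 2)` times the weight, which is estimated
by the inequality between the arithmetic and the geometric mean. -/
theorem eulerWeight_insert_le (a d : ℕ) :
    (a + 1) * eulerWeight a (d + 1) + (d + 1) * eulerWeight (a + 1) d ≤
      ((a + d + 2 : ℕ) : ℝ) / 2 * eulerWeight a d := by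
  have h1 : eulerWeight a (d + 1) = (d + 1) / (a + d + 2) * eulerWeight a d := by
    rw [eulerWeight, eulerWeight, show a + (d + 1) + 1 = (a + d + 1) + 1 by ring,
      Nat.factorial_succ d, Nat.factorial_succ (a + d + 1)]
    have : ((a + d + 1)! : ℝ) ≠ 0 := by positivity
    push_cast
    field_simp
    ring
  have h2 : eulerWeight (a + 1) d = (a + 1) / (a + d + 2) * eulerWeight a d := by
    rw [eulerWeight, eulerWeight, show a + 1 + d + 1 = (a + d + 1) + 1 by ring,
      Nat.factorial_succ a, Nat.factorial_succ (a + d + 1)]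
    have : ((a + d + 1)! : ℝ) ≠ 0 := by positivity
    push_cast
    field_simp
    ring
  have h3 := (eulerWeight_pos a d).le
  rw [h1, h2, ← mul_assoc, ← mul_assoc, ← add_mul]
  refine mul_le_mul_of_nonneg_right ?_ h3
  push_cast
  rw [mul_div_assoc', mul_div_assoc', ← add_div, div_le_div_iff₀ (by positivity) (by positivity)]
  nlinarith [sq_nonneg ((a : ℝ) - d)]

/-- Letters are inserted in increasing order; each insertion into a list of length `n` multiplies
the total weight by at most `(n + 1) / 2`. -/
theorem sum_eulerWeight_permutations_le {l : List α} (hl : l.Pairwise (· > ·)) (hne : l ≠ []) :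
    (l.permutations'.map fun v => eulerWeight (ascents v) (descents v)).sum ≤
      (l.length ! : ℝ) / 2 ^ (l.length - 1) := by
  induction l with
  | nil => exact absurd rfl hne
  | cons t l ih =>
    cases l with
    | nil => simp [List.permutations', List.permutations'Aux, ascents, descents, eulerWeight]
    | cons t' l =>
      rw [List.permutations', List.map_flatMap, List.flatMap, List.sum_flatten, List.map_map]
      have h1 : ∀ v ∈ (t' :: l).permutations',
          ((List.permutations'Aux t v).map fun v => eulerWeight (ascents v) (descents v)).sum ≤
            ((l.length + 2 : ℕ) : ℝ) / 2 * eulerWeight (ascents v) (descents v) := by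
        intro v hv
        rw [List.mem_permutations'] at hv
        cases v with
        | nil => exact absurd hv.length_eq (by simp)
        | cons a w =>
          rw [sum_insert_eq]
          · have h2 := ascents_add_descents a w
            have h3 := hv.length_eq
            simp only [List.length_cons] at h3
            refine (eulerWeight_insert_le _ _).trans (le_of_eq ?_)
            rw [h2, show w.length = l.length by omega]
          · intro x hx
            exact List.rel_of_pairwise_cons hl (hv.subset hx)
      refine (List.sum_le_sum h1).trans ?_
      rw [List.sum_map_mul_left]
      have h2 := ih (List.pairwise_cons.1 hl).2 (by simp)
      refine (mul_le_mul_of_nonneg_left h2 (by positivity)).trans (le_of_eq ?_)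
      simp only [List.length_cons, Nat.add_sub_cancel]
      rw [Nat.factorial_succ (l.length + 1), pow_succ]
      push_cast
      field_simp
      ring

/-- Every single term is bounded from below, because binomial coefficients are at most `2ⁿ`. -/
theorem le_sum_eulerWeight_permutations {l : List α} (hne : l ≠ []) :
    (l.length ! : ℝ) / (l.length * 2 ^ (l.length - 1)) ≤
      (l.permutations'.map fun v => eulerWeight (ascents v) (descents v)).sum := by
  have h1 : ∀ v ∈ l.permutations', 1 / (l.length * 2 ^ (l.length - 1) : ℝ) ≤
      eulerWeight (ascents v) (descents v) := by
    intro v hv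
    rw [List.mem_permutations'] at hv
    cases v with
    | nil => exact absurd (List.nil_perm.1 hv) hne
    | cons a w =>
      have h2 := ascents_add_descents a w
      have h3 := hv.length_eq
      simp only [List.length_cons] at h3
      have h4 := le_eulerWeight (ascents (a :: w)) (descents (a :: w))
      rwa [h2, h3, show w.length = l.length - 1 by omega] at h4
  refine le_trans (le_of_eq ?_) (List.sum_le_sum h1)
  rw [List.map_const', List.sum_replicate, (List.permutations_perm_permutations' l).length_eq.symm,
    List.length_permutations, nsmul_eq_mul]
  ring

end Permutations

/-! ### Bounds for the Magnus characteristic -/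

theorem degree_onesDegree (k : ℕ) : (onesDegree k).degree = k := by
  simp [onesDegree, Finsupp.degree_eq_sum]

theorem degree_bidegree (n m : ℕ) : (bidegree n m).degree = n + m := by
  simp [bidegree, Finsupp.degree_eq_sum]

theorem wordDegree_eq_onesDegree_iff {k : ℕ} (w : List (Fin k)) :
    wordDegree w = onesDegree k ↔ w.Perm (List.finRange k) := by
  rw [List.perm_iff_count, Finsupp.ext_iff]
  simp only [wordDegree_apply, onesDegree, Finsupp.equivFunOnFinite_symm_apply_apply,
    List.count_finRange]

theorem assocNorm_magnus {k : ℕ} (hk : 1 ≤ k) : assocNorm (magnus k) = ENNReal.ofReal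
    (((List.finRange k).reverse.permutations'.map
      fun v => eulerWeight (ascents v) (descents v)).sum) := by
  have hnd : (List.finRange k).reverse.permutations'.Nodup :=
    (List.permutations_perm_permutations' _).nodup_iff.1
      (List.nodup_permutations _ (List.nodup_reverse.2 (List.nodup_finRange k)))
  have hmem : ∀ w : List (Fin k), w ∈ (List.finRange k).reverse.permutations' ↔
      wordDegree w = onesDegree k := by
    intro w
    rw [List.mem_permutations', wordDegree_eq_onesDegree_iff]
    exact ⟨fun h => h.trans (List.reverse_perm _), fun h => h.trans (List.reverse_perm _).symm⟩
  rw [assocNorm_eq_tsum, tsum_eq_sum (s := (List.finRange k).reverse.permutations'.toFinset),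
    ← List.sum_toFinset _ hnd,
    ENNReal.ofReal_sum_of_nonneg fun _ _ => (eulerWeight_pos _ _).le]
  · refine Finset.sum_congr rfl fun w hw => ?_
    rw [List.mem_toFinset, hmem] at hw
    cases w with
    | nil =>
      have := degree_onesDegree k
      rw [← hw] at this
      simp at this
      omega
    | cons a w =>
      rw [wordCoeff_magnus (((wordDegree_eq_onesDegree_iff _).1 hw).nodup_iff.2
        (List.nodup_finRange k)) hw, eulerWeight]
  · intro w hw
    rw [List.mem_toFinset, hmem] at hw
    rw [magnus, enorm_eq_zero]
    by_contra h
    exact hw (isMultihomogeneous_logComponent _ w h)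

theorem Theta_le {k : ℕ} (hk : 1 ≤ k) : Theta k ≤ ENNReal.ofReal (1 / 2 ^ (k - 1)) := by
  have hp : (List.finRange k).reverse.Pairwise (· > ·) :=
    List.pairwise_reverse.2 (List.sortedLT_finRange k).pairwise
  have hne : (List.finRange k).reverse ≠ [] := by
    intro h
    have := congrArg List.length h
    simp at this
    omega
  have h := sum_eulerWeight_permutations_le hp hne
  rw [List.length_reverse, List.length_finRange] at h
  rw [Theta, assocNorm_magnus hk, ← ENNReal.ofReal_natCast (k !),
    ← ENNReal.ofReal_div_of_pos (by positivity)]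
  apply ENNReal.ofReal_le_ofReal
  rw [div_le_iff₀ (by positivity)]
  exact h.trans (le_of_eq (by ring))

theorem le_Theta {k : ℕ} (hk : 1 ≤ k) : ENNReal.ofReal (1 / (k * 2 ^ (k - 1))) ≤ Theta k := by
  have hne : (List.finRange k).reverse ≠ [] := by
    intro h
    have := congrArg List.length h
    simp at this
    omega
  have h := le_sum_eulerWeight_permutations hne
  rw [List.length_reverse, List.length_finRange] at h
  rw [Theta, assocNorm_magnus hk, ← ENNReal.ofReal_natCast (k !),
    ← ENNReal.ofReal_div_of_pos (by positivity)]
  apply ENNReal.ofReal_le_ofReal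
  rw [le_div_iff₀ (by positivity)]
  exact (le_of_eq (by ring)).trans h

/-! ### Absolutely convergent series in Banach algebras -/

section BanachEvaluation

variable {σ A : Type*} [NormedRing A]

/-- The sum of the coefficients of a formal series, that is, its value at `t = (1, …, 1)`. -/
noncomputable def valueAtOne (F : MvPowerSeries σ A) : A := ∑' d, MvPowerSeries.coeff d F

/-- Absolute convergence at `t = (1, …, 1)`. -/
def AbsConvergent (F : MvPowerSeries σ A) : Prop :=
  Summable fun d => ‖MvPowerSeries.coeff d F‖

/-- The sum of the norms of the coefficients of a formal series. -/
noncomputable def coeffNorm (F : MvPowerSeries σ A) : ℝ := ∑' d, ‖MvPowerSeries.coeff d F‖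

theorem absConvergent_one : AbsConvergent (1 : MvPowerSeries σ A) := by
  classical
  refine summable_of_ne_finset_zero (s := {0}) fun d hd => ?_
  rw [MvPowerSeries.coeff_one, if_neg (by simpa using hd), norm_zero]

theorem valueAtOne_one : valueAtOne (1 : MvPowerSeries σ A) = 1 := by
  classical
  rw [valueAtOne, tsum_eq_single 0]
  · simp
  · intro d hd
    rw [MvPowerSeries.coeff_one, if_neg hd]

theorem coeffNorm_one_le : coeffNorm (1 : MvPowerSeries σ A) ≤ ‖(1 : A)‖ := by
  classical
  rw [coeffNorm, tsum_eq_single 0]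
  · simp
  · intro d hd
    rw [MvPowerSeries.coeff_one, if_neg hd, norm_zero]

theorem coeffNorm_nonneg (F : MvPowerSeries σ A) : 0 ≤ coeffNorm F :=
  tsum_nonneg fun _ => norm_nonneg _

variable [CompleteSpace A]

open MvPowerSeries in
theorem AbsConvergent.mul_aux {F G : MvPowerSeries σ A} (hF : AbsConvergent F)
    (hG : AbsConvergent G) : AbsConvergent (F * G) ∧ coeffNorm (F * G) ≤ coeffNorm F * coeffNorm G
      ∧ valueAtOne (F * G) = valueAtOne F * valueAtOne G := by
  classical
  have hF' : Summable fun d => ‖coeff d F‖ := hF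
  have hG' : Summable fun d => ‖coeff d G‖ := hG
  have h1 : Summable fun x : (σ →₀ ℕ) × (σ →₀ ℕ) => ‖coeff x.1 F‖ * ‖coeff x.2 G‖ :=
    Summable.mul_of_nonneg (f := fun d => ‖coeff d F‖) (g := fun d => ‖coeff d G‖) hF' hG'
      (fun d => norm_nonneg (coeff d F)) (fun d => norm_nonneg (coeff d G))
  have h2 : Summable fun d => ∑ p ∈ Finset.HasAntidiagonal.antidiagonal d,
      ‖coeff p.1 F‖ * ‖coeff p.2 G‖ :=
    summable_sum_mul_antidiagonal_of_summable_mul (f := fun d => ‖coeff d F‖)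
      (g := fun d => ‖coeff d G‖) h1
  have h3 : ∀ d, ‖coeff d (F * G)‖ ≤ ∑ p ∈ Finset.HasAntidiagonal.antidiagonal d,
      ‖coeff p.1 F‖ * ‖coeff p.2 G‖ := by
    intro d
    rw [coeff_mul]
    exact (norm_sum_le _ _).trans (Finset.sum_le_sum fun p _ => norm_mul_le _ _)
  have h4 : AbsConvergent (F * G) := h2.of_nonneg_of_le (fun _ => norm_nonneg _) h3
  refine ⟨h4, ?_, ?_⟩
  · rw [coeffNorm, coeffNorm, coeffNorm, Summable.tsum_mul_tsum_eq_tsum_sum_antidiagonal hF' hG' h1]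
    exact Summable.tsum_le_tsum h3 h4 h2
  · rw [valueAtOne, valueAtOne, valueAtOne, Summable.tsum_mul_tsum_eq_tsum_sum_antidiagonal
      hF'.of_norm hG'.of_norm (summable_mul_of_summable_norm hF' hG')]
    exact tsum_congr fun d => coeff_mul _ _ _

theorem AbsConvergent.pow_aux {F : MvPowerSeries σ A} (hF : AbsConvergent F) (n : ℕ) :
    AbsConvergent (F ^ n) ∧ coeffNorm (F ^ n) ≤ ‖(1 : A)‖ * coeffNorm F ^ n
      ∧ valueAtOne (F ^ n) = valueAtOne F ^ n := by
  induction n with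
  | zero =>
    simp only [pow_zero, mul_one]
    exact ⟨absConvergent_one, coeffNorm_one_le, valueAtOne_one⟩
  | succ n ih =>
    obtain ⟨h1, h2, h3⟩ := ih
    obtain ⟨h4, h5, h6⟩ := h1.mul_aux hF
    rw [pow_succ]
    refine ⟨h4, h5.trans ?_, by rw [h6, h3, pow_succ]⟩
    rw [pow_succ, ← mul_assoc]
    exact mul_le_mul_of_nonneg_right h2 (coeffNorm_nonneg F)

variable [NormedAlgebra ℝ A]

open MvPowerSeries in
/-- The formal and the analytic exponential agree on absolutely convergent series. -/
theorem AbsConvergent.formalExp_aux {F : MvPowerSeries σ A} (hF : AbsConvergent F)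
    (h0 : constantCoeff F = 0) : AbsConvergent (formalExp F) ∧
      valueAtOne (formalExp F) = NormedSpace.exp (valueAtOne F) := by
  have hterm : ∀ n d, ‖(PowerSeries.exp ℝ).coeff n • coeff d (F ^ n)‖ =
      (n ! : ℝ)⁻¹ * ‖coeff d (F ^ n)‖ := by
    intro n d
    rw [norm_smul, PowerSeries.coeff_exp]
    simp
  have hsum : Summable fun p : ℕ × (σ →₀ ℕ) =>
      ‖(PowerSeries.exp ℝ).coeff p.1 • coeff p.2 (F ^ p.1)‖ := by
    simp only [hterm]
    rw [summable_prod_of_nonneg fun p => by positivity]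
    refine ⟨fun n => Summable.mul_left (f := fun d => ‖coeff d (F ^ n)‖) ((n ! : ℝ)⁻¹)
      (hF.pow_aux n).1, ?_⟩
    refine Summable.of_nonneg_of_le (fun n => tsum_nonneg fun d => by positivity)
      (f := fun n => ‖(1 : A)‖ * (coeffNorm F ^ n / n !)) (fun n => ?_)
      ((Real.summable_pow_div_factorial _).mul_left _)
    change ∑' d, (n ! : ℝ)⁻¹ * ‖coeff d (F ^ n)‖ ≤ _
    rw [tsum_mul_left]
    have h1 := (hF.pow_aux n).2.1
    calc (n ! : ℝ)⁻¹ * coeffNorm (F ^ n) ≤ (n ! : ℝ)⁻¹ * (‖(1 : A)‖ * coeffNorm F ^ n) := by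
          gcongr
      _ = ‖(1 : A)‖ * (coeffNorm F ^ n / n !) := by ring
  have hcoeff : ∀ d, coeff d (formalExp F) =
      ∑' n, (PowerSeries.exp ℝ).coeff n • coeff d (F ^ n) := by
    intro d
    rw [formalExp, coeff_evalAt, tsum_eq_sum]
    intro n hn
    rw [coeff_pow_eq_zero_of_degree_lt h0 n (by simpa using hn), smul_zero]
  have hswap : Summable fun p : (σ →₀ ℕ) × ℕ =>
      ‖(PowerSeries.exp ℝ).coeff p.2 • coeff p.1 (F ^ p.2)‖ := hsum.prod_symm
  constructor
  · refine Summable.of_nonneg_of_le (fun _ => norm_nonneg _) (fun d => ?_) hswap.prod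
    rw [hcoeff]
    exact norm_tsum_le_tsum_norm (hswap.prod_factor d)
  · rw [valueAtOne, tsum_congr hcoeff, NormedSpace.exp_eq_tsum ℝ]
    rw [Summable.tsum_comm (f := fun n d => (PowerSeries.exp ℝ).coeff n • coeff d (F ^ n))
      hsum.of_norm]
    refine tsum_congr fun n => ?_
    rw [← (hF.pow_aux n).2.2, valueAtOne, ← (hF.pow_aux n).1.of_norm.tsum_const_smul]
    refine tsum_congr fun d => ?_
    rw [PowerSeries.coeff_exp]
    simp

theorem formalExp_monomial_aux (i : σ) (x : A) :
    AbsConvergent (formalExp (MvPowerSeries.monomial (Finsupp.single i 1) x)) ∧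
      valueAtOne (formalExp (MvPowerSeries.monomial (Finsupp.single i 1) x)) =
        NormedSpace.exp x := by
  classical
  have h1 : AbsConvergent (MvPowerSeries.monomial (Finsupp.single i 1) x) := by
    refine summable_of_ne_finset_zero (s := {Finsupp.single i 1}) fun d hd => ?_
    rw [MvPowerSeries.coeff_monomial, if_neg (by simpa using hd), norm_zero]
  have h2 : MvPowerSeries.constantCoeff (MvPowerSeries.monomial (Finsupp.single i 1) x) = 0 := by
    rw [← MvPowerSeries.coeff_zero_eq_constantCoeff_apply, MvPowerSeries.coeff_monomial,
      if_neg (by simp [eq_comm])]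
  have h3 : valueAtOne (MvPowerSeries.monomial (Finsupp.single i 1) x) = x := by
    rw [valueAtOne, tsum_eq_single (Finsupp.single i 1)]
    · simp
    · intro d hd
      rw [MvPowerSeries.coeff_monomial, if_neg hd]
  have h4 := h1.formalExp_aux h2
  rwa [h3] at h4

/-- If the Baker–Campbell–Hausdorff series of `x₀, x₁` converges absolutely in a Banach algebra,
then its sum is a logarithm of `exp x₀ * exp x₁`. -/
theorem exp_tsum_logComponent (x : Fin 2 → A)
    (h : Summable fun d => ‖FreeAlgebra.lift ℝ x (logComponent d)‖) :
    NormedSpace.exp (∑' d, FreeAlgebra.lift ℝ x (logComponent d)) =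
      NormedSpace.exp (x 0) * NormedSpace.exp (x 1) := by
  set T : FreeAlgebra ℝ (Fin 2) →ₐ[ℝ] A := FreeAlgebra.lift ℝ x
  set Z := MvPowerSeries.map (T : FreeAlgebra ℝ (Fin 2) →+* A) (logProd 2) with hZ
  have hcoeff : ∀ d, MvPowerSeries.coeff d Z = T (logComponent d) := by
    intro d
    rw [hZ, MvPowerSeries.coeff_map, logComponent_eq]
    rfl
  have habs : AbsConvergent Z := by
    simpa only [AbsConvergent, hcoeff] using h
  have h0 : MvPowerSeries.constantCoeff Z = 0 := by
    rw [hZ, MvPowerSeries.constantCoeff_map, constantCoeff_logProd, map_zero]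
  have hval : valueAtOne Z = ∑' d, T (logComponent d) := tsum_congr hcoeff
  rw [← hval, ← (habs.formalExp_aux h0).2, hZ, formalExp, ← map_evalAt]
  change valueAtOne (MvPowerSeries.map _ (formalExp (logProd 2))) = _
  have hmono : ∀ i, MvPowerSeries.map (T : FreeAlgebra ℝ (Fin 2) →+* A) (expVar i) =
      formalExp (MvPowerSeries.monomial (Finsupp.single i 1) (x i)) := by
    intro i
    rw [expVar_eq, formalExp, map_evalAt, tX, MvPowerSeries.map_monomial]
    simp [T]
  have hprod : expProd 2 = expVar 0 * expVar 1 := by simp [expProd]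
  rw [formalExp_logProd, hprod, map_mul, hmono, hmono,
    ((formalExp_monomial_aux _ _).1.mul_aux (formalExp_monomial_aux _ _).1).2.2,
    (formalExp_monomial_aux _ _).2, (formalExp_monomial_aux _ _).2]

end BanachEvaluation

/-! ### One-parameter subgroups of `SL₂(ℝ)` -/

section SpecialLinear

open scoped Matrix.Norms.Operator
open NormedSpace

/-- A traceless `2 × 2` matrix of determinant `δ`, hence with square `-δ`. -/
noncomputable def rotationGenerator (δ : ℝ) : Matrix (Fin 2) (Fin 2) ℝ := !![0, -δ; 1, 0]

/-- The generalized cosine: the solution of `C'' = -δ C`, `C(0) = 1`, `C'(0) = 0`. -/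
noncomputable def genCos (δ t : ℝ) : ℝ := exp (t • rotationGenerator δ) 0 0

/-- The generalized sine: the solution of `S'' = -δ S`, `S(0) = 0`, `S'(0) = 1`. -/
noncomputable def genSin (δ t : ℝ) : ℝ := exp (t • rotationGenerator δ) 1 0

/-- The entries of a real `2 × 2` matrix, as continuous linear functionals. -/
noncomputable def entryL (i j : Fin 2) : Matrix (Fin 2) (Fin 2) ℝ →L[ℝ] ℝ :=
  LinearMap.toContinuousLinearMap (Matrix.entryLinearMap ℝ ℝ i j)

theorem exp_rotationGenerator (δ t : ℝ) : exp (t • rotationGenerator δ) =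
    !![genCos δ t, -δ * genSin δ t; genSin δ t, genCos δ t] := by
  have h : rotationGenerator δ * exp (t • rotationGenerator δ) =
      exp (t • rotationGenerator δ) * rotationGenerator δ :=
    (((Commute.refl (rotationGenerator δ)).smul_right t).exp_right)
  have h1 := congrFun (congrFun h 0) 0
  have h2 := congrFun (congrFun h 1) 0
  simp [Matrix.mul_apply, rotationGenerator] at h1 h2
  ext i j
  fin_cases i <;> fin_cases j
  · rfl
  · simp only [genSin]
    simp [rotationGenerator]
    linarith
  · rfl
  · simp [genCos, rotationGenerator]
    linarith

theorem hasDerivAt_entry (i j : Fin 2) (δ t : ℝ) :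
    HasDerivAt (fun t : ℝ => exp (t • rotationGenerator δ) i j)
      ((rotationGenerator δ * exp (t • rotationGenerator δ)) i j) t :=
  (entryL i j).hasFDerivAt.comp_hasDerivAt t (hasDerivAt_exp_smul_const' (rotationGenerator δ) t)

theorem hasDerivAt_genCos (δ t : ℝ) : HasDerivAt (genCos δ) (-δ * genSin δ t) t := by
  refine (hasDerivAt_entry 0 0 δ t).congr_deriv ?_
  rw [exp_rotationGenerator]
  simp [rotationGenerator, Matrix.mul_apply]

theorem hasDerivAt_genSin (δ t : ℝ) : HasDerivAt (genSin δ) (genCos δ t) t := by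
  refine (hasDerivAt_entry 1 0 δ t).congr_deriv ?_
  rw [exp_rotationGenerator]
  simp [rotationGenerator, Matrix.mul_apply]

@[simp] theorem genCos_zero (δ : ℝ) : genCos δ 0 = 1 := by simp [genCos]

@[simp] theorem genSin_zero (δ : ℝ) : genSin δ 0 = 0 := by simp [genSin]

theorem exp_add_rotationGenerator (δ s t : ℝ) : exp ((s + t) • rotationGenerator δ) =
    exp (s • rotationGenerator δ) * exp (t • rotationGenerator δ) := by
  rw [add_smul]
  exact exp_add_of_commute
    (((Commute.refl (rotationGenerator δ)).smul_left s).smul_right t)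

theorem genCos_add (δ s t : ℝ) :
    genCos δ (s + t) = genCos δ s * genCos δ t - δ * genSin δ s * genSin δ t := by
  have h := congrFun (congrFun (exp_add_rotationGenerator δ s t) 0) 0
  simp only [exp_rotationGenerator, Matrix.mul_apply] at h
  simp at h
  linarith

theorem genSin_add (δ s t : ℝ) :
    genSin δ (s + t) = genSin δ s * genCos δ t + genCos δ s * genSin δ t := by
  have h := congrFun (congrFun (exp_add_rotationGenerator δ s t) 1) 0
  simp only [exp_rotationGenerator, Matrix.mul_apply] at h
  simpa using h

theorem genCos_sq_add (δ t : ℝ) : genCos δ t ^ 2 + δ * genSin δ t ^ 2 = 1 := by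
  have h : ∀ t, HasDerivAt (fun t => genCos δ t ^ 2 + δ * genSin δ t ^ 2) 0 t := by
    intro t
    refine (((hasDerivAt_genCos δ t).pow 2).add
      (((hasDerivAt_genSin δ t).pow 2).const_mul δ)).congr_deriv ?_
    push_cast
    ring
  have := is_const_of_deriv_eq_zero (fun t => (h t).differentiableAt) (fun t => (h t).deriv) t 0
  simpa using this

theorem continuous_exp_rotationGenerator :
    Continuous fun p : ℝ × ℝ => exp (p.2 • rotationGenerator p.1) := by
  have h : Continuous rotationGenerator := by
    refine continuous_matrix fun i j => ?_
    fin_cases i <;> fin_cases j <;> simp [rotationGenerator] <;> fun_prop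
  refine (exp_continuous (𝔸 := Matrix (Fin 2) (Fin 2) ℝ)).comp ?_
  fun_prop

theorem continuous_genCos : Continuous fun p : ℝ × ℝ => genCos p.1 p.2 :=
  (entryL 0 0).continuous.comp continuous_exp_rotationGenerator

theorem continuous_genSin : Continuous fun p : ℝ × ℝ => genSin p.1 p.2 :=
  (entryL 1 0).continuous.comp continuous_exp_rotationGenerator

/-- The linear map `A ↦ A₀₀ + A₁₀ Z` transports `exp (t J)` to `exp (t Z)`, since it intertwines
multiplication by `J` with multiplication by `Z`. -/
theorem exp_smul_of_sq_eq {Z : Matrix (Fin 2) (Fin 2) ℝ} {δ : ℝ} (hZ : Z * Z = (-δ) • 1) (t : ℝ) :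
    exp (t • Z) = genCos δ t • 1 + genSin δ t • Z := by
  let T : Matrix (Fin 2) (Fin 2) ℝ →L[ℝ] Matrix (Fin 2) (Fin 2) ℝ :=
    (entryL 0 0).smulRight (1 : Matrix (Fin 2) (Fin 2) ℝ) + (entryL 1 0).smulRight Z
  have hT : ∀ A, T A = A 0 0 • (1 : Matrix (Fin 2) (Fin 2) ℝ) + A 1 0 • Z := fun A => rfl
  have hmul : ∀ A, T (rotationGenerator δ * A) = Z * T A := by
    intro A
    rw [hT, hT, mul_add, mul_smul_comm, mul_smul_comm, hZ, mul_one]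
    simp [rotationGenerator, Matrix.mul_apply]
    rw [add_comm, smul_smul, mul_comm]
  have hpow : ∀ n, T (rotationGenerator δ ^ n) = Z ^ n := by
    intro n
    induction n with
    | zero => simp [hT]
    | succ n ih => rw [pow_succ', hmul, ih, pow_succ']
  have h1 := T.hasSum (NormedSpace.exp_series_hasSum_exp' (𝕂 := ℝ) (t • rotationGenerator δ))
  have h2 := NormedSpace.exp_series_hasSum_exp' (𝕂 := ℝ) (t • Z)
  have h3 : T (exp (t • rotationGenerator δ)) = exp (t • Z) := by
    refine h1.unique (h2.congr_fun fun n => ?_)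
    rw [smul_pow, smul_pow, map_smul, map_smul, hpow]
  rw [← h3, hT]
  rfl

/-- The trace of `exp Z` is `2 cos` of a real or imaginary angle, and
`cos θ = 2 (cos (θ / 2))² - 1 ≥ -1` in both cases since `cos (θ / 2)` is real. -/
theorem neg_two_le_trace_exp {Z : Matrix (Fin 2) (Fin 2) ℝ} (hZ : Z.trace = 0) :
    -2 ≤ (exp Z).trace := by
  rw [Matrix.trace_fin_two] at hZ
  have hsq : Z * Z = (-Z.det) • 1 := by
    rw [Matrix.det_fin_two]
    have : Z 1 1 = -Z 0 0 := by linarith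
    ext i j
    fin_cases i <;> fin_cases j <;> simp [Matrix.mul_apply, this] <;> ring
  have h := exp_smul_of_sq_eq hsq 1
  rw [one_smul] at h
  have h1 : genCos Z.det 1 = 2 * genCos Z.det (1 / 2) ^ 2 - 1 := by
    have h2 := genCos_add Z.det (1 / 2) (1 / 2)
    have h3 := genCos_sq_add Z.det (1 / 2)
    norm_num at h2 h3 ⊢
    linarith
  rw [h, Matrix.trace_add, Matrix.trace_smul, Matrix.trace_smul, Matrix.trace_fin_two Z, hZ,
    Matrix.trace_one, h1]
  simp
  nlinarith [sq_nonneg (genCos Z.det (1 / 2))]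

/-- The squared norm `2 ∑ Aᵢⱼ²`, submultiplicative for commutators on traceless matrices. -/
noncomputable def lieSq (A : Matrix (Fin 2) (Fin 2) ℝ) : ℝ :=
  2 * (A 0 0 ^ 2 + A 0 1 ^ 2 + A 1 0 ^ 2 + A 1 1 ^ 2)

theorem lieSq_nonneg (A : Matrix (Fin 2) (Fin 2) ℝ) : 0 ≤ lieSq A := by
  unfold lieSq; positivity

/-- The difference of the two sides is a square, by Lagrange's identity for the cross product. -/
theorem lieSq_commutator_le {A B : Matrix (Fin 2) (Fin 2) ℝ} (hA : A.trace = 0)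
    (hB : B.trace = 0) : lieSq (A * B - B * A) ≤ lieSq A * lieSq B := by
  rw [Matrix.trace_fin_two] at hA hB
  have hA' : A 1 1 = -A 0 0 := by linarith
  have hB' : B 1 1 = -B 0 0 := by linarith
  simp only [lieSq, Matrix.sub_apply, Matrix.mul_apply, Fin.sum_univ_two, hA', hB']
  nlinarith [sq_nonneg (2 * A 0 0 * B 0 0 + A 0 1 * B 0 1 + A 1 0 * B 1 0)]

theorem abs_entry_le_of_lieSq_le {A : Matrix (Fin 2) (Fin 2) ℝ} {c : ℝ} (hc : 0 ≤ c)
    (h : lieSq A ≤ c ^ 2) (i j : Fin 2) : |A i j| ≤ c := by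
  refine abs_le_of_sq_le_sq ?_ hc
  refine le_trans ?_ h
  unfold lieSq
  fin_cases i <;> fin_cases j <;> simp <;>
    nlinarith [sq_nonneg (A 0 0), sq_nonneg (A 0 1), sq_nonneg (A 1 0), sq_nonneg (A 1 1)]

attribute [local instance] LieRing.ofAssociativeRing

variable {X : Type}

theorem lieMonomial_matrix_bound (x : X → Matrix (Fin 2) (Fin 2) ℝ) {t : ℝ}
    (htr : ∀ i, (x i).trace = 0) (hx : ∀ i, lieSq (x i) ≤ t ^ 2) (γ : FreeMagma X) :
    (FreeAlgebra.lift ℝ x (commutatorExpansion X (lieMonomial γ))).trace = 0 ∧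
      lieSq (FreeAlgebra.lift ℝ x (commutatorExpansion X (lieMonomial γ))) ≤
        (t ^ (multidegree γ).degree) ^ 2 := by
  induction γ using FreeMagma.recOnMul with
  | ih1 i =>
    change (FreeAlgebra.lift ℝ x (commutatorExpansion X (FreeLieAlgebra.of ℝ i))).trace = 0 ∧
      lieSq (FreeAlgebra.lift ℝ x (commutatorExpansion X (FreeLieAlgebra.of ℝ i))) ≤
        (t ^ (Finsupp.single i 1).degree) ^ 2
    rw [commutatorExpansion_of, FreeAlgebra.lift_ι_apply]
    simpa using ⟨htr i, hx i⟩
  | ih2 a b ha hb =>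
    have h : FreeAlgebra.lift ℝ x (commutatorExpansion X (lieMonomial (a * b))) =
        FreeAlgebra.lift ℝ x (commutatorExpansion X (lieMonomial a)) *
          FreeAlgebra.lift ℝ x (commutatorExpansion X (lieMonomial b)) -
        FreeAlgebra.lift ℝ x (commutatorExpansion X (lieMonomial b)) *
          FreeAlgebra.lift ℝ x (commutatorExpansion X (lieMonomial a)) := by
      change FreeAlgebra.lift ℝ x (commutatorExpansion X ⁅lieMonomial a, lieMonomial b⁆) = _
      rw [LieHom.map_lie, Ring.lie_def, map_sub, map_mul, map_mul]
    rw [h]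
    constructor
    · rw [Matrix.trace_sub, Matrix.trace_mul_comm, sub_self]
    · refine (lieSq_commutator_le ha.1 hb.1).trans ?_
      rw [multidegree_mul, map_add, pow_add, mul_pow]
      exact mul_le_mul ha.2 hb.2 (lieSq_nonneg _) (by positivity)

/-- A homomorphism from the free Lie algebra to `sl₂(ℝ)` which is bounded on the generators is
bounded for the `ℓ¹` Lie norm. -/
theorem abs_entry_le_lieNorm (x : X → Matrix (Fin 2) (Fin 2) ℝ) {t : ℝ} (ht : 0 < t)
    (htr : ∀ i, (x i).trace = 0) (hx : ∀ i, lieSq (x i) ≤ t ^ 2) (d : X →₀ ℕ)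
    (P : FreeLieAlgebra ℝ X) (i j : Fin 2) :
    ENNReal.ofReal |FreeAlgebra.lift ℝ x (commutatorExpansion X P) i j| ≤
      lieNorm d P * ENNReal.ofReal t ^ d.degree := by
  have h2 : ENNReal.ofReal t ^ d.degree ≠ 0 := by simp [ht]
  have h3 : ENNReal.ofReal t ^ d.degree ≠ ∞ := ENNReal.pow_ne_top (by simp)
  rw [← ENNReal.div_le_iff h2 h3, lieNorm]
  refine le_iInf fun θ => le_iInf fun hθ => le_iInf fun hP => ?_
  rw [ENNReal.div_le_iff h2 h3, ← ENNReal.ofReal_pow ht.le,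
    ← ENNReal.ofReal_mul' (by positivity)]
  refine ENNReal.ofReal_le_ofReal ?_
  have h4 : FreeAlgebra.lift ℝ x (commutatorExpansion X P) i j = ∑ γ ∈ θ.support,
      θ γ * FreeAlgebra.lift ℝ x (commutatorExpansion X (lieMonomial γ)) i j := by
    rw [← hP, Finsupp.sum, map_sum, map_sum, Matrix.sum_apply]
    refine Finset.sum_congr rfl fun γ _ => ?_
    rw [map_smul, map_smul, Matrix.smul_apply, smul_eq_mul]
  rw [h4, Finsupp.sum, Finset.sum_mul]
  refine (Finset.abs_sum_le_sum_abs _ _).trans (Finset.sum_le_sum fun γ hγ => ?_)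
  rw [abs_mul, ← hθ γ hγ]
  exact mul_le_mul_of_nonneg_left (abs_entry_le_of_lieSq_le (by positivity)
    (lieMonomial_matrix_bound x htr hx γ).2 i j) (abs_nonneg _)

theorem trace_eq_zero_of_lie (x : X → Matrix (Fin 2) (Fin 2) ℝ) (htr : ∀ i, (x i).trace = 0)
    (P : FreeLieAlgebra ℝ X) :
    (FreeAlgebra.lift ℝ x (commutatorExpansion X P)).trace = 0 := by
  obtain ⟨θ, rfl⟩ := exists_presentation P
  rw [Finsupp.sum, map_sum, map_sum, Matrix.trace_sum]
  refine Finset.sum_eq_zero fun γ _ => ?_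
  rw [map_smul, map_smul, Matrix.trace_smul]
  suffices h : (FreeAlgebra.lift ℝ x (commutatorExpansion X (lieMonomial γ))).trace = 0 by
    rw [h, smul_zero]
  cases γ with
  | of i =>
    change (FreeAlgebra.lift ℝ x (commutatorExpansion X (FreeLieAlgebra.of ℝ i))).trace = 0
    rw [commutatorExpansion_of, FreeAlgebra.lift_ι_apply, htr]
  | mul a b =>
    change (FreeAlgebra.lift ℝ x
      (commutatorExpansion X ⁅lieMonomial a, lieMonomial b⁆)).trace = 0
    rw [LieHom.map_lie, Ring.lie_def, map_sub (FreeAlgebra.lift ℝ x),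
      map_mul (FreeAlgebra.lift ℝ x), map_mul (FreeAlgebra.lift ℝ x), Matrix.trace_sub,
      Matrix.trace_mul_comm, sub_self]

end SpecialLinear

/-- Summation over bidegrees. -/
theorem tsum_bidegree (f : (Fin 2 →₀ ℕ) → ℝ≥0∞) :
    ∑' d, f d = ∑' (n : ℕ) (m : ℕ), f (bidegree n m) := by
  rw [← ENNReal.tsum_prod (f := fun n m => f (bidegree n m))]
  exact (((finTwoArrowEquiv ℕ).symm.trans Finsupp.equivFunOnFinite.symm).tsum_eq f).symm

theorem seriesTwo_diagonal (s : ℝ≥0) (f : (Fin 2 →₀ ℕ) → ℝ≥0∞) :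
    seriesTwo (fun n m => f (bidegree n m)) s s = ∑' d, f d * (s : ℝ≥0∞) ^ d.degree := by
  rw [tsum_bidegree, seriesTwo]
  simp only [degree_bidegree, pow_add, mul_assoc]

section SpecialLinear

open scoped Matrix.Norms.Operator
open NormedSpace

theorem norm_le_sum_abs_entry (A : Matrix (Fin 2) (Fin 2) ℝ) : ‖A‖ ≤ ∑ i, ∑ j, |A i j| := by
  have h : (Finset.univ : Finset (Fin 2)).sup (fun i => ∑ j, ‖A i j‖₊) ≤
      ∑ i, ∑ j, ‖A i j‖₊ :=
    Finset.sup_le fun i hi =>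
      Finset.single_le_sum (f := fun i => ∑ j, ‖A i j‖₊) (fun _ _ => zero_le) hi
  rw [Matrix.linfty_opNorm_def]
  exact_mod_cast h

/-- If the Lie norms of the Baker–Campbell–Hausdorff series are summable at `(s, s)`, then
evaluation in `sl₂(ℝ)` bounds the trace of the product of two exponentials from below. -/
theorem neg_two_le_trace_exp_mul_exp {s : ℝ≥0} (hs : seriesTwo GamLie s s < ∞) {t : ℝ}
    (ht : 0 < t) (hts : t ≤ s) (x : Fin 2 → Matrix (Fin 2) (Fin 2) ℝ)
    (htr : ∀ i, (x i).trace = 0) (hx : ∀ i, lieSq (x i) ≤ t ^ 2) :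
    -2 ≤ (exp (x 0) * exp (x 1)).trace := by
  have hs' : ∑' d : Fin 2 →₀ ℕ, lieNorm d (lieOf (logComponent d)) * (s : ℝ≥0∞) ^ d.degree < ∞ := by
    rwa [← seriesTwo_diagonal s (fun d => lieNorm d (lieOf (logComponent d)))]
  have hentry : ∀ d i j, ENNReal.ofReal |FreeAlgebra.lift ℝ x (logComponent d) i j| ≤
      lieNorm d (lieOf (logComponent d)) * (s : ℝ≥0∞) ^ d.degree := by
    intro d i j
    have h := abs_entry_le_lieNorm x ht htr hx d (lieOf (logComponent d)) i j
    rw [commutatorExpansion_lieOf_logComponent] at h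
    refine h.trans (mul_le_mul_right (pow_le_pow_left' ?_ _) _)
    rw [ENNReal.ofReal_le_iff_le_toReal ENNReal.coe_ne_top]
    exact hts
  have hentry_summable : ∀ i j, Summable fun d => |FreeAlgebra.lift ℝ x (logComponent d) i j| := by
    intro i j
    have h := ENNReal.summable_toReal ((ENNReal.tsum_le_tsum fun d => hentry d i j).trans_lt hs').ne
    simpa only [ENNReal.toReal_ofReal (abs_nonneg _)] using h
  have hsum : Summable fun d => ‖FreeAlgebra.lift ℝ x (logComponent d)‖ := by
    exact Summable.of_nonneg_of_le (fun d => norm_nonneg _) (fun d => norm_le_sum_abs_entry _)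
      (summable_sum fun i _ => summable_sum fun j _ => hentry_summable i j)
  have htrace : (∑' d, FreeAlgebra.lift ℝ x (logComponent d)).trace = 0 := by
    have h1 : ∀ i j, (∑' d, FreeAlgebra.lift ℝ x (logComponent d)) i j =
        ∑' d, FreeAlgebra.lift ℝ x (logComponent d) i j := fun i j =>
      (entryL i j).map_tsum hsum.of_norm
    rw [Matrix.trace_fin_two, h1, h1, ← ((hentry_summable 0 0).of_abs).tsum_add
      ((hentry_summable 1 1).of_abs)]
    convert tsum_zero with d
    rw [← Matrix.trace_fin_two, ← commutatorExpansion_lieOf_logComponent]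
    exact trace_eq_zero_of_lie x htr _
  exact le_of_le_of_eq (neg_two_le_trace_exp htrace)
    (congrArg Matrix.trace (exp_tsum_logComponent x hsum))

/-- The bound on the generalized sine forced by the finiteness of the Lie series. It expresses that
the trace `2 - (1 - p²) S(t)²` of `exp (t H₀) * exp (t H₁)` is at least `-2`, for suitable unit
vectors `H₀, H₁` of `sl₂(ℝ)`. -/
theorem genSin_sq_le {s : ℝ≥0} (hs : seriesTwo GamLie s s < ∞) {p : ℝ} (hp : p ∈ Set.Icc 0 1)
    {t : ℝ} (ht : 0 ≤ t) (hts : t ≤ s) :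
    (1 - p ^ 2) / 4 * genSin ((1 - 2 * p ^ 2) / 4) t ^ 2 ≤ 1 := by
  rcases ht.eq_or_lt with rfl | ht
  · simp
  set r := √((1 - p ^ 2) / 4) with hr
  have hr2 : r ^ 2 = (1 - p ^ 2) / 4 := Real.sq_sqrt (by nlinarith [hp.1, hp.2])
  -- The matrices satisfy `H₀² = H₁² = -(1 - 2 * p ^ 2) / 4`, `tr (H₀ H₁) = -1 / 2` and have norm one.
  let H : Fin 2 → Matrix (Fin 2) (Fin 2) ℝ :=
    ![!![0, -(r + p / 2); r - p / 2, 0], !![0, -(r - p / 2); r + p / 2, 0]]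
  have hsq : ∀ i, H i * H i = (-((1 - 2 * p ^ 2) / 4)) • (1 : Matrix (Fin 2) (Fin 2) ℝ) := by
    intro i
    ext a b
    fin_cases i <;> fin_cases a <;> fin_cases b <;> simp [H, Matrix.mul_apply] <;>
      linear_combination -hr2
  have h := neg_two_le_trace_exp_mul_exp hs ht hts (fun i => t • H i)
    (by intro i; fin_cases i <;> simp [H, Matrix.trace_fin_two])
    (by
      intro i
      fin_cases i <;> simp [H, lieSq] <;> apply le_of_eq <;> linear_combination 4 * t ^ 2 * hr2)
  rw [exp_smul_of_sq_eq (hsq 0), exp_smul_of_sq_eq (hsq 1)] at h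
  have hC := genCos_sq_add ((1 - 2 * p ^ 2) / 4) t
  simp [H, Matrix.trace_fin_two, Matrix.mul_apply] at h
  nlinarith

end SpecialLinear

/-! ### The majorant of the resolvent in one variable -/

section Majorant

/-- The generalized sine with parameter `(1 - 2p²)/4`. -/
noncomputable def majNum (p t : ℝ) : ℝ := genSin ((1 - 2 * p ^ 2) / 4) t

/-- The denominator of the majorant `majNum p t / majDen p t`, which solves the Riccati equation
`a' = 1 + p a + q a²`, `a(0) = 0`, with `q = (1 - p²)/4`. The parameter `(1 - 2p²)/4` of the
generalized sine and cosine is `q - p²/4`. -/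
noncomputable def majDen (p t : ℝ) : ℝ :=
  genCos ((1 - 2 * p ^ 2) / 4) t - p / 2 * genSin ((1 - 2 * p ^ 2) / 4) t

@[simp] theorem majNum_zero (p : ℝ) : majNum p 0 = 0 := by simp [majNum]

@[simp] theorem majDen_zero (p : ℝ) : majDen p 0 = 1 := by simp [majDen]

theorem hasDerivAt_majNum (p t : ℝ) :
    HasDerivAt (majNum p) (majDen p t + p / 2 * majNum p t) t :=
  (hasDerivAt_genSin _ t).congr_deriv (by rw [majDen, majNum]; ring)

theorem hasDerivAt_majDen (p t : ℝ) :
    HasDerivAt (majDen p) (-(1 - p ^ 2) / 4 * majNum p t - p / 2 * majDen p t) t :=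
  ((hasDerivAt_genCos _ t).sub ((hasDerivAt_genSin _ t).const_mul (p / 2))).congr_deriv
    (by rw [majDen, majNum]; ring)

theorem continuous_majNum : Continuous fun z : ℝ × ℝ => majNum z.1 z.2 :=
  continuous_genSin.comp (g := fun z : ℝ × ℝ => genSin z.1 z.2)
    (f := fun z : ℝ × ℝ => ((1 - 2 * z.1 ^ 2) / 4, z.2)) (by fun_prop)

theorem continuous_majDen : Continuous fun z : ℝ × ℝ => majDen z.1 z.2 := by
  have h : Continuous fun z : ℝ × ℝ => genCos ((1 - 2 * z.1 ^ 2) / 4) z.2 :=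
    continuous_genCos.comp (g := fun z : ℝ × ℝ => genCos z.1 z.2)
      (f := fun z : ℝ × ℝ => ((1 - 2 * z.1 ^ 2) / 4, z.2)) (by fun_prop)
  have h2 := continuous_majNum
  exact h.sub ((by fun_prop : Continuous fun z : ℝ × ℝ => z.1 / 2).mul h2)

theorem majDen_mul (p t : ℝ) :
    majDen p t * (majDen p t + p * majNum p t) = 1 - (1 - p ^ 2) / 4 * majNum p t ^ 2 := by
  have h := genCos_sq_add ((1 - 2 * p ^ 2) / 4) t
  rw [majDen, majNum]
  linear_combination h

theorem majDen_mul_majDen (p x y : ℝ) :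
    majDen p x * majDen p y - (1 - p ^ 2) / 4 * (majNum p x * majNum p y) = majDen p (x + y) := by
  rw [majDen, majDen, majDen, majNum, majNum, genCos_add, genSin_add]
  ring

/-- As long as the generalized sine satisfies the bound, the function
`1 - (1 - p²)/4 S² = C² - p²/4 S²` is nonnegative, hence stationary at an interior zero of the
denominator, which is impossible. -/
theorem majDen_ne_zero {p : ℝ} (hp : p ≠ 0) {s t : ℝ}
    (hbound : ∀ t, 0 ≤ t → t ≤ s → (1 - p ^ 2) / 4 * majNum p t ^ 2 ≤ 1)
    (h0 : 0 < t) (hts : t < s) : majDen p t ≠ 0 := by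
  intro hz
  have hzero : 1 - (1 - p ^ 2) / 4 * majNum p t ^ 2 = 0 := by rw [← majDen_mul, hz, zero_mul]
  have hmin : IsLocalMin (fun t => 1 - (1 - p ^ 2) / 4 * majNum p t ^ 2) t := by
    filter_upwards [Ioo_mem_nhds h0 hts] with u hu
    simp only [hzero]
    linarith [hbound u hu.1.le hu.2.le]
  have hder : HasDerivAt (fun t => 1 - (1 - p ^ 2) / 4 * majNum p t ^ 2)
      (-((1 - p ^ 2) / 4 * (2 * majNum p t * (majDen p t + p / 2 * majNum p t)))) t := by
    refine ((((hasDerivAt_majNum p t).pow 2).const_mul _).const_sub 1).congr_deriv ?_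
    push_cast
    ring
  have h := hmin.hasDerivAt_eq_zero hder
  rw [hz] at h
  exact hp (by linear_combination -h + p * hzero)

/-- For `p = 0` the previous argument fails, but nonnegativity follows by continuity in `p`, and
the zeros of the denominator are simple. -/
theorem majDen_pos {s : ℝ}
    (hbound : ∀ p ∈ Set.Icc (0 : ℝ) 1, ∀ t, 0 ≤ t → t ≤ s → (1 - p ^ 2) / 4 * majNum p t ^ 2 ≤ 1)
    {p : ℝ} (hp : p ∈ Set.Icc (0 : ℝ) 1) {t : ℝ} (h0 : 0 ≤ t) (hts : t < s) : 0 < majDen p t := by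
  have hcont : ∀ p, Continuous (majDen p) := fun p =>
    continuous_majDen.comp (f := fun t : ℝ => (p, t)) (by fun_prop)
  have hpos : ∀ p ∈ Set.Ioc (0 : ℝ) 1, ∀ t, 0 ≤ t → t < s → 0 < majDen p t := by
    intro p hp t h0 hts
    by_contra! hneg
    obtain ⟨u, hu, hu0⟩ := intermediate_value_Icc' h0 (hcont p).continuousOn
      (show (0 : ℝ) ∈ Set.Icc (majDen p t) (majDen p 0) from ⟨hneg, by simp⟩)
    have hu1 : 0 < u := by
      refine hu.1.lt_of_ne ?_
      rintro rfl
      simp at hu0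
    exact majDen_ne_zero hp.1.ne' (hbound p ⟨hp.1.le, hp.2⟩) hu1 (hu.2.trans_lt hts) hu0
  rcases hp.1.eq_or_lt with rfl | hp0
  · have hnonneg : ∀ t, 0 ≤ t → t < s → 0 ≤ majDen 0 t := by
      intro t h0 hts
      have hc : Filter.Tendsto (fun p => majDen p t) (nhdsWithin 0 (Set.Ioi 0))
          (nhds (majDen 0 t)) :=
        ((continuous_majDen.comp (f := fun p : ℝ => (p, t)) (by fun_prop)).tendsto 0).mono_left
          nhdsWithin_le_nhds
      refine ge_of_tendsto hc ?_
      filter_upwards [Ioc_mem_nhdsGT zero_lt_one] with p hp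
      exact (hpos p hp t h0 hts).le
    refine (hnonneg t h0 hts).lt_of_ne fun hz => ?_
    have h1 : 0 < t := by
      refine h0.lt_of_ne ?_
      rintro rfl
      simp at hz
    have hmin : IsLocalMin (majDen 0) t := by
      filter_upwards [Ioo_mem_nhds h1 hts] with u hu
      rw [← hz]
      exact hnonneg u hu.1.le hu.2
    have hd := hmin.hasDerivAt_eq_zero (hasDerivAt_majDen 0 t)
    have hm := majDen_mul 0 t
    rw [← hz] at hd hm
    nlinarith
  · exact hpos p ⟨hp0, hp.2⟩ t h0 hts

/-- The coefficients of the power series solution of `a' = 1 + p a + q a²`, `a(0) = 0`. -/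
noncomputable def riccatiCoeff (p q : ℝ) : ℕ → ℝ
  | 0 => 0
  | n + 1 => ((if n = 0 then 1 else 0) + p * riccatiCoeff p q n +
      q * ∑ i : Fin (n + 1), riccatiCoeff p q i * riccatiCoeff p q (n - i)) / (n + 1)

theorem succ_mul_riccatiCoeff (p q : ℝ) (n : ℕ) :
    (n + 1) * riccatiCoeff p q (n + 1) = (if n = 0 then 1 else 0) + p * riccatiCoeff p q n +
      q * ∑ z ∈ Finset.HasAntidiagonal.antidiagonal n,
        riccatiCoeff p q z.1 * riccatiCoeff p q z.2 := by
  rw [riccatiCoeff, mul_div_cancel₀ _ (by positivity),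
    Finset.Nat.sum_antidiagonal_eq_sum_range_succ fun i j => riccatiCoeff p q i * riccatiCoeff p q j,
    Finset.sum_range]

theorem riccatiCoeff_nonneg {p q : ℝ} (hp : 0 ≤ p) (hq : 0 ≤ q) (n : ℕ) :
    0 ≤ riccatiCoeff p q n := by
  induction n using Nat.strong_induction_on with
  | _ n ih =>
    rcases n with _ | n
    · simp [riccatiCoeff]
    · rw [riccatiCoeff]
      have h1 := ih n (Nat.lt_succ_self n)
      have h2 : 0 ≤ ∑ i : Fin (n + 1), riccatiCoeff p q i * riccatiCoeff p q (n - i) :=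
        Finset.sum_nonneg fun i _ => mul_nonneg (ih _ i.2) (ih _ (by omega))
      have h3 : (0 : ℝ) ≤ if n = 0 then 1 else 0 := by split_ifs <;> norm_num
      positivity

/-- The partial sums of the solution of the Riccati equation. -/
noncomputable def riccatiSum (p q : ℝ) (N : ℕ) (t : ℝ) : ℝ :=
  ∑ n ∈ Finset.range (N + 1), riccatiCoeff p q n * t ^ n

theorem hasDerivAt_riccatiSum (p q : ℝ) (N : ℕ) (t : ℝ) : HasDerivAt (riccatiSum p q N)
    (∑ n ∈ Finset.range N, (n + 1) * riccatiCoeff p q (n + 1) * t ^ n) t := by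
  have h : HasDerivAt (riccatiSum p q N)
      (∑ n ∈ Finset.range (N + 1), riccatiCoeff p q n * (n * t ^ (n - 1))) t :=
    HasDerivAt.fun_sum fun n _ => (hasDerivAt_pow n t).const_mul _
  refine h.congr_deriv ?_
  rw [Finset.sum_range_succ']
  simp only [Nat.cast_zero, zero_mul, mul_zero, add_zero]
  refine Finset.sum_congr rfl fun n _ => ?_
  push_cast
  ring

/-- Truncation of a convolution with nonnegative terms is at most the square of the truncation. -/
theorem deriv_riccatiSum_le {p q : ℝ} (hp : 0 ≤ p) (hq : 0 ≤ q) (N : ℕ) {t : ℝ} (ht : 0 ≤ t) :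
    ∑ n ∈ Finset.range N, (n + 1) * riccatiCoeff p q (n + 1) * t ^ n ≤
      1 + p * riccatiSum p q N t + q * riccatiSum p q N t ^ 2 := by
  have hnn : ∀ n, 0 ≤ riccatiCoeff p q n * t ^ n := fun n =>
    mul_nonneg (riccatiCoeff_nonneg hp hq n) (by positivity)
  have h1 : ∑ n ∈ Finset.range N, (if n = 0 then (1 : ℝ) else 0) * t ^ n ≤ 1 := by
    rcases N with _ | N
    · simp
    · rw [Finset.sum_range_succ']
      simp
  have h2 : ∑ n ∈ Finset.range N, riccatiCoeff p q n * t ^ n ≤ riccatiSum p q N t :=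
    Finset.sum_le_sum_of_subset_of_nonneg (Finset.range_mono (Nat.le_succ N)) fun n _ _ => hnn n
  have h3 : ∑ n ∈ Finset.range N, (∑ z ∈ Finset.HasAntidiagonal.antidiagonal n,
      riccatiCoeff p q z.1 * riccatiCoeff p q z.2) * t ^ n ≤ riccatiSum p q N t ^ 2 := by
    have h4 : ∀ n, (∑ z ∈ Finset.HasAntidiagonal.antidiagonal n,
        riccatiCoeff p q z.1 * riccatiCoeff p q z.2) * t ^ n =
        ∑ z ∈ Finset.HasAntidiagonal.antidiagonal n,
          (riccatiCoeff p q z.1 * t ^ z.1) * (riccatiCoeff p q z.2 * t ^ z.2) := by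
      intro n
      rw [Finset.sum_mul]
      refine Finset.sum_congr rfl fun z hz => ?_
      rw [← Finset.HasAntidiagonal.mem_antidiagonal.1 hz, pow_add]
      ring
    simp only [h4]
    rw [sq, riccatiSum, Finset.sum_mul_sum, ← Finset.sum_product']
    refine le_of_eq_of_le (Finset.sum_congr rfl fun n hn => ?_)
      (Finset.sum_fiberwise_le_sum_of_sum_fiber_nonneg (t := Finset.range N)
        (g := fun z : ℕ × ℕ => z.1 + z.2)
        fun n _ => Finset.sum_nonneg fun z _ => mul_nonneg (hnn z.1) (hnn z.2))
    refine Finset.sum_congr ?_ fun _ _ => rfl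
    ext z
    rw [Finset.mem_range] at hn
    simp only [Finset.HasAntidiagonal.mem_antidiagonal, Finset.mem_filter, Finset.mem_product,
      Finset.mem_range]
    omega
  calc _ = ∑ n ∈ Finset.range N, (if n = 0 then (1 : ℝ) else 0) * t ^ n +
        p * ∑ n ∈ Finset.range N, riccatiCoeff p q n * t ^ n +
        q * ∑ n ∈ Finset.range N, (∑ z ∈ Finset.HasAntidiagonal.antidiagonal n,
          riccatiCoeff p q z.1 * riccatiCoeff p q z.2) * t ^ n := by
        rw [Finset.mul_sum, Finset.mul_sum, ← Finset.sum_add_distrib, ← Finset.sum_add_distrib]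
        refine Finset.sum_congr rfl fun n _ => ?_
        rw [succ_mul_riccatiCoeff]
        ring
    _ ≤ _ := by gcongr

/-- Comparison: the partial sums `a` stay below the solution `majNum p / majDen p`, since
`F = majNum p - a * majDen p` satisfies `F' ≥ (p / 2 + q a) F` and `F(0) = 0`. -/
theorem riccatiSum_mul_le {p s : ℝ} (hp : p ∈ Set.Icc (0 : ℝ) 1)
    (hpos : ∀ t, 0 ≤ t → t < s → 0 < majDen p t) (N : ℕ) {t : ℝ} (h0 : 0 ≤ t) (hts : t < s) :
    riccatiSum p ((1 - p ^ 2) / 4) N t * majDen p t ≤ majNum p t := by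
  set q := (1 - p ^ 2) / 4 with hq
  have hq0 : 0 ≤ q := by rw [hq]; nlinarith [hp.1, hp.2]
  have hc : Continuous (riccatiSum p q N) :=
    continuous_iff_continuousAt.2 fun t => (hasDerivAt_riccatiSum p q N t).continuousAt
  let B : ℝ → ℝ := fun t => ∫ u in (0 : ℝ)..t, (p / 2 + q * riccatiSum p q N u)
  have hc' : Continuous fun u => p / 2 + q * riccatiSum p q N u := by fun_prop
  have hB : ∀ t, HasDerivAt B (p / 2 + q * riccatiSum p q N t) t := fun t =>
    intervalIntegral.integral_hasDerivAt_right (hc'.intervalIntegrable _ _)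
      (hc'.stronglyMeasurableAtFilter _ _) hc'.continuousAt
  let F : ℝ → ℝ := fun t =>
    (majNum p t - riccatiSum p q N t * majDen p t) * Real.exp (-B t)
  have hF : ∀ t, HasDerivAt F _ t := fun t => ((hasDerivAt_majNum p t).sub
    ((hasDerivAt_riccatiSum p q N t).mul (hasDerivAt_majDen p t))).mul ((hB t).neg.exp)
  have hmono : MonotoneOn F (Set.Icc 0 t) := by
    refine monotoneOn_of_deriv_nonneg (convex_Icc 0 t)
      (fun u _ => (hF u).continuousAt.continuousWithinAt)
      (fun u _ => (hF u).differentiableAt.differentiableWithinAt) fun u hu => ?_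
    rw [interior_Icc] at hu
    have h1 := hpos u hu.1.le (hu.2.trans hts)
    have h2 := mul_le_mul_of_nonneg_right (deriv_riccatiSum_le hp.1 hq0 N hu.1.le) h1.le
    rw [(hF u).deriv]
    simp only [Pi.sub_apply, Pi.mul_apply, Pi.neg_apply]
    rw [← mul_assoc, mul_right_comm, ← add_mul]
    refine mul_nonneg ?_ (Real.exp_pos _).le
    rw [hq] at h2 ⊢
    linarith
  have h := hmono (Set.left_mem_Icc.2 h0) (Set.right_mem_Icc.2 h0) h0
  have hF0 : F 0 = 0 := by
    have : riccatiSum p q N 0 = 0 := by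
      rw [riccatiSum, Finset.sum_range_succ']
      simp [riccatiCoeff]
    simp [F, this]
  rw [hF0] at h
  have := nonneg_of_mul_nonneg_left h (Real.exp_pos _)
  linarith

end Majorant

/-! ### The resolvent of a single exponential -/

section ExpResolvent

/-- The power series `(eᶻ - 1) / (s + (1 - s) eᶻ)`. -/
noncomputable def expResolvent (s : ℝ) : PowerSeries ℝ :=
  (resolventSeries s).subst (PowerSeries.exp ℝ - 1)

theorem constantCoeff_exp_sub_one : PowerSeries.constantCoeff (PowerSeries.exp ℝ - 1) = 0 := by
  simp

theorem expResolvent_eq (s : ℝ) : expResolvent s = (PowerSeries.exp ℝ - 1) -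
    (1 - s) • ((PowerSeries.exp ℝ - 1) * expResolvent s) := by
  have hsub : PowerSeries.HasSubst (PowerSeries.exp ℝ - 1) :=
    PowerSeries.HasSubst.of_constantCoeff_zero' constantCoeff_exp_sub_one
  conv_lhs => rw [expResolvent, resolventSeries_eq, PowerSeries.subst_sub hsub,
    PowerSeries.subst_smul hsub, PowerSeries.subst_mul hsub, PowerSeries.subst_X hsub]
  rfl

/-- The Riccati equation `r' = (1 + s r) (1 - (1 - s) r)`. -/
theorem derivative_expResolvent (s : ℝ) : PowerSeries.derivative ℝ (expResolvent s) =
    (1 + PowerSeries.C s * expResolvent s) * (1 - PowerSeries.C (1 - s) * expResolvent s) := by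
  set r := expResolvent s with hr
  set e := PowerSeries.exp ℝ with he
  have hC : PowerSeries.C (1 - s) = 1 - PowerSeries.C s := by simp
  have h1 : r = (e - 1) - PowerSeries.C (1 - s) * ((e - 1) * r) := by
    rw [← PowerSeries.smul_eq_C_mul]
    exact expResolvent_eq s
  have h2 : PowerSeries.derivative ℝ e = e := PowerSeries.derivative_exp ℝ
  have h3 := congrArg (PowerSeries.derivative ℝ) h1
  rw [map_sub, Derivation.leibniz, Derivation.leibniz, map_sub, h2] at h3
  simp only [smul_eq_mul, PowerSeries.derivative_C, Derivation.map_one_eq_zero, mul_zero, sub_zero,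
    add_zero] at h3
  have hne : 1 + PowerSeries.C (1 - s) * (e - 1) ≠ 0 := by
    intro h
    have := congrArg PowerSeries.constantCoeff h
    simp [he] at this
  apply mul_left_cancel₀ hne
  rw [hC] at h1 h3 ⊢
  linear_combination h3 - PowerSeries.C s * (1 - (1 - PowerSeries.C s) * r) * h1

theorem succ_mul_coeff_expResolvent (s : ℝ) (n : ℕ) :
    (n + 1) * (expResolvent s).coeff (n + 1) = (if n = 0 then 1 else 0) +
      (2 * s - 1) * (expResolvent s).coeff n - s * (1 - s) *
        ∑ z ∈ Finset.HasAntidiagonal.antidiagonal n,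
          (expResolvent s).coeff z.1 * (expResolvent s).coeff z.2 := by
  have h := congrArg (PowerSeries.coeff n) (derivative_expResolvent s)
  have h2 : (1 + PowerSeries.C s * expResolvent s) * (1 - PowerSeries.C (1 - s) * expResolvent s) =
      1 + PowerSeries.C (2 * s - 1) * expResolvent s -
        PowerSeries.C (s * (1 - s)) * (expResolvent s * expResolvent s) := by
    simp only [map_sub, map_mul, map_one, map_ofNat]
    ring
  rw [h2, PowerSeries.coeff_derivative, map_sub, map_add, PowerSeries.coeff_C_mul,
    PowerSeries.coeff_C_mul, PowerSeries.coeff_one, PowerSeries.coeff_mul] at h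
  linarith

theorem coeff_zero_expResolvent (s : ℝ) : (expResolvent s).coeff 0 = 0 := by
  rw [expResolvent_eq]
  simp

/-- The Riccati equations of `expResolvent s` and of the majorant have the same coefficients up to
sign. -/
theorem abs_coeff_expResolvent_le {s : ℝ} (hs : s ∈ Set.Icc (0 : ℝ) 1) (n : ℕ) :
    |(expResolvent s).coeff n| ≤
      riccatiCoeff |1 - 2 * s| ((1 - |1 - 2 * s| ^ 2) / 4) n := by
  have hq : (1 - |1 - 2 * s| ^ 2) / 4 = s * (1 - s) := by rw [sq_abs]; ring
  rw [hq]
  have hq0 : 0 ≤ s * (1 - s) := mul_nonneg hs.1 (by linarith [hs.2])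
  induction n using Nat.strong_induction_on with
  | _ n ih =>
    rcases n with _ | n
    · simp [coeff_zero_expResolvent, riccatiCoeff]
    · have h1 : (0 : ℝ) < n + 1 := by positivity
      refine le_of_mul_le_mul_left ?_ h1
      have h2 : (n + 1 : ℝ) * |(expResolvent s).coeff (n + 1)| =
          |(n + 1) * (expResolvent s).coeff (n + 1)| := by rw [abs_mul, abs_of_pos h1]
      rw [succ_mul_riccatiCoeff, h2, succ_mul_coeff_expResolvent]
      refine (abs_sub _ _).trans (add_le_add ((abs_add_le _ _).trans (add_le_add ?_ ?_)) ?_)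
      · split_ifs <;> simp
      · rw [abs_mul, abs_sub_comm]
        exact mul_le_mul_of_nonneg_left (ih n (Nat.lt_succ_self n)) (abs_nonneg _)
      · rw [abs_mul, abs_of_nonneg hq0]
        refine mul_le_mul_of_nonneg_left ?_ hq0
        refine (Finset.abs_sum_le_sum_abs _ _).trans (Finset.sum_le_sum fun z hz => ?_)
        have hz' := Finset.HasAntidiagonal.mem_antidiagonal.1 hz
        rw [abs_mul]
        exact mul_le_mul (ih _ (by omega)) (ih _ (by omega)) (abs_nonneg _)
          ((abs_nonneg _).trans (ih _ (by omega)))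

theorem resolvent_expVar {k : ℕ} (i : Fin k) (s : ℝ) :
    resolvent (expVar i - 1) s = evalAt (tX i) (expResolvent s) := by
  rw [expResolvent, evalAt_subst (constantCoeff_tX i) constantCoeff_exp_sub_one, evalAt_sub,
    evalAt_one, resolvent, expVar_eq]

end ExpResolvent

/-! ### The resolvent of a product -/

section ProductResolvent

/-- Writing `1 - m R`, `1 - m U`, `1 - m V` for the inverses of `l + m g₀ g₁`, `l + m g₀`,
`l + m g₁`, where `l + m = 1`, one has `1 - m R = (1 - m V) K (1 - m U)` with
`K = (1 + l m U V)⁻¹`. Division by `m` gives the formula below. -/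
theorem resolvent_product {B : Type*} [Ring B] [Algebra ℝ B] {l m : ℝ} (hlm : l = 1 - m)
    (hm : m ≠ 0) {g₀ g₁ U V K R : B}
    (hU : U = (g₀ - 1) - m • ((g₀ - 1) * U)) (hU' : U = (g₀ - 1) - m • (U * (g₀ - 1)))
    (hV : V = (g₁ - 1) - m • ((g₁ - 1) * V))
    (hK : K = 1 - (l * m) • (U * V * K))
    (hR : R = (g₀ * g₁ - 1) - m • (R * (g₀ * g₁ - 1))) :
    R = l • (U * V * K) + V * K + K * U - m • (V * K * U) := by
  subst hlm
  have h1 : (1 - m • U) * g₀ = 1 + (1 - m) • U := by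
    have : m • (U * g₀) = (g₀ - 1) + m • U - U := by
      rw [mul_sub, mul_one, smul_sub] at hU'
      rw [← eq_sub_iff_add_eq.1 hU']
      abel
    rw [sub_mul, one_mul, smul_mul_assoc, this]
    module
  have h2 : g₁ * (1 - m • V) = 1 + (1 - m) • V := by
    have : m • (g₁ * V) = (g₁ - 1) + m • V - V := by
      rw [sub_mul, one_mul, smul_sub] at hV
      rw [← eq_sub_iff_add_eq.1 hV]
      abel
    rw [mul_sub, mul_one, mul_smul_comm, this]
    module
  have h3 : ((1 - m) • 1 + m • g₀) * (1 - m • U) = 1 := by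
    have : m • (g₀ * U) = (g₀ - 1) + m • U - U := by
      rw [sub_mul, one_mul, smul_sub] at hU
      rw [← eq_sub_iff_add_eq.1 hU]
      abel
    rw [add_mul, smul_mul_assoc, smul_mul_assoc, one_mul, mul_sub, mul_one, mul_smul_comm, this]
    module
  have h4 : (1 - m • U) * (1 + m • (g₀ * g₁ - 1)) * (1 - m • V) = 1 + ((1 - m) * m) • (U * V) := by
    have : (1 - m • U) * (1 + m • (g₀ * g₁ - 1)) * (1 - m • V) =
        (1 - m) • ((1 - m • U) * (1 - m • V)) +
          m • (((1 - m • U) * g₀) * (g₁ * (1 - m • V))) := by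
      simp only [mul_add, add_mul, mul_sub, sub_mul, smul_mul_assoc, mul_smul_comm, smul_add,
        smul_sub, smul_smul, mul_assoc, mul_one, one_mul]
      module
    rw [this, h1, h2]
    simp only [mul_add, add_mul, mul_sub, sub_mul, smul_mul_assoc, mul_smul_comm, smul_add,
        smul_sub, smul_smul, mul_one, one_mul]
    module
  have h5 : (1 + ((1 - m) * m) • (U * V)) * K = 1 := by
    rw [add_mul, one_mul, smul_mul_assoc]
    nth_rewrite 1 [hK]
    abel
  have h6 : (1 + m • (g₀ * g₁ - 1)) * ((1 - m • V) * K * (1 - m • U)) = 1 := by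
    calc (1 + m • (g₀ * g₁ - 1)) * ((1 - m • V) * K * (1 - m • U)) =
        (((1 - m) • 1 + m • g₀) * (1 - m • U)) * (1 + m • (g₀ * g₁ - 1)) *
          ((1 - m • V) * K * (1 - m • U)) := by rw [h3, one_mul]
      _ = ((1 - m) • 1 + m • g₀) * (((1 - m • U) * (1 + m • (g₀ * g₁ - 1)) * (1 - m • V)) * K) *
          (1 - m • U) := by simp only [mul_assoc]
      _ = 1 := by rw [h4, h5, mul_one, h3]
  have h7 : (1 - m • R) * (1 + m • (g₀ * g₁ - 1)) = 1 := by
    have : m • (R * (g₀ * g₁ - 1)) = (g₀ * g₁ - 1) - R := by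
      rw [eq_sub_iff_add_eq, add_comm]
      exact eq_sub_iff_add_eq.1 hR
    rw [sub_mul, mul_add, mul_add, one_mul, one_mul, mul_one, smul_mul_assoc, mul_smul_comm, this]
    module
  have h8 : 1 - m • R = (1 - m • V) * K * (1 - m • U) := by
    calc 1 - m • R = (1 - m • R) * ((1 + m • (g₀ * g₁ - 1)) *
          ((1 - m • V) * K * (1 - m • U))) := by rw [h6, mul_one]
      _ = _ := by rw [← mul_assoc, h7, one_mul]
  have h9 : m • R = m • ((1 - m) • (U * V * K) + V * K + K * U - m • (V * K * U)) := by
    have h10 : m • R = 1 - (1 - m • V) * K * (1 - m • U) := by rw [← h8]; abel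
    have h11 : (1 : B) = K + ((1 - m) * m) • (U * V * K) := by
      nth_rewrite 1 [hK]
      abel
    rw [h10]
    nth_rewrite 1 [h11]
    simp only [mul_sub, sub_mul, smul_mul_assoc, mul_smul_comm, smul_add,
        smul_sub, smul_smul, mul_one, one_mul]
    module
  have h12 := congrArg (fun z => m⁻¹ • z) h9
  simpa only [smul_smul, inv_mul_cancel₀ hm, one_smul] using h12

end ProductResolvent

/-! ### Weighted `ℓ¹` norms of formal series -/

section WeightedNorm

variable {k : ℕ}

/-- The monomial `x₁^{d₁} ⋯ xₖ^{dₖ}`. -/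
noncomputable def weight (x : Fin k → ℝ≥0) (d : Fin k →₀ ℕ) : ℝ≥0∞ :=
  ∏ i, (x i : ℝ≥0∞) ^ d i

theorem weight_zero (x : Fin k → ℝ≥0) : weight x 0 = 1 := by simp [weight]

theorem weight_add (x : Fin k → ℝ≥0) (d e : Fin k →₀ ℕ) :
    weight x (d + e) = weight x d * weight x e := by
  simp [weight, pow_add, Finset.prod_mul_distrib]

theorem weight_single (x : Fin k → ℝ≥0) (i : Fin k) :
    weight x (Finsupp.single i 1) = x i := by
  rw [weight, Finset.prod_eq_single i]
  · simp
  · intro j _ hj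
    simp [hj]
  · simp

theorem weight_bidegree (x y : ℝ≥0) (n m : ℕ) :
    weight ![x, y] (bidegree n m) = (x : ℝ≥0∞) ^ n * (y : ℝ≥0∞) ^ m := by
  simp [weight, bidegree]

/-- The weighted `ℓ¹` norm `∑ |F_d|₁ x^d` of a formal series with noncommutative coefficients. -/
noncomputable def weightedNorm (x : Fin k → ℝ≥0)
    (F : MvPowerSeries (Fin k) (FreeAlgebra ℝ (Fin k))) : ℝ≥0∞ :=
  ∑' d, assocNorm (MvPowerSeries.coeff d F) * weight x d

variable (x : Fin k → ℝ≥0) (F G : MvPowerSeries (Fin k) (FreeAlgebra ℝ (Fin k)))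

theorem weightedNorm_add_le : weightedNorm x (F + G) ≤ weightedNorm x F + weightedNorm x G := by
  rw [weightedNorm, weightedNorm, weightedNorm, ← ENNReal.tsum_add]
  refine ENNReal.tsum_le_tsum fun d => ?_
  rw [map_add, ← add_mul]
  exact mul_le_mul_left (assocNorm_add_le _ _) _

theorem weightedNorm_smul (r : ℝ) : weightedNorm x (r • F) = ‖r‖ₑ * weightedNorm x F := by
  rw [weightedNorm, weightedNorm, ← ENNReal.tsum_mul_left]
  refine tsum_congr fun d => ?_
  rw [← mul_assoc, ← assocNorm_smul]
  rfl

theorem weightedNorm_sub_le : weightedNorm x (F - G) ≤ weightedNorm x F + weightedNorm x G := by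
  rw [weightedNorm, weightedNorm, weightedNorm, ← ENNReal.tsum_add]
  refine ENNReal.tsum_le_tsum fun d => ?_
  rw [map_sub, ← add_mul]
  exact mul_le_mul_left (assocNorm_sub_le _ _) _

theorem weightedNorm_mul_le : weightedNorm x (F * G) ≤ weightedNorm x F * weightedNorm x G := by
  classical
  calc weightedNorm x (F * G) ≤ ∑' d, ∑ p ∈ Finset.HasAntidiagonal.antidiagonal d,
        (assocNorm (MvPowerSeries.coeff p.1 F) * weight x p.1) *
          (assocNorm (MvPowerSeries.coeff p.2 G) * weight x p.2) := by
        refine ENNReal.tsum_le_tsum fun d => ?_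
        rw [MvPowerSeries.coeff_mul]
        refine (mul_le_mul_left (assocNorm_sum_le _ _) _).trans ?_
        rw [Finset.sum_mul]
        refine Finset.sum_le_sum fun p hp => ?_
        rw [← Finset.HasAntidiagonal.mem_antidiagonal.1 hp, weight_add, mul_mul_mul_comm]
        exact mul_le_mul_left (assocNorm_mul_le _ _) _
    _ = ∑' d, ∑' p : Finset.HasAntidiagonal.antidiagonal d,
        (assocNorm (MvPowerSeries.coeff p.1.1 F) * weight x p.1.1) *
          (assocNorm (MvPowerSeries.coeff p.1.2 G) * weight x p.1.2) := by
        refine tsum_congr fun d => ?_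
        rw [tsum_fintype]
        exact (Finset.sum_coe_sort (Finset.HasAntidiagonal.antidiagonal d)
          fun p : (Fin k →₀ ℕ) × (Fin k →₀ ℕ) =>
            (assocNorm (MvPowerSeries.coeff p.1 F) * weight x p.1) *
              (assocNorm (MvPowerSeries.coeff p.2 G) * weight x p.2)).symm
    _ = ∑' p : (Fin k →₀ ℕ) × (Fin k →₀ ℕ),
        (assocNorm (MvPowerSeries.coeff p.1 F) * weight x p.1) *
          (assocNorm (MvPowerSeries.coeff p.2 G) * weight x p.2) := by
        rw [← ENNReal.tsum_sigma, ← Finset.HasAntidiagonal.sigmaAntidiagonalEquivProd.tsum_eq]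
        rfl
    _ = weightedNorm x F * weightedNorm x G := by
        rw [ENNReal.tsum_prod', weightedNorm, weightedNorm, ← ENNReal.tsum_mul_right]
        refine tsum_congr fun d => ?_
        rw [← ENNReal.tsum_mul_left]

theorem weightedNorm_monomial_le (d : Fin k →₀ ℕ) (P : FreeAlgebra ℝ (Fin k)) :
    weightedNorm x (MvPowerSeries.monomial d P) ≤ assocNorm P * weight x d := by
  classical
  rw [weightedNorm, tsum_eq_single d]
  · rw [MvPowerSeries.coeff_monomial_same]
  · intro e he
    rw [MvPowerSeries.coeff_monomial, if_neg he, assocNorm_zero, zero_mul]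

theorem weightedNorm_one_le : weightedNorm x 1 ≤ 1 := by
  refine (weightedNorm_monomial_le x 0 1).trans ?_
  rw [weight_zero, mul_one, ← wordMonomial_nil, assocNorm_wordMonomial]

theorem weightedNorm_pow_le (n : ℕ) : weightedNorm x (F ^ n) ≤ weightedNorm x F ^ n := by
  induction n with
  | zero => simpa using weightedNorm_one_le x
  | succ n ih =>
    rw [pow_succ, pow_succ]
    exact (weightedNorm_mul_le x _ _).trans (mul_le_mul_left ih _)

theorem weightedNorm_evalAt_le (a : PowerSeries ℝ) :
    weightedNorm x (evalAt F a) ≤ ∑' n, ‖a.coeff n‖ₑ * weightedNorm x F ^ n := by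
  calc weightedNorm x (evalAt F a) ≤
        ∑' d, ∑' n, ‖a.coeff n‖ₑ * (assocNorm (MvPowerSeries.coeff d (F ^ n)) * weight x d) := by
        refine ENNReal.tsum_le_tsum fun d => ?_
        rw [coeff_evalAt]
        refine (mul_le_mul_left (assocNorm_sum_le _ _) _).trans ?_
        rw [Finset.sum_mul]
        simp only [assocNorm_smul, mul_assoc]
        exact ENNReal.sum_le_tsum _
    _ = ∑' n, ‖a.coeff n‖ₑ * weightedNorm x (F ^ n) := by
        rw [ENNReal.tsum_comm]
        exact tsum_congr fun n => ENNReal.tsum_mul_left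
    _ ≤ _ := ENNReal.tsum_le_tsum fun n => mul_le_mul_right (weightedNorm_pow_le x F n) _

theorem weightedNorm_tX_le (i : Fin k) : weightedNorm x (tX i) ≤ x i := by
  refine (weightedNorm_monomial_le x _ _).trans ?_
  rw [weight_single, ← wordMonomial_singleton, assocNorm_wordMonomial, one_mul]

theorem weightedNorm_resolvent_expVar_le (i : Fin k) (s : ℝ) :
    weightedNorm x (resolvent (expVar i - 1) s) ≤
      ∑' n, ‖(expResolvent s).coeff n‖ₑ * (x i : ℝ≥0∞) ^ n := by
  rw [resolvent_expVar]
  exact (weightedNorm_evalAt_le x _ _).trans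
    (ENNReal.tsum_le_tsum fun n => mul_le_mul_right (pow_le_pow_left' (weightedNorm_tX_le x i) n) _)

end WeightedNorm

/-! ### The resolvent of a product of two exponentials -/

section TwoExponentials

theorem expProd_two : expProd 2 = expVar 0 * expVar 1 := by simp [expProd]

theorem resolvent_eq' {X : Type} {f : MvPowerSeries X (FreeAlgebra ℝ X)}
    (hf : MvPowerSeries.constantCoeff f = 0) (s : ℝ) :
    resolvent f s = f - (1 - s) • (resolvent f s * f) := by
  conv_lhs => rw [resolvent, resolventSeries_eq, mul_comm, evalAt_sub, evalAt_smul, evalAt_mul hf,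
    evalAt_X hf]
  rfl

theorem constantCoeff_expVar_sub_one {k : ℕ} (i : Fin k) :
    MvPowerSeries.constantCoeff (expVar i - 1) = 0 := by
  rw [map_sub, expVar_eq, constantCoeff_evalAt]
  simp

/-- The norm of `(1 + s (1 - s) U V)⁻¹` is estimated by a geometric series. -/
theorem weightedNorm_resolvent_expProd_two_le {s : ℝ} (h0 : 0 ≤ s) (h1 : s < 1) (x : Fin 2 → ℝ≥0)
    {A B : ℝ≥0∞} (hA : weightedNorm x (resolvent (expVar 0 - 1) s) ≤ A)
    (hB : weightedNorm x (resolvent (expVar 1 - 1) s) ≤ B) :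
    weightedNorm x (resolvent (expProd 2 - 1) s) ≤
      (A + B + A * B) * (1 - ENNReal.ofReal (s * (1 - s)) * (A * B))⁻¹ := by
  set U := resolvent (expVar (0 : Fin 2) - 1) s with hU
  set V := resolvent (expVar (1 : Fin 2) - 1) s with hV
  have hU0 : MvPowerSeries.constantCoeff U = 0 := by
    rw [hU, resolvent, constantCoeff_evalAt]
    simp [resolventSeries]
  have hUV0 : MvPowerSeries.constantCoeff (U * V) = 0 := by rw [map_mul, hU0, zero_mul]
  let a : PowerSeries ℝ := PowerSeries.mk fun n => (-(s * (1 - s))) ^ n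
  have ha : a = 1 - (s * (1 - s)) • (PowerSeries.X * a) := by
    ext n
    rw [map_sub, PowerSeries.coeff_smul, PowerSeries.coeff_mk]
    rcases n with _ | n
    · simp
    · rw [PowerSeries.coeff_succ_X_mul, PowerSeries.coeff_mk, PowerSeries.coeff_one]
      simp [pow_succ]
      ring
  set K := evalAt (U * V) a with hK
  have hK1 : K = 1 - (s * (1 - s)) • (U * V * K) := by
    conv_lhs => rw [hK, ha, evalAt_sub, evalAt_smul, evalAt_mul hUV0, evalAt_X hUV0, evalAt_one]
  have hR := resolvent_product (l := s) (m := 1 - s) (by ring) (by linarith)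
    (resolvent_eq (constantCoeff_expVar_sub_one 0) s)
    (resolvent_eq' (constantCoeff_expVar_sub_one 0) s)
    (resolvent_eq (constantCoeff_expVar_sub_one 1) s) hK1
    (by rw [← expProd_two]; exact resolvent_eq' constantCoeff_expProd_sub_one s)
  rw [← hU, ← hV] at hR
  have hAB : weightedNorm x (U * V) ≤ A * B :=
    (weightedNorm_mul_le x _ _).trans (mul_le_mul' hA hB)
  have hKn : weightedNorm x K ≤ (1 - ENNReal.ofReal (s * (1 - s)) * (A * B))⁻¹ := by
    refine (weightedNorm_evalAt_le x _ _).trans ?_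
    rw [← ENNReal.tsum_geometric]
    refine ENNReal.tsum_le_tsum fun n => ?_
    rw [PowerSeries.coeff_mk, enorm_pow, enorm_neg, mul_pow,
      Real.enorm_of_nonneg (mul_nonneg h0 (by linarith))]
    exact mul_le_mul_right (pow_le_pow_left' hAB n) _
  set N := (1 - ENNReal.ofReal (s * (1 - s)) * (A * B))⁻¹
  have hs1 : ‖s‖ₑ + ‖1 - s‖ₑ = 1 := by
    rw [Real.enorm_of_nonneg h0, Real.enorm_of_nonneg (by linarith),
      ← ENNReal.ofReal_add h0 (by linarith)]
    simp
  rw [hR]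
  calc _ ≤ ‖s‖ₑ * (A * B * N) + B * N + N * A + ‖1 - s‖ₑ * (B * N * A) := by
        refine (weightedNorm_sub_le x _ _).trans (add_le_add ((weightedNorm_add_le x _ _).trans
          (add_le_add ((weightedNorm_add_le x _ _).trans (add_le_add ?_ ?_)) ?_)) ?_)
        · rw [weightedNorm_smul]
          exact mul_le_mul_right ((weightedNorm_mul_le x _ _).trans (mul_le_mul' hAB hKn)) _
        · exact (weightedNorm_mul_le x _ _).trans (mul_le_mul' hB hKn)
        · exact (weightedNorm_mul_le x _ _).trans (mul_le_mul' hKn hA)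
        · rw [weightedNorm_smul]
          exact mul_le_mul_right ((weightedNorm_mul_le x _ _).trans (mul_le_mul'
            ((weightedNorm_mul_le x _ _).trans (mul_le_mul' hB hKn)) hA)) _
    _ = (A + B + (‖s‖ₑ + ‖1 - s‖ₑ) * (A * B)) * N := by ring
    _ = _ := by rw [hs1, one_mul]

theorem tsum_enorm_coeff_expResolvent_le {s t : ℝ} (hs : s ∈ Set.Icc (0 : ℝ) 1) {x : ℝ≥0}
    (hx : (x : ℝ) < t) (hpos : ∀ u, 0 ≤ u → u < t → 0 < majDen |1 - 2 * s| u) :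
    ∑' n, ‖(expResolvent s).coeff n‖ₑ * (x : ℝ≥0∞) ^ n ≤
      ENNReal.ofReal (majNum |1 - 2 * s| x / majDen |1 - 2 * s| x) := by
  have hp : |1 - 2 * s| ∈ Set.Icc (0 : ℝ) 1 :=
    ⟨abs_nonneg _, abs_le.2 ⟨by linarith [hs.2], by linarith [hs.1]⟩⟩
  set p := |1 - 2 * s| with hpdef
  set q := (1 - p ^ 2) / 4 with hq
  have hq0 : 0 ≤ q := by rw [hq]; nlinarith [hp.1, hp.2]
  refine ENNReal.tsum_le_of_sum_range_le fun N => ?_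
  have h1 : riccatiSum p q N x ≤ majNum p x / majDen p x := by
    rw [le_div_iff₀ (hpos x x.2 hx)]
    exact riccatiSum_mul_le hp hpos N x.2 hx
  refine le_trans ?_ (ENNReal.ofReal_le_ofReal h1)
  rw [riccatiSum, ENNReal.ofReal_sum_of_nonneg fun n _ =>
    mul_nonneg (riccatiCoeff_nonneg hp.1 hq0 n) (by positivity)]
  refine (Finset.sum_le_sum fun n _ => ?_).trans
    (Finset.sum_le_sum_of_subset (Finset.range_mono (Nat.le_succ N)))
  rw [ENNReal.ofReal_mul (riccatiCoeff_nonneg hp.1 hq0 n), Real.enorm_eq_ofReal_abs,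
    ENNReal.ofReal_pow x.coe_nonneg]
  refine mul_le_mul' (ENNReal.ofReal_le_ofReal (abs_coeff_expResolvent_le hs n)) ?_
  simp

/-- The `ℓ¹` norm of the resolvent of `exp X₁ exp X₂` is bounded by the value of the majorant
obtained from the addition formulas. -/
theorem weightedNorm_resolvent_le {s t : ℝ} (h0 : 0 ≤ s) (h1 : s < 1) {x y : ℝ≥0}
    (hxy : (x : ℝ) + y < t) (hpos : ∀ u, 0 ≤ u → u < t → 0 < majDen |1 - 2 * s| u) :
    weightedNorm ![x, y] (resolvent (expProd 2 - 1) s) ≤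
      ENNReal.ofReal ((majNum |1 - 2 * s| x * majDen |1 - 2 * s| y +
        majNum |1 - 2 * s| y * majDen |1 - 2 * s| x + majNum |1 - 2 * s| x * majNum |1 - 2 * s| y) /
          majDen |1 - 2 * s| (x + y)) := by
  have hs : s ∈ Set.Icc (0 : ℝ) 1 := ⟨h0, h1.le⟩
  have hp : |1 - 2 * s| ∈ Set.Icc (0 : ℝ) 1 :=
    ⟨abs_nonneg _, abs_le.2 ⟨by linarith, by linarith⟩⟩
  have hq : (1 - |1 - 2 * s| ^ 2) / 4 = s * (1 - s) := by rw [sq_abs]; ring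
  have hx : (x : ℝ) < t := by linarith [y.2]
  have hy : (y : ℝ) < t := by linarith [x.2]
  have hA : weightedNorm ![x, y] (resolvent (expVar 0 - 1) s) ≤
      ENNReal.ofReal (majNum |1 - 2 * s| x / majDen |1 - 2 * s| x) :=
    (weightedNorm_resolvent_expVar_le ![x, y] 0 s).trans (tsum_enorm_coeff_expResolvent_le hs hx hpos)
  have hB : weightedNorm ![x, y] (resolvent (expVar 1 - 1) s) ≤
      ENNReal.ofReal (majNum |1 - 2 * s| y / majDen |1 - 2 * s| y) :=
    (weightedNorm_resolvent_expVar_le ![x, y] 1 s).trans (tsum_enorm_coeff_expResolvent_le hs hy hpos)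
  refine (weightedNorm_resolvent_expProd_two_le h0 h1 _ hA hB).trans ?_
  have hS : ∀ u, 0 ≤ u → u < t → 0 ≤ majNum |1 - 2 * s| u := by
    intro u hu0 hut
    simpa [riccatiSum, riccatiCoeff] using riccatiSum_mul_le hp hpos 0 hu0 hut
  have hadd := majDen_mul_majDen |1 - 2 * s| x y
  rw [hq] at hadd
  have hwx := hpos x x.2 hx
  have hwy := hpos y y.2 hy
  have hwxy := hpos (x + y) (by positivity) hxy
  have hSx := hS x x.2 hx
  have hSy := hS y y.2 hy
  have hs0 : 0 ≤ s * (1 - s) := mul_nonneg h0 (by linarith)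
  generalize majNum |1 - 2 * s| x = a at *
  generalize majNum |1 - 2 * s| y = b at *
  generalize majDen |1 - 2 * s| x = c at *
  generalize majDen |1 - 2 * s| y = d at *
  rw [← hadd] at hwxy ⊢
  have hone : 1 - s * (1 - s) * (a / c * (b / d)) = (c * d - s * (1 - s) * (a * b)) / (c * d) := by
    field_simp
  have ha : 0 ≤ a / c := by positivity
  have hb : 0 ≤ b / d := by positivity
  rw [← ENNReal.ofReal_mul ha, ← ENNReal.ofReal_mul hs0, ← ENNReal.ofReal_one,
    ← ENNReal.ofReal_sub _ (by positivity), hone, ← ENNReal.ofReal_inv_of_pos (by positivity),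
    ← ENNReal.ofReal_add ha hb, ← ENNReal.ofReal_add (by positivity) (by positivity),
    ← ENNReal.ofReal_mul (by positivity)]
  refine ENNReal.ofReal_le_ofReal (le_of_eq ?_)
  field_simp

/-- The `ℓ¹` norms of the Baker–Campbell–Hausdorff components are bounded by the mean of those of
the resolvents. -/
theorem weightedNorm_logProd_le {k : ℕ} (x : Fin k → ℝ≥0) : weightedNorm x (logProd k) ≤
    ∫⁻ s in Set.Ioo (0 : ℝ) 1, weightedNorm x (resolvent (expProd k - 1) s) := by
  have hmeas : ∀ (d : Fin k →₀ ℕ) (w : List (Fin k)), Measurable fun s : ℝ =>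
      ‖wordCoeff w (MvPowerSeries.coeff d (resolvent (expProd k - 1) s))‖ₑ := fun d w =>
    (continuous_wordCoeff_resolvent _ d w).measurable.enorm
  have hassoc : ∀ d : Fin k →₀ ℕ, Measurable fun s : ℝ =>
      assocNorm (MvPowerSeries.coeff d (resolvent (expProd k - 1) s)) := by
    intro d
    simp only [assocNorm_eq_tsum]
    exact Measurable.tsum (hmeas d)
  have h1 : ∀ d : Fin k →₀ ℕ, assocNorm (MvPowerSeries.coeff d (logProd k)) ≤
      ∫⁻ s in Set.Ioo (0 : ℝ) 1,
        assocNorm (MvPowerSeries.coeff d (resolvent (expProd k - 1) s)) := by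
    intro d
    simp only [assocNorm_eq_tsum]
    rw [lintegral_tsum fun w => (hmeas d w).aemeasurable]
    refine ENNReal.tsum_le_tsum fun w => ?_
    rw [logProd, wordCoeff_coeff_log_eq_integral, intervalIntegral.integral_of_le zero_le_one,
      ← integral_Ioc_eq_integral_Ioo.symm]
    exact enorm_integral_le_lintegral_enorm _
  simp only [weightedNorm]
  rw [lintegral_tsum fun d => ((hassoc d).mul_const _).aemeasurable]
  refine ENNReal.tsum_le_tsum fun d => ?_
  rw [lintegral_mul_const _ (hassoc d)]
  exact mul_le_mul_left (h1 d) _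

theorem seriesTwo_Gam (x y : ℝ≥0) : seriesTwo Gam x y = weightedNorm ![x, y] (logProd 2) := by
  rw [weightedNorm, tsum_bidegree, seriesTwo]
  refine tsum_congr fun n => tsum_congr fun m => ?_
  rw [weight_bidegree, mul_assoc, Gam, bch, logComponent_eq]

/-- Where the denominators of the majorants stay positive, the Baker–Campbell–Hausdorff series is
bounded. -/
theorem iSup_seriesTwo_Gam_lt_top {t : ℝ} {x : ℝ≥0} (hx : (x : ℝ) < t)
    (hpos : ∀ p ∈ Set.Icc (0 : ℝ) 1, ∀ u, 0 ≤ u → u < t → 0 < majDen p u) :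
    (⨆ (x₁ : ℝ≥0) (x₂ : ℝ≥0) (_ : x₁ + x₂ ≤ x), seriesTwo Gam x₁ x₂) < ∞ := by
  let S : Set (ℝ × ℝ × ℝ) := Set.Icc 0 (1, (x : ℝ), (x : ℝ)) ∩ {z | z.2.1 + z.2.2 ≤ x}
  have hS : IsCompact S :=
    isCompact_Icc.inter_right (isClosed_le (by fun_prop) continuous_const)
  have hn : ∀ f : ℝ × ℝ × ℝ → ℝ, Continuous f →
      Continuous fun z : ℝ × ℝ × ℝ => majNum z.1 (f z) := fun f hf =>
    continuous_majNum.comp (f := fun z : ℝ × ℝ × ℝ => (z.1, f z)) (by fun_prop)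
  have hd : ∀ f : ℝ × ℝ × ℝ → ℝ, Continuous f →
      Continuous fun z : ℝ × ℝ × ℝ => majDen z.1 (f z) := fun f hf =>
    continuous_majDen.comp (f := fun z : ℝ × ℝ × ℝ => (z.1, f z)) (by fun_prop)
  have hc : ContinuousOn (fun z : ℝ × ℝ × ℝ =>
      (majNum z.1 z.2.1 * majDen z.1 z.2.2 + majNum z.1 z.2.2 * majDen z.1 z.2.1 +
        majNum z.1 z.2.1 * majNum z.1 z.2.2) / majDen z.1 (z.2.1 + z.2.2)) S := by
    refine ContinuousOn.div ?_ ?_ ?_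
    · exact ((((hn _ (by fun_prop)).mul (hd _ (by fun_prop))).add
        ((hn _ (by fun_prop)).mul (hd _ (by fun_prop)))).add
        ((hn _ (by fun_prop)).mul (hn _ (by fun_prop)))).continuousOn
    · exact (hd _ (by fun_prop)).continuousOn
    · rintro ⟨p, a, b⟩ ⟨⟨⟨hp0, ha, hb⟩, hp1, -, -⟩, hab⟩
      exact (hpos p ⟨hp0, hp1⟩ (a + b) (add_nonneg ha hb) (lt_of_le_of_lt hab hx)).ne'
  obtain ⟨M, hM⟩ := hS.exists_bound_of_continuousOn hc
  refine lt_of_le_of_lt (b := ENNReal.ofReal M) ?_ ENNReal.ofReal_lt_top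
  refine iSup_le fun a => iSup_le fun b => iSup_le fun hab => ?_
  have hab' : (a : ℝ) + b ≤ x := by exact_mod_cast hab
  rw [seriesTwo_Gam]
  refine (weightedNorm_logProd_le _).trans ?_
  have hle : ∀ s ∈ Set.Ioo (0 : ℝ) 1,
      weightedNorm ![a, b] (resolvent (expProd 2 - 1) s) ≤ ENNReal.ofReal M := by
    intro s hs
    have hp : |1 - 2 * s| ∈ Set.Icc (0 : ℝ) 1 :=
      ⟨abs_nonneg _, abs_le.2 ⟨by linarith [hs.2], by linarith [hs.1]⟩⟩
    refine (weightedNorm_resolvent_le hs.1.le hs.2 (hab'.trans_lt hx) (hpos _ hp)).trans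
      (ENNReal.ofReal_le_ofReal ?_)
    refine (le_abs_self _).trans (hM (|1 - 2 * s|, (a : ℝ), (b : ℝ)) ⟨⟨⟨hp.1, a.2, b.2⟩, hp.2, ?_, ?_⟩,
      hab'⟩)
    · change (a : ℝ) ≤ x
      linarith [b.2]
    · change (b : ℝ) ≤ x
      linarith [a.2]
  calc _ ≤ ∫⁻ _ in Set.Ioo (0 : ℝ) 1, ENNReal.ofReal M :=
        setLIntegral_mono measurable_const hle
    _ = ENNReal.ofReal M := by simp

theorem diagonalRadius_GamLie_le : diagonalRadius GamLie ≤ 2 * cumulativeRadius Gam := by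
  refine iSup_le fun x => iSup_le fun hx => ?_
  have hpos : ∀ p ∈ Set.Icc (0 : ℝ) 1, ∀ u, 0 ≤ u → u < ((x / 2 : ℝ≥0) : ℝ) → 0 < majDen p u :=
    fun p hp u hu0 hu => majDen_pos (fun p hp t ht0 ht => genSin_sq_le hx hp ht0 ht) hp hu0 hu
  have h : ((x / 2 : ℝ≥0) : ℝ≥0∞) ≤ cumulativeRadius Gam := by
    refine ENNReal.le_of_forall_nnreal_lt fun r hr => ?_
    have hr' : (r : ℝ) < ((x / 2 : ℝ≥0) : ℝ) := by exact_mod_cast hr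
    exact le_iSup₂_of_le (f := fun (x : ℝ≥0) (_ : (⨆ (x₁ : ℝ≥0) (x₂ : ℝ≥0) (_ : x₁ + x₂ ≤ x),
      seriesTwo Gam x₁ x₂) < ∞) => (x : ℝ≥0∞)) r (iSup_seriesTwo_Gam_lt_top hr' hpos) le_rfl
  calc (x : ℝ≥0∞) = 2 * ((x / 2 : ℝ≥0) : ℝ≥0∞) := by
        have : x = 2 * (x / 2) := by field_simp
        conv_lhs => rw [this]
        push_cast
        rfl
    _ ≤ _ := mul_le_mul_right h 2

end TwoExponentials

/-! ### Comparison of the coefficients -/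

section Coefficients

theorem Theta_le_two_pow_mul (n : ℕ) : Theta n ≤ 2 ^ (n - 1) * ThetaLie n := by
  rw [Theta, ThetaLie, ← mul_div_assoc]
  refine ENNReal.div_le_div_right ?_ _
  have h := assocNorm_logComponent_le (onesDegree n)
  rwa [degree_onesDegree] at h

theorem ThetaLie_le_div {n : ℕ} (hn : 1 ≤ n) : ThetaLie n ≤ Theta n / n := by
  have h := lieNorm_logComponent_le (d := onesDegree n) (by rwa [degree_onesDegree])
  rw [degree_onesDegree] at h
  rw [Theta, ThetaLie, ENNReal.div_right_comm]
  exact ENNReal.div_le_div_right h _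

theorem Gam_le_two_pow_mul (n m : ℕ) : Gam n m ≤ 2 ^ (n + m - 1) * GamLie n m := by
  have h := assocNorm_logComponent_le (bidegree n m)
  rwa [degree_bidegree] at h

theorem GamLie_le_div {n m : ℕ} (h : 1 ≤ n + m) : GamLie n m ≤ Gam n m / ((n + m : ℕ) : ℝ≥0∞) := by
  have h := lieNorm_logComponent_le (d := bidegree n m) (by rwa [degree_bidegree])
  rwa [degree_bidegree] at h

theorem bidegree_zero_zero : bidegree 0 0 = 0 := by
  ext i
  fin_cases i <;> simp [bidegree]

theorem Gam_zero_zero : Gam 0 0 = 0 := by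
  rw [Gam, bch, bidegree_zero_zero, logComponent_zero, assocNorm_zero]

theorem GamLie_zero_zero : GamLie 0 0 = 0 := by
  rw [GamLie, bch, bidegree_zero_zero, lieNorm_logComponent_zero]

theorem div_natCast_le (a : ℝ≥0∞) {n : ℕ} (hn : 1 ≤ n) : a / n ≤ a :=
  ENNReal.div_le_of_le_mul (by
    conv_lhs => rw [← mul_one a]
    exact mul_le_mul_right (by exact_mod_cast hn) a)

theorem GamLie_le_Gam (n m : ℕ) : GamLie n m ≤ Gam n m := by
  rcases Nat.eq_zero_or_pos (n + m) with h | h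
  · obtain ⟨rfl, rfl⟩ : n = 0 ∧ m = 0 := by omega
    rw [GamLie_zero_zero]
    exact zero_le
  · exact (GamLie_le_div h).trans (div_natCast_le _ h)

end Coefficients

/-! ### Comparison of the series -/

section Series

theorem two_mul_two_pow_mul_half_pow (x : ℝ≥0) (k : ℕ) :
    2 * 2 ^ k * ((x / 2 : ℝ≥0) : ℝ≥0∞) ^ (k + 1) = (x : ℝ≥0∞) ^ (k + 1) := by
  have h : (2 * 2 ^ k * (x / 2) ^ (k + 1) : ℝ≥0) = x ^ (k + 1) := by
    rw [div_pow]
    field_simp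
    ring
  exact_mod_cast h

theorem two_mul_seriesOne_Theta_le (x : ℝ≥0) :
    2 * seriesOne Theta (x / 2) ≤ seriesOne ThetaLie x := by
  rw [seriesOne, seriesOne, ← ENNReal.tsum_mul_left]
  refine ENNReal.tsum_le_tsum fun k => ?_
  rw [← two_mul_two_pow_mul_half_pow x k]
  calc 2 * (Theta (k + 1) * ((x / 2 : ℝ≥0) : ℝ≥0∞) ^ (k + 1)) ≤
        2 * (2 ^ k * ThetaLie (k + 1) * ((x / 2 : ℝ≥0) : ℝ≥0∞) ^ (k + 1)) := by
        gcongr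
        exact Theta_le_two_pow_mul (k + 1)
    _ = _ := by ring

theorem two_mul_seriesTwo_Gam_le (x y : ℝ≥0) :
    2 * seriesTwo Gam (x / 2) (y / 2) ≤ seriesTwo GamLie x y := by
  rw [seriesTwo, seriesTwo, ← ENNReal.tsum_mul_left]
  refine ENNReal.tsum_le_tsum fun n => ?_
  rw [← ENNReal.tsum_mul_left]
  refine ENNReal.tsum_le_tsum fun m => ?_
  rcases Nat.eq_zero_or_pos (n + m) with h | h
  · obtain ⟨rfl, rfl⟩ : n = 0 ∧ m = 0 := by omega
    simp [Gam_zero_zero]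
  · have h2 : (2 * 2 ^ (n + m - 1) * (x / 2) ^ n * (y / 2) ^ m : ℝ≥0) = x ^ n * y ^ m := by
      rw [div_pow, div_pow, ← pow_succ', Nat.sub_add_cancel h, pow_add]
      field_simp
    have h3 : (2 * 2 ^ (n + m - 1) * ((x / 2 : ℝ≥0) : ℝ≥0∞) ^ n * ((y / 2 : ℝ≥0) : ℝ≥0∞) ^ m) =
        (x : ℝ≥0∞) ^ n * (y : ℝ≥0∞) ^ m := by exact_mod_cast h2
    calc 2 * (Gam n m * ((x / 2 : ℝ≥0) : ℝ≥0∞) ^ n * ((y / 2 : ℝ≥0) : ℝ≥0∞) ^ m) ≤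
          2 * (2 ^ (n + m - 1) * GamLie n m * ((x / 2 : ℝ≥0) : ℝ≥0∞) ^ n *
            ((y / 2 : ℝ≥0) : ℝ≥0∞) ^ m) := by
          gcongr
          exact Gam_le_two_pow_mul n m
      _ = GamLie n m * (2 * 2 ^ (n + m - 1) * ((x / 2 : ℝ≥0) : ℝ≥0∞) ^ n *
            ((y / 2 : ℝ≥0) : ℝ≥0∞) ^ m) := by ring
      _ = _ := by rw [h3, mul_assoc]

theorem lintegral_ofReal_pow (x : ℝ≥0) (k : ℕ) :
    ∫⁻ t in Set.Ioc (0 : ℝ) x, ENNReal.ofReal t ^ k = (x : ℝ≥0∞) ^ (k + 1) / (k + 1 : ℕ) := by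
  have h1 : ∫⁻ t in Set.Ioc (0 : ℝ) x, ENNReal.ofReal t ^ k =
      ∫⁻ t in Set.Ioc (0 : ℝ) x, ENNReal.ofReal (t ^ k) :=
    setLIntegral_congr_fun measurableSet_Ioc fun t ht => (ENNReal.ofReal_pow ht.1.le k).symm
  rw [h1, ← ofReal_integral_eq_lintegral_ofReal, ← intervalIntegral.integral_of_le x.coe_nonneg,
    integral_pow, zero_pow (Nat.succ_ne_zero k), sub_zero, ENNReal.ofReal_div_of_pos (by positivity),
    ENNReal.ofReal_pow x.coe_nonneg, ENNReal.ofReal_coe_nnreal]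
  · congr 1
    rw [← Nat.cast_succ, ENNReal.ofReal_natCast]
  · exact ((continuous_pow k).integrableOn_Icc).mono_set Set.Ioc_subset_Icc_self
  · filter_upwards [ae_restrict_mem measurableSet_Ioc] with t ht
    exact pow_nonneg ht.1.le k

theorem seriesOne_div_ofReal (a : ℕ → ℝ≥0∞) (x : ℝ≥0) {t : ℝ} (ht : 0 < t) :
    seriesOne a (x * t.toNNReal) / ENNReal.ofReal t =
      ∑' k, a (k + 1) * (x : ℝ≥0∞) ^ (k + 1) * ENNReal.ofReal t ^ k := by
  rw [seriesOne, div_eq_mul_inv, ← ENNReal.tsum_mul_right]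
  refine tsum_congr fun k => ?_
  have h0 : ENNReal.ofReal t ≠ 0 := by simpa using ht
  rw [ENNReal.coe_mul, mul_pow, pow_succ (_ : ℝ≥0∞) k, pow_succ ((t.toNNReal : ℝ≥0∞)) k]
  change a (k + 1) * (_ * (ENNReal.ofReal t ^ k * ENNReal.ofReal t)) * _ = _
  rw [← mul_assoc (a (k + 1)), ← mul_assoc _ _ (ENNReal.ofReal t), mul_assoc _ (ENNReal.ofReal t),
    ENNReal.mul_inv_cancel h0 ENNReal.ofReal_ne_top, mul_one]

theorem lintegral_seriesOne (a : ℕ → ℝ≥0∞) (x y : ℝ≥0) :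
    ∫⁻ t in Set.Ioc (0 : ℝ) y, seriesOne a (x * t.toNNReal) / ENNReal.ofReal t =
      ∑' k, a (k + 1) * (x : ℝ≥0∞) ^ (k + 1) * ((y : ℝ≥0∞) ^ (k + 1) / (k + 1 : ℕ)) := by
  rw [setLIntegral_congr_fun measurableSet_Ioc fun t ht => seriesOne_div_ofReal a x ht.1,
    lintegral_tsum fun k => by fun_prop]
  refine tsum_congr fun k => ?_
  rw [lintegral_const_mul _ (by fun_prop), lintegral_ofReal_pow]

theorem lintegral_seriesOne_unit (a : ℕ → ℝ≥0∞) (x : ℝ≥0) :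
    ∫⁻ t in Set.Ioc (0 : ℝ) 1, seriesOne a (x * t.toNNReal) / ENNReal.ofReal t =
      ∑' k, a (k + 1) / (k + 1 : ℕ) * (x : ℝ≥0∞) ^ (k + 1) := by
  refine (lintegral_seriesOne a x 1).trans (tsum_congr fun k => ?_)
  rw [ENNReal.coe_one, one_pow, one_div, mul_right_comm, div_eq_mul_inv]

/-- Both integrals are equal to `∑ aₖ xᵏ / k`. -/
theorem lintegral_seriesOne_eq (a : ℕ → ℝ≥0∞) (x : ℝ≥0) :
    ∫⁻ t in Set.Ioc (0 : ℝ) 1, seriesOne a (x * t.toNNReal) / ENNReal.ofReal t =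
      ∫⁻ t in Set.Ioc (0 : ℝ) x, seriesOne a t.toNNReal / ENNReal.ofReal t := by
  have h := lintegral_seriesOne a 1 x
  simp only [one_mul] at h
  rw [lintegral_seriesOne_unit, h]
  refine tsum_congr fun k => ?_
  rw [ENNReal.coe_one, one_pow, mul_one, div_eq_mul_inv, div_eq_mul_inv, mul_right_comm, mul_assoc]

theorem seriesOne_ThetaLie_le (x : ℝ≥0) : seriesOne ThetaLie x ≤
    ∫⁻ t in Set.Ioc (0 : ℝ) 1, seriesOne Theta (x * t.toNNReal) / ENNReal.ofReal t := by
  rw [lintegral_seriesOne_unit]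
  exact ENNReal.tsum_le_tsum fun k => mul_le_mul_left (ThetaLie_le_div (Nat.le_add_left 1 k)) _

theorem seriesTwo_GamLie_le (x y : ℝ≥0) : seriesTwo GamLie x y ≤
    ∫⁻ t in Set.Ioc (0 : ℝ) 1,
      seriesTwo Gam (x * t.toNNReal) (y * t.toNNReal) / ENNReal.ofReal t := by
  have hmeas : ∀ n m, Measurable fun t : ℝ => Gam n m * ((x * t.toNNReal : ℝ≥0) : ℝ≥0∞) ^ n *
      ((y * t.toNNReal : ℝ≥0) : ℝ≥0∞) ^ m / ENNReal.ofReal t := by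
    intro n m
    fun_prop
  have h1 : ∀ t : ℝ, seriesTwo Gam (x * t.toNNReal) (y * t.toNNReal) / ENNReal.ofReal t =
      ∑' n, ∑' m, Gam n m * ((x * t.toNNReal : ℝ≥0) : ℝ≥0∞) ^ n *
        ((y * t.toNNReal : ℝ≥0) : ℝ≥0∞) ^ m / ENNReal.ofReal t := by
    intro t
    simp only [seriesTwo, div_eq_mul_inv, ENNReal.tsum_mul_right]
  simp only [h1]
  rw [lintegral_tsum fun n => (Measurable.tsum (hmeas n)).aemeasurable, seriesTwo]
  refine ENNReal.tsum_le_tsum fun n => ?_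
  rw [lintegral_tsum fun m => (hmeas n m).aemeasurable]
  refine ENNReal.tsum_le_tsum fun m => ?_
  rcases Nat.eq_zero_or_pos (n + m) with h | h
  · obtain ⟨rfl, rfl⟩ : n = 0 ∧ m = 0 := by omega
    simp [GamLie_zero_zero]
  · have h2 : ∀ t ∈ Set.Ioc (0 : ℝ) 1, Gam n m * ((x * t.toNNReal : ℝ≥0) : ℝ≥0∞) ^ n *
        ((y * t.toNNReal : ℝ≥0) : ℝ≥0∞) ^ m / ENNReal.ofReal t =
          Gam n m * (x : ℝ≥0∞) ^ n * (y : ℝ≥0∞) ^ m * ENNReal.ofReal t ^ (n + m - 1) := by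
      intro t ht
      have h0 : ENNReal.ofReal t ≠ 0 := by simpa using ht.1
      have h3 : ENNReal.ofReal t ^ n * ENNReal.ofReal t ^ m =
          ENNReal.ofReal t ^ (n + m - 1) * ENNReal.ofReal t := by
        rw [← pow_add, ← pow_succ, Nat.sub_add_cancel h]
      rw [ENNReal.coe_mul, ENNReal.coe_mul, mul_pow, mul_pow]
      change Gam n m * (_ * ENNReal.ofReal t ^ n) * (_ * ENNReal.ofReal t ^ m) / _ = _
      calc _ = Gam n m * (x : ℝ≥0∞) ^ n * (y : ℝ≥0∞) ^ m *
            (ENNReal.ofReal t ^ n * ENNReal.ofReal t ^ m) * (ENNReal.ofReal t)⁻¹ := by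
            rw [div_eq_mul_inv]
            ring
        _ = _ := by
            rw [h3, ← mul_assoc, mul_assoc _ (ENNReal.ofReal t),
              ENNReal.mul_inv_cancel h0 ENNReal.ofReal_ne_top, mul_one]
    have h3 := lintegral_ofReal_pow 1 (n + m - 1)
    rw [Nat.sub_add_cancel h, ENNReal.coe_one, one_pow, NNReal.coe_one] at h3
    rw [setLIntegral_congr_fun measurableSet_Ioc h2, lintegral_const_mul _ (by fun_prop), h3]
    calc GamLie n m * (x : ℝ≥0∞) ^ n * (y : ℝ≥0∞) ^ m ≤
          Gam n m / ((n + m : ℕ) : ℝ≥0∞) * (x : ℝ≥0∞) ^ n * (y : ℝ≥0∞) ^ m := by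
          gcongr
          exact GamLie_le_div h
      _ = _ := by
          rw [div_eq_mul_inv, one_div]
          ring

end Series

/-! ### Convergence radii -/

section Radii

/-- The coefficients are at most `2 ^ (1 - k)`. -/
theorem two_le_convRadius_ThetaLie : 2 ≤ convRadius ThetaLie := by
  refine ENNReal.le_of_forall_nnreal_lt fun x hx => ?_
  have hx' : x / 2 < 1 := by
    rw [div_lt_one (by norm_num)]
    exact_mod_cast hx
  refine le_iSup₂_of_le (f := fun (x : ℝ≥0) (_ : seriesOne ThetaLie x < ∞) => (x : ℝ≥0∞)) x ?_ le_rfl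
  have hterm : ∀ k, ThetaLie (k + 1) * (x : ℝ≥0∞) ^ (k + 1) ≤
      x * ((x / 2 : ℝ≥0) : ℝ≥0∞) ^ k := by
    intro k
    have h1 : ThetaLie (k + 1) ≤ ((1 / 2 ^ k : ℝ≥0) : ℝ≥0∞) := by
      refine (ThetaLie_le_div (Nat.le_add_left 1 k)).trans
        ((div_natCast_le _ (Nat.le_add_left 1 k)).trans
          ((Theta_le (Nat.le_add_left 1 k)).trans_eq ?_))
      rw [Nat.add_sub_cancel, ENNReal.ofReal, ENNReal.coe_inj]
      ext
      rw [Real.coe_toNNReal _ (by positivity)]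
      push_cast
      rfl
    have h2 : (1 / 2 ^ k * x ^ (k + 1) : ℝ≥0) = x * (x / 2) ^ k := by
      rw [div_pow]
      field_simp
      rw [pow_succ']
    calc ThetaLie (k + 1) * (x : ℝ≥0∞) ^ (k + 1) ≤
          ((1 / 2 ^ k : ℝ≥0) : ℝ≥0∞) * (x : ℝ≥0∞) ^ (k + 1) := by gcongr
      _ = _ := by exact_mod_cast h2
  refine lt_of_le_of_lt (ENNReal.tsum_le_tsum hterm) ?_
  rw [ENNReal.tsum_mul_left, ENNReal.tsum_geometric]
  refine ENNReal.mul_lt_top ENNReal.coe_lt_top ?_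
  rw [ENNReal.inv_lt_top, tsub_pos_iff_lt]
  exact_mod_cast hx'

/-- The coefficients are at least `4 ^ (1 - k) / k`. -/
theorem convRadius_ThetaLie_le : convRadius ThetaLie ≤ 4 := by
  refine iSup_le fun x => iSup_le fun hx => ?_
  by_contra! h
  have h4 : (4 : ℝ≥0) < x := by exact_mod_cast h
  -- At `x ≥ 4` the terms dominate those of the harmonic series.
  have hterm : ∀ k : ℕ, ENNReal.ofReal (1 / ((k : ℝ) + 1)) ≤
      ThetaLie (k + 1) * (x : ℝ≥0∞) ^ (k + 1) := by
    intro k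
    have h1 : Theta (k + 1) ≤ 2 ^ k * ThetaLie (k + 1) := Theta_le_two_pow_mul (k + 1)
    have h2 : ENNReal.ofReal (1 / (((k + 1 : ℕ) : ℝ) * 2 ^ k)) ≤ Theta (k + 1) :=
      le_Theta (Nat.le_add_left 1 k)
    have h3 : ENNReal.ofReal (1 / ((k : ℝ) + 1)) =
        ENNReal.ofReal (1 / (((k + 1 : ℕ) : ℝ) * 2 ^ k)) * 2 ^ k := by
      have : (2 : ℝ≥0∞) ^ k = ENNReal.ofReal (2 ^ k) := by
        rw [ENNReal.ofReal_pow (by norm_num)]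
        simp
      rw [this, ← ENNReal.ofReal_mul (by positivity)]
      congr 1
      push_cast
      field_simp
    have h5 : (2 : ℝ≥0∞) ^ k * 2 ^ k ≤ (x : ℝ≥0∞) ^ (k + 1) := by
      have : (2 : ℝ≥0) ^ k * 2 ^ k ≤ x ^ (k + 1) := by
        calc (2 : ℝ≥0) ^ k * 2 ^ k = 4 ^ k := by rw [← mul_pow]; norm_num
          _ ≤ 4 ^ (k + 1) := pow_le_pow_right₀ (by norm_num) (Nat.le_succ k)
          _ ≤ x ^ (k + 1) := pow_le_pow_left' h4.le _
      exact_mod_cast this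
    calc ENNReal.ofReal (1 / ((k : ℝ) + 1)) ≤ 2 ^ k * ThetaLie (k + 1) * 2 ^ k := by
          rw [h3]
          exact mul_le_mul_left (h2.trans h1) _
      _ = ThetaLie (k + 1) * (2 ^ k * 2 ^ k) := by ring
      _ ≤ _ := mul_le_mul_right h5 _
  have hfin := ((ENNReal.tsum_le_tsum hterm).trans_lt hx).ne
  have hsum := ENNReal.summable_toReal hfin
  refine Real.not_summable_one_div_natCast ((summable_nat_add_iff 1).1 ?_)
  refine hsum.congr fun k => ?_
  rw [ENNReal.toReal_ofReal (by positivity)]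
  push_cast
  rfl

theorem cumulativeRadius_Gam_le : cumulativeRadius Gam ≤ cumulativeRadius GamLie := by
  refine iSup_le fun x => iSup_le fun hx => ?_
  refine le_iSup₂_of_le (f := fun (x : ℝ≥0) (_ : (⨆ (x₁ : ℝ≥0) (x₂ : ℝ≥0) (_ : x₁ + x₂ ≤ x),
      seriesTwo GamLie x₁ x₂) < ∞) => (x : ℝ≥0∞)) x (lt_of_le_of_lt ?_ hx) le_rfl
  refine iSup_mono fun a => iSup_mono fun b => iSup_mono fun _ => ?_
  refine ENNReal.tsum_le_tsum fun n => ENNReal.tsum_le_tsum fun m => ?_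
  gcongr
  exact GamLie_le_Gam n m

theorem cumulativeRadius_le_diagonalRadius (a : ℕ → ℕ → ℝ≥0∞) :
    cumulativeRadius a ≤ diagonalRadius a := by
  refine iSup_le fun x => iSup_le fun hx => ?_
  refine le_iSup₂_of_le (f := fun (x : ℝ≥0) (_ : seriesTwo a (x / 2) (x / 2) < ∞) =>
    (x : ℝ≥0∞)) x (lt_of_le_of_lt ?_ hx) le_rfl
  exact le_iSup_of_le (x / 2) (le_iSup₂_of_le (f := fun (b : ℝ≥0) (_ : x / 2 + b ≤ x) =>
    seriesTwo a (x / 2) b) (x / 2) (add_halves x).le le_rfl)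

end Radii

end MagnusLie

theorem mainTheorem4 :
    -- Magnus expansion, commutator expansion bound
    (∀ n : ℕ, 1 ≤ n → MagnusLie.Theta n ≤ 2 ^ (n - 1) * MagnusLie.ThetaLie n) ∧
    (∀ x : ℝ≥0, 2 * MagnusLie.seriesOne MagnusLie.Theta (x / 2) ≤
      MagnusLie.seriesOne MagnusLie.ThetaLie x) ∧
    -- Magnus expansion, Dynkin–Specht–Wever bound
    (∀ n : ℕ, 1 ≤ n → MagnusLie.ThetaLie n ≤ MagnusLie.Theta n / (n : ℝ≥0∞)) ∧
    (∀ x : ℝ≥0, MagnusLie.seriesOne MagnusLie.ThetaLie x ≤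
      ∫⁻ t in Set.Ioc (0 : ℝ) 1,
        MagnusLie.seriesOne MagnusLie.Theta (x * t.toNNReal) / ENNReal.ofReal t) ∧
    (∀ x : ℝ≥0,
      ∫⁻ t in Set.Ioc (0 : ℝ) 1,
        MagnusLie.seriesOne MagnusLie.Theta (x * t.toNNReal) / ENNReal.ofReal t =
      ∫⁻ t in Set.Ioc (0 : ℝ) (x : ℝ),
        MagnusLie.seriesOne MagnusLie.Theta t.toNNReal / ENNReal.ofReal t) ∧
    -- the Lie cumulative radius of the Magnus expansion
    (2 ≤ MagnusLie.convRadius MagnusLie.ThetaLie ∧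
      MagnusLie.convRadius MagnusLie.ThetaLie ≤ 4) ∧
    -- BCH expansion, commutator expansion bound
    (∀ n m : ℕ, 1 ≤ n + m →
      MagnusLie.Gam n m ≤ 2 ^ (n + m - 1) * MagnusLie.GamLie n m) ∧
    (∀ x y : ℝ≥0, 2 * MagnusLie.seriesTwo MagnusLie.Gam (x / 2) (y / 2) ≤
      MagnusLie.seriesTwo MagnusLie.GamLie x y) ∧
    -- BCH expansion, Dynkin–Specht–Wever bound
    (∀ n m : ℕ, 1 ≤ n + m →
      MagnusLie.GamLie n m ≤ MagnusLie.Gam n m / ((n + m : ℕ) : ℝ≥0∞)) ∧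
    (∀ x y : ℝ≥0, MagnusLie.seriesTwo MagnusLie.GamLie x y ≤
      ∫⁻ t in Set.Ioc (0 : ℝ) 1,
        MagnusLie.seriesTwo MagnusLie.Gam (x * t.toNNReal) (y * t.toNNReal) /
          ENNReal.ofReal t) ∧
    -- the convergence radii of the BCH expansion
    (MagnusLie.cumulativeRadius MagnusLie.Gam ≤
        MagnusLie.cumulativeRadius MagnusLie.GamLie ∧
      MagnusLie.cumulativeRadius MagnusLie.GamLie ≤
        MagnusLie.diagonalRadius MagnusLie.GamLie ∧
      MagnusLie.diagonalRadius MagnusLie.GamLie ≤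
        2 * MagnusLie.cumulativeRadius MagnusLie.Gam) := by
  open MagnusLie in
  exact ⟨fun n _ => Theta_le_two_pow_mul n, two_mul_seriesOne_Theta_le,
    fun _ hn => ThetaLie_le_div hn, seriesOne_ThetaLie_le, lintegral_seriesOne_eq Theta,
    ⟨two_le_convRadius_ThetaLie, convRadius_ThetaLie_le⟩,
    fun n m _ => Gam_le_two_pow_mul n m, two_mul_seriesTwo_Gam_le,
    fun _ _ h => GamLie_le_div h, seriesTwo_GamLie_le,
    cumulativeRadius_Gam_le, cumulativeRadius_le_diagonalRadius GamLie, diagonalRadius_GamLie_le⟩
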